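/- **Setting.** Let $\mathcal M=(\mathcal S,\mathcal A,r,c,P,\rho)$ be a finite constrained Markov decision process with $r:\mathcal S\times\mathcal A\to[0,1]$, $c:\mathcal S\times\mathcal A\to[-1,1]$, transition law $P$ and initial distribution $\rho$, such that under every policy the induced Markov chain on $\mathcal S$ is irreducible and aperiodic. Let $\{\pi_\theta\}_{\theta\in\mathbb R^d}$ be a class of policies, $\Theta\subseteq\mathbb R^d$, and let $\phi_g:\mathcal S\to\mathbb R^m$, $\|\phi_g(s)\|\le 1$, be feature maps, $g\in\{r,c\}$. Let $P^{\pi_\theta}(s,s')=\sum_a\pi_\theta(a|s)P(s'|s,a)$, let $d^{\pi_\theta}$ be its stationary distribution, and let $\mathbb E_\theta$ be the expectation over $z=(s,a,s')$ with $s\sim d^{\pi_\theta}$, $a\sim\pi_\theta(\cdot|s)$, $s'\sim P(\cdot|s,a)$. Let $\tau_{\mathrm{mix}}=\sup_{\theta\in\Theta}\min\{t\ge1:\ \|(P^{\pi_\theta})^t(s,\cdot)-d^{\pi_\theta}\|_{\mathrm{TV}}\le\frac14\ \forall s\}$. Assume that, for some $\lambda>0$, $\mathbb E_\theta[\phi_g(s)(\phi_g(s)-\phi_g(s'))^\top]-\lambda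 I$ is positive semidefinite (as a quadratic form) for all $\theta\in\Theta$, $g\in\{r,c\}$. For a constant $c_\gamma$ put $$\mathbf A_g(z)=\begin{pmatrix}c_\gamma&0\\ \phi_g(s)&\phi_g(s)(\phi_g(s)-\phi_g(s'))^\top\end{pmatrix},\qquad \mathbf b_g(z)=\begin{pmatrix}c_\gamma\, g(s,a)\\ g(s,a)\phi_g(s)\end{pmatrix},$$ $\mathbf A_g(\theta)=\mathbb E_\theta[\mathbf A_g(z)]$, $\mathbf b_g(\theta)=\mathbb E_\theta[\mathbf b_g(z)]$ and $\xi_g^*(\theta)=\mathbf A_g(\theta)^{-1}\mathbf b_g(\theta)\in\mathbb R^{1+m}$. **Algorithm.** For a function $f$ of transitions, an *MLMC estimate* of $f$ draws $Q\sim\mathrm{Geom}(1/2)$ on $\{1,2,\dots\}$ and then, from the current state, a $\pi_{\theta_k}$-trajectory $z^0,z^1,\dots$ of length $2^Q$ if $2^Q\le T_{\max}$ and of length $1$ otherwise; it is $f^0+2^Q(f^Q-f^{Q-1})\mathbf 1\{2^Q\le T_{\max}\}$ with $f^j=2^{-j}\sum_{t<2^j}f(z^t)$. The last state of the trajectory is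 the next current state; the first one is drawn from $\rho$. The primal-dual natural actor-critic algorithm starts from some $\theta_0$ and from $\lambda_0=0$, and runs $K$ epochs. Epoch $k$ consists of: 1. (critic) $H$ steps $\xi_{g,h+1}^k=\xi_{g,h}^k-\gamma_\xi v_{g,h}$ from $\xi_{g,0}^k=0$, $v_{g,h}$ being the MLMC estimate of $\mathbf A_g(z)\xi_{g,h}^k-\mathbf b_g(z)$ (the same trajectory for $g=r,c$); its output is $\xi_g^k=\xi_{g,H}^k=[\eta_g^k,\zeta_g^k]$; 2. (actor) $H$ steps $\omega_{g,h+1}^k=\omega_{g,h}^k-\gamma_\omega u_{g,h}$ from $\omega_{g,0}^k=0$, $u_{g,h}$ being the MLMC estimate of $\nabla\log\pi_{\theta_k}(a|s)\big(\langle\nabla\log\pi_{\theta_k}(a|s),\omega_{g,h}^k\rangle-[g(s,a)-\eta_g^k+\langle\zeta_g^k,\phi_g(s')-\phi_g(s)\rangle]\big)$; its output is $\omega_g^k=\omega_{g,H}^k$; 3. $\theta_{k+1}=\theta_k+\alpha(\omega_r^k+\lambda_k\omega_c^k)$, and $\lambda_{k+1}$ is the projection of $\lambda_k-\beta\eta_c^k$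 onto $[0,2/\delta]$, where $\delta\in(0,1)$. Assume that $\theta_k\in\Theta$ almost surely for all $k<K$, and let $\mathbb E_k$ be the conditional expectation given the history before epoch $k$. **Theorem.** There are universal constants $p\in\mathbb N$ and $\kappa$ such that for all $\lambda>0$ and all sufficiently large $c_\gamma$, namely $c_\gamma\ge\kappa(\lambda+1/\lambda)$, there is a constant $C>0$, depending only on $\lambda$ and $c_\gamma$, such that the following holds in every such setting, for all integers $K\ge 0$, $T,H\ge1$ and $T_{\max}$ and all values of the other inputs of the algorithm. If $$\gamma_\xi=\frac{2\log T}{\lambda H}\le\frac{\lambda}{24c_\gamma^2\tau_{\mathrm{mix}}\log T_{\max}},\qquad T_{\max}\ge\frac{8c_\gamma^2\tau_{\mathrm{mix}}}{\lambda},$$ then $\mathbf A_g(\theta)$ is invertible for $\theta\in\Theta$, $\xi_g^k$ and $\|\xi_g^k-\xi_g^*(\theta_k)\|^2$ are integrable, and, with $L=[(1+\log T)(1+\log T_{\max})]^p$, for both $g\in\{r,c\}$ and all $k\in\{0,\dots,K-1\}$, almost surely $$\big\|\mathbb E_k[\xi_g^k]-\xi_g^*(\theta_k)\big\|^2\le C\,L\left(\frac1{T^2}+\frac{\tau_{\mathrm{mix}}^2}{T_{\max}}\right),\qquad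 \mathbb E_k\big[\|\xi_g^k-\xi_g^*(\theta_k)\|^2\big]\le C\,L\left(\frac1{T^2}+\frac{\tau_{\mathrm{mix}}}{H}+\frac{\tau_{\mathrm{mix}}}{T_{\max}}\right).$$ -/

import Mathlib

open MeasureTheory ProbabilityTheory
open scoped Matrix

noncomputable section

namespace PDNAC

/-- The two scalar signals of a constrained MDP: the reward `r` and the constraint cost `c`. -/
inductive Signal where
  | r
  | c

/-- A constrained Markov decision process with reward `r : S × A → [0, 1]`, constraint cost
`c : S × A → [-1, 1]`, transition law `P` and initial state distribution `ρ`. -/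
structure CMDP (S A : Type*) where
  r : S → A → ℝ
  c : S → A → ℝ
  P : S → A → PMF S
  ρ : PMF S
  r_mem : ∀ s a, r s a ∈ Set.Icc (0 : ℝ) 1
  c_mem : ∀ s a, c s a ∈ Set.Icc (-1 : ℝ) 1

/-- A transition `z = (s, a, s')`. -/
abbrev Transition (S A : Type*) := S × A × S

/-- The space `ℝ ^ (1 + m)` of critic parameters `ξ = [η, ζ]`; the coordinate `Sum.inl ()` is the
average-reward estimate `η`, the coordinates `Sum.inr i` form the value-function weights `ζ`. -/
abbrev CriticSpace (m : ℕ) := EuclideanSpace ℝ (Unit ⊕ Fin m)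

/-- The space `ℝ ^ d` of policy parameters. -/
abbrev ParamSpace (d : ℕ) := EuclideanSpace ℝ (Fin d)

namespace CMDP

variable {S A : Type*} (M : CMDP S A)

/-- The signal `g ∈ {r, c}` as a function on state-action pairs. -/
def signal : Signal → S → A → ℝ
  | Signal.r => M.r
  | Signal.c => M.c

section Chain

variable [Fintype S] [Fintype A]

/-- The state transition matrix `P^π(s, s') = ∑ a, π(a | s) P(s' | s, a)`. -/
def transitionMatrix (π : S → PMF A) : Matrix S S ℝ :=
  Matrix.of fun s s' => ∑ a, (π s a).toReal * (M.P s a s').toReal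

/-- `q` is a stationary distribution of the chain induced by `π`. -/
def IsStationary (π : S → PMF A) (q : S → ℝ) : Prop :=
  (∀ s, 0 ≤ q s) ∧ ∑ s, q s = 1 ∧ q ᵥ* M.transitionMatrix π = q

/-- The stationary distribution `d^π`. It exists because `S` is finite, and it is unique when the
chain is irreducible. -/
def stationary (π : S → PMF A) : S → ℝ :=
  Classical.epsilon (M.IsStationary π)

/-- `E_π[f(z)]` for `z = (s, a, s')` with `s ∼ d^π`, `a ∼ π(s)`, `s' ∼ P(s, a)`. -/
def stationaryMean {V : Type*} [AddCommGroup V] [Module ℝ V] (π : S → PMF A)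
    (f : Transition S A → V) : V :=
  ∑ s, ∑ a, ∑ s', (M.stationary π s * (π s a).toReal * (M.P s a s').toReal) • f (s, a, s')

variable [DecidableEq S]

/-- Under every policy the induced chain on `S` is irreducible and aperiodic (no integer other
than `1` divides all the return times of a state). -/
def Ergodic : Prop :=
  ∀ π : S → PMF A, (M.transitionMatrix π).IsIrreducible ∧
    ∀ (s : S) (p : ℕ),
      (∀ n : ℕ, 1 ≤ n → 0 < (M.transitionMatrix π ^ n) s s → p ∣ n) → p = 1

/-- The mixing time of the chain induced by `π`: the least `t ≥ 1` such that the law at time `t`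
is within total variation distance `1/4` of `d^π`, for every initial state. -/
def mixingTime (π : S → PMF A) : ℕ :=
  sInf {t : ℕ | 1 ≤ t ∧
    ∀ s, (1 / 2 : ℝ) * ∑ s', |(M.transitionMatrix π ^ t) s s' - M.stationary π s'| ≤ 1 / 4}

/-- The overall mixing time `τ_mix`, the supremum of the mixing times over the parameter set. -/
def tauMix {d : ℕ} (π : ParamSpace d → S → PMF A) (Θ : Set (ParamSpace d)) : ℕ :=
  ⨆ θ : Θ, M.mixingTime (π θ)

end Chain

section Critic

variable {m : ℕ} (φ : Signal → S → EuclideanSpace ℝ (Fin m)) (cγ : ℝ)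

/-- The one-sample matrix `A_g(z)`, with blocks `c_γ`, `0`, `φ_g(s)` and
`φ_g(s) (φ_g(s) - φ_g(s'))ᵀ`. -/
def criticMatrixAt (g : Signal) (z : Transition S A) :
    Matrix (Unit ⊕ Fin m) (Unit ⊕ Fin m) ℝ :=
  Matrix.fromBlocks
    (Matrix.of fun _ _ => cγ) 0
    (Matrix.of fun i _ => φ g z.1 i)
    (Matrix.of fun i j => φ g z.1 i * (φ g z.1 j - φ g z.2.2 j))

/-- The one-sample vector `b_g(z) = [c_γ g(s, a), g(s, a) φ_g(s)]`. -/
def criticVectorAt (g : Signal) (z : Transition S A) : Unit ⊕ Fin m → ℝ :=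
  Sum.elim (fun _ => cγ * M.signal g z.1 z.2.1)
    (fun i => M.signal g z.1 z.2.1 * φ g z.1 i)

/-- The one-sample critic direction `v_g(ξ; z) = A_g(z) ξ - b_g(z)`. -/
def criticDirectionAt (g : Signal) (ξ : CriticSpace m) (z : Transition S A) : CriticSpace m :=
  WithLp.toLp 2
    (criticMatrixAt φ cγ g z *ᵥ (fun i => ξ i) - M.criticVectorAt φ cγ g z)

variable [Fintype S] [Fintype A]

/-- `A_g = E_π[A_g(z)]`. -/
def criticMatrix (π : S → PMF A) (g : Signal) : Matrix (Unit ⊕ Fin m) (Unit ⊕ Fin m) ℝ :=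
  M.stationaryMean π (criticMatrixAt φ cγ g)

/-- `b_g = E_π[b_g(z)]`. -/
def criticVector (π : S → PMF A) (g : Signal) : Unit ⊕ Fin m → ℝ :=
  M.stationaryMean π (M.criticVectorAt φ cγ g)

/-- The target `ξ_g^* = A_g⁻¹ b_g`. -/
def criticTarget (π : S → PMF A) (g : Signal) : CriticSpace m :=
  WithLp.toLp 2 ((M.criticMatrix φ cγ π g)⁻¹ *ᵥ M.criticVector φ cγ π g)

/-- `E_θ[φ_g(s) (φ_g(s) - φ_g(s'))ᵀ] - lam I` is positive semidefinite as a quadratic form (the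
matrix need not be symmetric), for all `θ ∈ Θ` and both signals. -/
def CriticPositive {d : ℕ} (π : ParamSpace d → S → PMF A) (Θ : Set (ParamSpace d))
    (lam : ℝ) : Prop :=
  ∀ θ ∈ Θ, ∀ (g : Signal) (x : Fin m → ℝ),
    0 ≤ x ⬝ᵥ ((M.stationaryMean (π θ) (fun z : Transition S A =>
        Matrix.vecMulVec (fun i => φ g z.1 i) (fun j => φ g z.1 j - φ g z.2.2 j))
      - lam • (1 : Matrix (Fin m) (Fin m) ℝ)) *ᵥ x)

end Critic

end CMDP

/-! ### Multi-level Monte Carlo sampling -/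

/-- The geometric law with parameter `1/2` on `{1, 2, 3, …}`. -/
def levelLaw : PMF ℕ :=
  (geometricMeasure ⟨1 / 2, by norm_num, by norm_num⟩).toPMF.map (· + 1)

/-- Length of the trajectory drawn at level `q`: `2 ^ q` if `2 ^ q ≤ T_max`, and `1` otherwise. -/
def trajLength (Tmax q : ℕ) : ℕ := if 2 ^ q ≤ Tmax then 2 ^ q else 1

/-- The average `2 ^ (-j) ∑_{t < 2 ^ j} f(z_t)`. -/
def levelMean {Z V : Type*} [AddCommGroup V] [Module ℝ V] (f : Z → V) (zs : List Z)
    (j : ℕ) : V :=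
  ((2 : ℝ) ^ j)⁻¹ • ((zs.take (2 ^ j)).map f).sum

/-- The multi-level Monte Carlo estimate from a trajectory `zs` drawn at level `q`. -/
def mlmc {Z V : Type*} [AddCommGroup V] [Module ℝ V] (Tmax : ℕ) (f : Z → V) (q : ℕ)
    (zs : List Z) : V :=
  levelMean f zs 0 +
    if 2 ^ q ≤ Tmax then (2 : ℝ) ^ q • (levelMean f zs q - levelMean f zs (q - 1)) else 0

/-- The data of one inner-loop step: the random level and the trajectory. -/
abbrev InnerSample (S A : Type*) := ℕ × List (Transition S A)

/-- The data of one epoch: the inner-loop steps of the critic, then those of the actor. -/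
abbrev EpochSample (S A : Type*) := List (InnerSample S A) × List (InnerSample S A)

/-- A run of the algorithm: the initial state and the data of the successive epochs. All iterates
are functions of a run. -/
def Run (S A : Type*) := S × List (EpochSample S A)

instance (S A : Type*) : MeasurableSpace (Run S A) := ⊤

/-- Last state of a trajectory that starts at `s`. -/
def trajEnd {S A : Type*} (s : S) (zs : List (Transition S A)) : S :=
  zs.foldl (fun _ z => z.2.2) s

/-- Last state of a succession of inner-loop steps that starts at `s`. -/
def innerEnd {S A : Type*} (s : S) (xs : List (InnerSample S A)) : S :=
  xs.foldl (fun s x => trajEnd s x.2) s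

/-- The law of the first `n` transitions from `s` under the policy `π`. -/
def CMDP.trajLaw {S A : Type*} (M : CMDP S A) (π : S → PMF A) :
    ℕ → S → PMF (List (Transition S A))
  | 0, _ => PMF.pure []
  | n + 1, s =>
      (π s).bind fun a => (M.P s a).bind fun s' =>
        (M.trajLaw π n s').map fun zs => (s, a, s') :: zs

/-- The law of `n` inner-loop steps: each draws a level and a trajectory that starts where the
previous trajectory ended. -/
def CMDP.innerLaw {S A : Type*} (M : CMDP S A) (π : S → PMF A) (Tmax : ℕ) :
    ℕ → S → PMF (List (InnerSample S A))
  | 0, _ => PMF.pure []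
  | n + 1, s =>
      levelLaw.bind fun q => (M.trajLaw π (trajLength Tmax q) s).bind fun zs =>
        (M.innerLaw π Tmax n (trajEnd s zs)).map fun xs => (q, zs) :: xs

/-! ### The primal-dual natural actor-critic algorithm -/

/-- The inputs of the algorithm besides the CMDP: policy class, critic features, initial
parameter, step sizes, the constant `c_γ`, Slater parameter `δ`, inner loop size `H`, `T_max`. -/
structure Algorithm (S A : Type*) (m d : ℕ) where
  π : ParamSpace d → S → PMF A
  φ : Signal → S → EuclideanSpace ℝ (Fin m)
  θ₀ : ParamSpace d
  α : ℝ
  β : ℝ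
  γω : ℝ
  γξ : ℝ
  cγ : ℝ
  δ : ℝ
  H : ℕ
  Tmax : ℕ

/-- What an epoch starts from: the primal and dual parameters and the current state. -/
structure EpochState (S : Type*) (d : ℕ) where
  θ : ParamSpace d
  dual : ℝ
  state : S

namespace Algorithm

variable {S A : Type*} {m d : ℕ} (alg : Algorithm S A m d) (M : CMDP S A)

/-- The critic parameter after the given inner-loop steps, starting from `0`:
`ξ_{h+1} = ξ_h - γ_ξ v_g(ξ_h)` with the MLMC estimate `v_g(ξ_h)`. -/
def criticIterate (g : Signal) (xs : List (InnerSample S A)) : CriticSpace m :=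
  xs.foldl (fun ξ x =>
    ξ - alg.γξ • mlmc alg.Tmax (M.criticDirectionAt alg.φ alg.cγ g ξ) x.1 x.2) 0

/-- The score `∇_θ log π_θ(a | s)`. -/
def score (θ : ParamSpace d) (s : S) (a : A) : ParamSpace d :=
  gradient (fun ϑ => Real.log (alg.π ϑ s a).toReal) θ

/-- The one-sample estimate of the gradient of the natural policy gradient objective,
`F(z) ω - [g(s, a) - η + ⟨ζ, φ_g(s') - φ_g(s)⟩] ∇ log π_θ(a | s)`. -/
def actorDirectionAt (g : Signal) (θ : ParamSpace d) (ξ : CriticSpace m) (w : ParamSpace d)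
    (z : Transition S A) : ParamSpace d :=
  inner ℝ (alg.score θ z.1 z.2.1) w • alg.score θ z.1 z.2.1 -
    (M.signal g z.1 z.2.1 - ξ (Sum.inl ()) +
      ∑ i, ξ (Sum.inr i) * (alg.φ g z.2.2 i - alg.φ g z.1 i)) • alg.score θ z.1 z.2.1

/-- The natural policy gradient estimate after the given inner-loop steps, starting from `0`. -/
def actorIterate (g : Signal) (θ : ParamSpace d) (ξ : CriticSpace m)
    (xs : List (InnerSample S A)) : ParamSpace d :=
  xs.foldl (fun w x =>
    w - alg.γω • mlmc alg.Tmax (alg.actorDirectionAt M g θ ξ w) x.1 x.2) 0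

/-- The update at the end of an epoch: `θ ← θ + α (ω_r + λ ω_c)` and
`λ ← Proj_{[0, 2/δ]} (λ - β η_c)`. -/
def epochUpdate (x : EpochState S d) (e : EpochSample S A) : EpochState S d where
  θ := x.θ + alg.α •
    (alg.actorIterate M Signal.r x.θ (alg.criticIterate M Signal.r e.1) e.2 +
      x.dual • alg.actorIterate M Signal.c x.θ (alg.criticIterate M Signal.c e.1) e.2)
  dual := max 0 (min (2 / alg.δ)
    (x.dual - alg.β * alg.criticIterate M Signal.c e.1 (Sum.inl ())))
  state := innerEnd (innerEnd x.state e.1) e.2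

/-- The epoch state reached after the given epochs, from `θ₀`, `λ₀ = 0` and the state `s`. -/
def stateAfter (s : S) (es : List (EpochSample S A)) : EpochState S d :=
  es.foldl (alg.epochUpdate M) ⟨alg.θ₀, 0, s⟩

/-- The law of the data of one epoch. -/
def epochLaw (x : EpochState S d) : PMF (EpochSample S A) :=
  (M.innerLaw (alg.π x.θ) alg.Tmax alg.H x.state).bind fun cs =>
    (M.innerLaw (alg.π x.θ) alg.Tmax alg.H (innerEnd x.state cs)).map fun as => (cs, as)

/-- The law of a run of `K` epochs. -/
def runLaw : ℕ → PMF (Run S A)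
  | 0 => M.ρ.map fun s => (s, [])
  | k + 1 => (runLaw k).bind fun ω =>
      (alg.epochLaw M (alg.stateAfter M ω.1 ω.2)).map fun e => (ω.1, ω.2 ++ [e])

/-- The probability measure on runs of `K` epochs. -/
def runMeasure (K : ℕ) : Measure (Run S A) := (alg.runLaw M K).toMeasure

/-- The policy parameter `θ_k` at the start of epoch `k`. -/
def theta (k : ℕ) (ω : Run S A) : ParamSpace d :=
  (alg.stateAfter M ω.1 (ω.2.take k)).θ

/-- The critic output `ξ_g^k` of epoch `k`. -/
def xi (g : Signal) (k : ℕ) (ω : Run S A) : CriticSpace m :=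
  alg.criticIterate M g (ω.2.getD k ([], [])).1

end Algorithm

/-- The history up to epoch `k`: the σ-algebra generated by the initial state and the data of
the epochs `0, …, k - 1`. -/
@[reducible]
def history (S A : Type*) (k : ℕ) : MeasurableSpace (Run S A) :=
  MeasurableSpace.comap (fun ω : Run S A => (ω.1, ω.2.take k)) ⊤

end PDNAC

end

open MeasureTheory ProbabilityTheory
open scoped Matrix

noncomputable section

namespace PDNAC

set_option linter.unusedSectionVars false

/-! Fix an epoch and put `e_h = ξ_h - ξ^*`. Since `A ξ^* = b`, the mean update direction at `ξ_h` is
`A e_h` up to a bias, so the critic loop is a noisy linear recursion driven by `A`. For large `c_γ`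
the matrix `A` is coercive with constant `7/8 * lam` (`le_inner_criticOp`): the only off-diagonal
block couples `η` to `ζ`, and `c_γ` absorbs it. Coercivity yields the invertibility of `A`, a bound
on `ξ^*`, and a contraction factor `1 - γ lam` per step.

The noise is controlled through mixing. For a centred function of the transitions, the conditional
means along the chain halve every mixing time, so they sum to `O(τ)` (`sum_norm_act_pow_le`). Hence
a sum of `n` centred terms has mean `O(τ)` and second moment `O(nτ)`. In the multi-level estimate
the weight `2 ^ (-q)` cancels the factor `2 ^ q`. The mean then telescopes to that of the longest
average, with bias `O(τ / T_max)` (`norm_mean_stepLaw_mlmc_sub_le`). In the second moment each level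
costs `O(τ)`, which gives `O(τ log T_max)` (`mean_stepLaw_mlmc_norm_sq_le`). These bounds are
uniform in the initial state, so they hold conditionally on all earlier steps although the
trajectories are concatenated.

Expanding the square gives a contraction for `E‖e_h‖²` with residual level of order `(τ / T_max)² +
γ τ log T_max` (`mean_criticError_sq_le`). For the bias, linearity of `A` shows that the mean error
obeys the same recursion driven by the averaged bias alone; the variance drops out, and the second
moment bound controls that average (`norm_mean_criticError_sq_le`). The choice of `γ` makes `(1 - γ
lam) ^ H ≤ 1 / T²`.

All laws are discrete, so expectations are the sums `mean`. `condExp_history` identifies the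
conditional expectation given the history with the mean over the law of the next epoch, which
transfers the one-epoch bounds to the run. -/

/-! ### Means of bounded functions under discrete laws -/

section Mean

variable {α β V W : Type*} [NormedAddCommGroup V] [NormedSpace ℝ V]
  [NormedAddCommGroup W] [NormedSpace ℝ W]

/-- The mean of `f` under the discrete law `p`. -/
def mean (p : PMF α) (f : α → V) : V := ∑' a, (p a).toReal • f a

/-- `f` is bounded on the support of `p`. -/
def BddOn (p : PMF α) (f : α → V) : Prop := ∃ C : ℝ, ∀ a ∈ p.support, ‖f a‖ ≤ C

lemma hasSum_toReal (p : PMF α) : HasSum (fun a => (p a).toReal) 1 := by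
  have h : ∑' a, p a ≠ ⊤ := by simp [p.tsum_coe]
  have := ENNReal.hasSum_toReal h
  rwa [← ENNReal.tsum_toReal_eq (ENNReal.ne_top_of_tsum_ne_top h), p.tsum_coe,
    ENNReal.toReal_one] at this

lemma norm_toReal_smul_le {p : PMF α} {f : α → V} {C : ℝ} (h : ∀ a ∈ p.support, ‖f a‖ ≤ C)
    (a : α) : ‖(p a).toReal • f a‖ ≤ (p a).toReal * C := by
  by_cases ha : p a = 0
  · simp [ha]
  · rw [norm_smul, Real.norm_of_nonneg ENNReal.toReal_nonneg]
    exact mul_le_mul_of_nonneg_left (h a ((p.mem_support_iff a).2 ha)) ENNReal.toReal_nonneg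

lemma BddOn.of_forall {p : PMF α} {f : α → V} (C : ℝ) (h : ∀ a, ‖f a‖ ≤ C) : BddOn p f :=
  ⟨C, fun a _ => h a⟩

lemma BddOn.const (p : PMF α) (c : V) : BddOn p fun _ => c := ⟨‖c‖, fun _ _ => le_rfl⟩

lemma BddOn.add {p : PMF α} {f g : α → V} (hf : BddOn p f) (hg : BddOn p g) :
    BddOn p fun a => f a + g a := by
  obtain ⟨C, hC⟩ := hf
  obtain ⟨D, hD⟩ := hg
  exact ⟨C + D, fun a ha => (norm_add_le _ _).trans (add_le_add (hC a ha) (hD a ha))⟩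

lemma BddOn.sub {p : PMF α} {f g : α → V} (hf : BddOn p f) (hg : BddOn p g) :
    BddOn p fun a => f a - g a := by
  obtain ⟨C, hC⟩ := hf
  obtain ⟨D, hD⟩ := hg
  exact ⟨C + D, fun a ha => (norm_sub_le _ _).trans (add_le_add (hC a ha) (hD a ha))⟩

lemma BddOn.const_smul {p : PMF α} {f : α → V} (c : ℝ) (hf : BddOn p f) :
    BddOn p fun a => c • f a := by
  obtain ⟨C, hC⟩ := hf
  refine ⟨|c| * C, fun a ha => ?_⟩
  rw [norm_smul]
  exact mul_le_mul_of_nonneg_left (hC a ha) (abs_nonneg c)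

lemma BddOn.const_mul {p : PMF α} {f : α → ℝ} (c : ℝ) (hf : BddOn p f) :
    BddOn p fun a => c * f a := hf.const_smul c

lemma BddOn.clm {p : PMF α} {f : α → V} (L : V →L[ℝ] W) (hf : BddOn p f) :
    BddOn p fun a => L (f a) := by
  obtain ⟨C, hC⟩ := hf
  exact ⟨‖L‖ * C, fun a ha => (L.le_opNorm _).trans
    (mul_le_mul_of_nonneg_left (hC a ha) (norm_nonneg _))⟩

lemma BddOn.norm {p : PMF α} {f : α → V} (hf : BddOn p f) : BddOn p fun a => ‖f a‖ := by
  obtain ⟨C, hC⟩ := hf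
  exact ⟨C, fun a ha => by simpa using hC a ha⟩

lemma BddOn.norm_sq {p : PMF α} {f : α → V} (hf : BddOn p f) : BddOn p fun a => ‖f a‖ ^ 2 := by
  obtain ⟨C, hC⟩ := hf
  refine ⟨C ^ 2, fun a ha => ?_⟩
  rw [Real.norm_of_nonneg (sq_nonneg _)]
  exact pow_le_pow_left₀ (norm_nonneg _) (hC a ha) 2

lemma BddOn.of_bind {p : PMF α} {k : α → PMF β} {f : β → V} (h : BddOn (p.bind k) f)
    {a : α} (ha : a ∈ p.support) : BddOn (k a) f := by
  obtain ⟨C, hC⟩ := h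
  exact ⟨C, fun b hb => hC b ((PMF.mem_support_bind_iff p k b).2 ⟨a, ha, hb⟩)⟩

lemma BddOn.of_map {p : PMF α} {k : α → β} {f : β → V} (h : BddOn (p.map k) f) :
    BddOn p fun a => f (k a) := by
  obtain ⟨C, hC⟩ := h
  exact ⟨C, fun a ha => hC _ ((PMF.mem_support_map_iff k p _).2 ⟨a, ha, rfl⟩)⟩

lemma BddOn.map {p : PMF α} {k : α → β} {f : β → V} (h : BddOn p fun a => f (k a)) :
    BddOn (p.map k) f := by
  obtain ⟨C, hC⟩ := h
  refine ⟨C, fun b hb => ?_⟩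
  obtain ⟨a, ha, rfl⟩ := (PMF.mem_support_map_iff k p _).1 hb
  exact hC a ha

lemma mean_congr {p : PMF α} {f g : α → V} (h : ∀ a ∈ p.support, f a = g a) :
    mean p f = mean p g := by
  refine tsum_congr fun a => ?_
  by_cases ha : p a = 0
  · simp [ha]
  · rw [h a ((p.mem_support_iff a).2 ha)]

lemma mean_pure (a : α) (f : α → V) : mean (PMF.pure a) f = f a := by
  rw [mean, tsum_eq_single a]
  · simp
  · intro b hb
    simp [PMF.pure_apply, hb]

lemma mean_fintype [Fintype α] (p : PMF α) (f : α → V) : mean p f = ∑ a, (p a).toReal • f a :=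
  tsum_fintype _

variable [CompleteSpace V] [CompleteSpace W]

lemma BddOn.summable {p : PMF α} {f : α → V} (h : BddOn p f) :
    Summable fun a => (p a).toReal • f a := by
  obtain ⟨C, hC⟩ := h
  exact Summable.of_norm_bounded ((hasSum_toReal p).summable.mul_right C)
    (norm_toReal_smul_le hC)

lemma norm_mean_le {p : PMF α} {f : α → V} {C : ℝ} (h : ∀ a ∈ p.support, ‖f a‖ ≤ C) :
    ‖mean p f‖ ≤ C := by
  have := tsum_of_norm_bounded ((hasSum_toReal p).mul_right C) (norm_toReal_smul_le h)
  rwa [one_mul] at this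

lemma mean_const (p : PMF α) (c : V) : mean p (fun _ => c) = c := by
  have := (hasSum_toReal p).smul_const c
  rw [one_smul] at this
  exact this.tsum_eq

lemma mean_add {p : PMF α} {f g : α → V} (hf : BddOn p f) (hg : BddOn p g) :
    mean p (fun a => f a + g a) = mean p f + mean p g := by
  simp only [mean, smul_add]
  exact hf.summable.tsum_add hg.summable

lemma mean_sub {p : PMF α} {f g : α → V} (hf : BddOn p f) (hg : BddOn p g) :
    mean p (fun a => f a - g a) = mean p f - mean p g := by
  simp only [mean, smul_sub]
  exact hf.summable.tsum_sub hg.summable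

lemma mean_clm {p : PMF α} {f : α → V} (L : V →L[ℝ] W) (hf : BddOn p f) :
    mean p (fun a => L (f a)) = L (mean p f) := by
  simp only [mean]
  rw [L.map_tsum hf.summable]
  simp

lemma mean_smul {p : PMF α} {f : α → V} (c : ℝ) (hf : BddOn p f) :
    mean p (fun a => c • f a) = c • mean p f :=
  mean_clm (c • ContinuousLinearMap.id ℝ V) hf

lemma mean_mul {p : PMF α} {f : α → ℝ} (c : ℝ) (hf : BddOn p f) :
    mean p (fun a => c * f a) = c * mean p f := mean_smul c hf

lemma mean_mono {p : PMF α} {f g : α → ℝ} (hf : BddOn p f) (hg : BddOn p g)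
    (h : ∀ a ∈ p.support, f a ≤ g a) : mean p f ≤ mean p g := by
  refine hf.summable.tsum_le_tsum (fun a => ?_) hg.summable
  by_cases ha : p a = 0
  · simp [ha]
  · exact mul_le_mul_of_nonneg_left (h a ((p.mem_support_iff a).2 ha)) ENNReal.toReal_nonneg

lemma mean_le {p : PMF α} {f : α → ℝ} {C : ℝ} (hf : BddOn p f)
    (h : ∀ a ∈ p.support, f a ≤ C) : mean p f ≤ C :=
  (mean_mono hf (BddOn.const p C) h).trans_eq (mean_const p C)

lemma norm_mean_le_mean_norm {p : PMF α} {f : α → V} (hf : BddOn p f) :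
    ‖mean p f‖ ≤ mean p fun a => ‖f a‖ := by
  refine tsum_of_norm_bounded hf.norm.summable.hasSum fun a => ?_
  rw [norm_smul, Real.norm_of_nonneg ENNReal.toReal_nonneg, smul_eq_mul]

lemma BddOn.mean_bind {p : PMF α} {k : α → PMF β} {f : β → V} (h : BddOn (p.bind k) f) :
    BddOn p fun a => mean (k a) f := by
  obtain ⟨C, hC⟩ := h
  exact ⟨C, fun a ha => norm_mean_le fun b hb =>
    hC b ((PMF.mem_support_bind_iff p k b).2 ⟨a, ha, hb⟩)⟩

lemma mean_bind {p : PMF α} {k : α → PMF β} {f : β → V} (h : BddOn (p.bind k) f) :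
    mean (p.bind k) f = mean p fun a => mean (k a) f := by
  obtain ⟨C, hC⟩ := h
  -- The joint weights have total mass one, and a nonzero joint weight puts the second coordinate in
  -- the support of the bind, where `f` is bounded. This gives the absolute summability that allows
  -- exchanging the sums.
  have hs : Summable (fun x : α × β => (p x.1 * k x.1 x.2).toReal) := by
    apply ENNReal.summable_toReal
    rw [ENNReal.tsum_prod']
    simp [ENNReal.tsum_mul_left, PMF.tsum_coe]
  have hF : Summable (Function.uncurry fun (a : α) (b : β) => (p a * k a b).toReal • f b) := by
    refine Summable.of_norm_bounded (hs.mul_right C) fun x => ?_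
    by_cases hx : p x.1 * k x.1 x.2 = 0
    · simp [Function.uncurry, hx]
    · have hx' := mul_ne_zero_iff.1 hx
      have hb : x.2 ∈ (p.bind k).support := (PMF.mem_support_bind_iff p k _).2
        ⟨x.1, (p.mem_support_iff _).2 hx'.1, ((k x.1).mem_support_iff _).2 hx'.2⟩
      simp only [Function.uncurry, norm_smul]
      rw [Real.norm_of_nonneg ENNReal.toReal_nonneg]
      exact mul_le_mul_of_nonneg_left (hC _ hb) ENNReal.toReal_nonneg
  have h1 : ∀ b, ((p.bind k) b).toReal • f b = ∑' a, (p a * k a b).toReal • f b := by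
    intro b
    have hb : ∑' a, p a * k a b ≠ ⊤ := by
      rw [← PMF.bind_apply]; exact PMF.apply_ne_top _ _
    rw [PMF.bind_apply, ENNReal.tsum_toReal_eq (ENNReal.ne_top_of_tsum_ne_top hb)]
    exact ((ENNReal.summable_toReal hb).tsum_smul_const (f b)).symm
  simp only [mean]
  rw [tsum_congr h1, hF.tsum_comm]
  refine tsum_congr fun a => ?_
  rw [← tsum_const_smul'']
  refine tsum_congr fun b => ?_
  rw [ENNReal.toReal_mul, mul_smul]

lemma mean_map {p : PMF α} {k : α → β} {f : β → V} (h : BddOn p fun a => f (k a)) :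
    mean (p.map k) f = mean p fun a => f (k a) := by
  have h' : BddOn (p.bind (PMF.pure ∘ k)) f := h.map
  rw [PMF.map, mean_bind h']
  simp only [Function.comp, mean_pure]

lemma integrable_toMeasure [MeasurableSpace α] [DiscreteMeasurableSpace α]
    [SecondCountableTopology V] {p : PMF α} {f : α → V} (h : BddOn p f) :
    Integrable f p.toMeasure := by
  obtain ⟨C, hC⟩ := h
  borelize V
  refine Integrable.of_bound (C := C)
    (Measurable.of_discrete (f := f)).aestronglyMeasurable ?_
  have : p.toMeasure p.supportᶜ = 0 := by
    rw [PMF.toMeasure_apply_eq_zero_iff _ (MeasurableSet.of_discrete)]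
    exact disjoint_compl_right
  filter_upwards [compl_mem_ae_iff.2 this] with a ha
  exact hC a (by simpa using ha)

lemma integral_toMeasure [MeasurableSpace α] [DiscreteMeasurableSpace α]
    [MeasurableSingletonClass α] [SecondCountableTopology V] {p : PMF α} {f : α → V}
    (h : BddOn p f) : ∫ a, f a ∂p.toMeasure = mean p f :=
  PMF.integral_eq_tsum p f (integrable_toMeasure h)

end Mean

section MeanInner

variable {α V : Type*} [NormedAddCommGroup V] [InnerProductSpace ℝ V] [CompleteSpace V]

lemma mean_inner_left {p : PMF α} {f : α → V} (v : V) (hf : BddOn p f) :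
    mean p (fun a => inner ℝ v (f a)) = inner ℝ v (mean p f) :=
  mean_clm (innerSL ℝ v) hf

lemma BddOn.inner_left {p : PMF α} {f : α → V} (v : V) (hf : BddOn p f) :
    BddOn p fun a => inner ℝ v (f a) := hf.clm (innerSL ℝ v)

end MeanInner

/-! ### Finite Markov chains -/

section Chain

variable {S : Type*} [Fintype S] [DecidableEq S] {P : Matrix S S ℝ}

lemma pow_add_apply_pos (hP : ∀ i j, 0 ≤ P i j) {a b : ℕ} {i j l : S}
    (ha : 0 < (P ^ a) i j) (hb : 0 < (P ^ b) j l) : 0 < (P ^ (a + b)) i l := by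
  rw [pow_add, Matrix.mul_apply]
  exact (mul_pos ha hb).trans_le (Finset.single_le_sum
    (f := fun x => (P ^ a) i x * (P ^ b) x l) (fun x _ => mul_nonneg
      (Matrix.pow_apply_nonneg hP a i x) (Matrix.pow_apply_nonneg hP b x l)) (Finset.mem_univ j))

/-- An irreducible aperiodic matrix is primitive. -/
theorem isPrimitive_of_aperiodic (hI : P.IsIrreducible)
    (hA : ∀ (s : S) (p : ℕ), (∀ n : ℕ, 1 ≤ n → 0 < (P ^ n) s s → p ∣ n) → p = 1) :
    P.IsPrimitive := by
  have hP := hI.nonneg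
  choose k hk0 hk using (Matrix.isIrreducible_iff_exists_pow_pos hP).1 hI
  have hret : ∀ s, ∃ N, ∀ n ≥ N, 0 < (P ^ n) s s := by
    intro s
    obtain ⟨N, hN⟩ := Nat.exists_mem_closure_of_ge {n : ℕ | 1 ≤ n ∧ 0 < (P ^ n) s s}
    refine ⟨N, fun n hn => ?_⟩
    -- Aperiodicity says that the return times have gcd one, so every large integer is a sum of
    -- return times. Return times are closed under addition, so every large integer is one.
    have h1 : Nat.setGcd {n : ℕ | 1 ≤ n ∧ 0 < (P ^ n) s s} = 1 :=
      hA s _ fun n hn hpos => Nat.setGcd_dvd_of_mem ⟨hn, hpos⟩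
    have hmem := hN n hn (by rw [h1]; exact one_dvd n)
    refine AddSubmonoid.closure_induction (motive := fun n _ => 0 < (P ^ n) s s)
      (fun n hn => hn.2) (by simp) (fun a b _ _ ha hb => pow_add_apply_pos hP ha hb) hmem
  choose N hN using hret
  -- The exponent is large enough that, after reserving `k i j` steps to go from `i` to `j`, the
  -- remaining number of steps is still a return time of `i`.
  refine ⟨hP, (∑ i, N i) + (∑ i, ∑ j, k i j) + 1, by omega, fun i j => ?_⟩
  have hNi : N i ≤ ∑ i, N i := Finset.single_le_sum (fun _ _ => Nat.zero_le _) (Finset.mem_univ i)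
  have hki : k i j ≤ ∑ i, ∑ j, k i j :=
    (Finset.single_le_sum (f := k i) (fun _ _ => Nat.zero_le _) (Finset.mem_univ j)).trans
      (Finset.single_le_sum (f := fun i => ∑ j, k i j) (fun _ _ => Nat.zero_le _)
        (Finset.mem_univ i))
  have := pow_add_apply_pos hP (hN i ((∑ i, N i) + (∑ i, ∑ j, k i j) + 1 - k i j) (by omega))
    (hk i j)
  rwa [Nat.sub_add_cancel (by omega)] at this

/-- A finite stochastic matrix has a stationary distribution. -/
theorem exists_stationary [Nonempty S] (hP : P ∈ Matrix.rowStochastic ℝ S) :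
    ∃ q : S → ℝ, (∀ s, 0 ≤ q s) ∧ ∑ s, q s = 1 ∧ q ᵥ* P = q := by
  -- The constant vector is a right null vector of `P - 1`, so a left null vector `x` exists. Its
  -- signs are unknown, which is why `|x|` is used below.
  have hdet : (P - 1).det = 0 := by
    rw [← Matrix.exists_mulVec_eq_zero_iff]
    refine ⟨1, one_ne_zero, ?_⟩
    rw [Matrix.sub_mulVec, Matrix.one_vecMul_of_mem_rowStochastic hP, Matrix.one_mulVec, sub_self]
  obtain ⟨x, hx0, hx⟩ := Matrix.exists_vecMul_eq_zero_iff.2 hdet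
  rw [Matrix.vecMul_sub, Matrix.vecMul_one, sub_eq_zero] at hx
  have hle : ∀ s ∈ Finset.univ, |x s| ≤ ∑ i, |x i| * P i s := by
    intro s _
    calc |x s| = |(x ᵥ* P) s| := by rw [hx]
      _ ≤ ∑ i, |x i * P i s| := Finset.abs_sum_le_sum_abs _ _
      _ = _ := Finset.sum_congr rfl fun i _ => by
        rw [abs_mul, abs_of_nonneg (Matrix.nonneg_of_mem_rowStochastic hP)]
  have hsum : ∑ s, |x s| = ∑ s, ∑ i, |x i| * P i s := by
    rw [Finset.sum_comm]
    refine Finset.sum_congr rfl fun i _ => ?_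
    rw [← Finset.mul_sum, Matrix.sum_row_of_mem_rowStochastic hP, mul_one]
  -- The triangle inequality gives `|x| ≤ |x| P` entrywise, and both sides have the same total mass.
  -- Equality therefore holds in every entry.
  have heq := (Finset.sum_eq_sum_iff_of_le hle).1 hsum
  have hpos : 0 < ∑ s, |x s| := by
    obtain ⟨s, hs⟩ := Function.ne_iff.1 hx0
    exact (abs_pos.2 hs).trans_le
      (Finset.single_le_sum (f := fun s => |x s|) (fun _ _ => abs_nonneg _) (Finset.mem_univ s))
  refine ⟨fun s => (∑ s, |x s|)⁻¹ * |x s|, fun s => by positivity, ?_, ?_⟩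
  · rw [← Finset.mul_sum, inv_mul_cancel₀ hpos.ne']
  · ext s
    change ∑ i, (∑ s, |x s|)⁻¹ * |x i| * P i s = _
    simp_rw [mul_assoc]
    rw [← Finset.mul_sum, ← heq s (Finset.mem_univ s)]

lemma stationary_vecMul_pow {q : S → ℝ} (hq : q ᵥ* P = q) (n : ℕ) : q ᵥ* P ^ n = q := by
  induction n with
  | zero => simp
  | succ n ih => rw [pow_succ, ← Matrix.vecMul_vecMul, ih, hq]

/-- The rows of the powers of a primitive stochastic matrix converge to the stationary
distribution. -/
theorem exists_mixing [Nonempty S] (hP : P ∈ Matrix.rowStochastic ℝ S) (hprim : P.IsPrimitive)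
    {q : S → ℝ} (hq0 : ∀ s, 0 ≤ q s) (hq1 : ∑ s, q s = 1) (hq : q ᵥ* P = q) {δ : ℝ} (hδ : 0 < δ) :
    ∃ t, 1 ≤ t ∧ ∀ s, ∑ s', |(P ^ t) s s' - q s'| ≤ δ := by
  obtain ⟨n, hn, hpos⟩ := hprim.exists_pos_pow
  have hQ : P ^ n ∈ Matrix.rowStochastic ℝ S := pow_mem hP n
  obtain ⟨⟨i₀, j₀⟩, hmin⟩ := Finite.exists_min fun x : S × S => (P ^ n) x.1 x.2
  set ε := (P ^ n) i₀ j₀ with hε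
  have hε0 : 0 < ε := hpos _ _
  have hε1 : ε ≤ 1 := Matrix.le_one_of_mem_rowStochastic hQ
  have hql : ∀ s, q s ≤ 1 := fun s => by
    rw [← hq1]; exact Finset.single_le_sum (fun s _ => hq0 s) (Finset.mem_univ s)
  -- Doeblin's argument: all entries of `P ^ n` are at least `ε`, hence at least `ε * q s`.
  -- Subtracting `ε q` from each row does not change the action on vectors of zero sum and leaves
  -- nonnegative rows of mass `1 - ε`.
  have hstep : ∀ x : S → ℝ, ∑ s, x s = 0 →
      ∑ s, |(x ᵥ* P ^ n) s| ≤ (1 - ε) * ∑ s, |x s| := by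
    intro x hx
    have h1 : ∀ s, (x ᵥ* P ^ n) s = ∑ i, x i * ((P ^ n) i s - ε * q s) := by
      intro s
      simp_rw [mul_sub, Finset.sum_sub_distrib]
      rw [← Finset.sum_mul, hx, zero_mul, sub_zero]
      rfl
    calc ∑ s, |(x ᵥ* P ^ n) s| ≤ ∑ s, ∑ i, |x i| * ((P ^ n) i s - ε * q s) := by
          refine Finset.sum_le_sum fun s _ => ?_
          rw [h1]
          refine (Finset.abs_sum_le_sum_abs _ _).trans_eq (Finset.sum_congr rfl fun i _ => ?_)
          have h2 : ε ≤ (P ^ n) i s := hmin (i, s)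
          have h3 : 0 ≤ (P ^ n) i s - ε * q s := by nlinarith [hql s, hq0 s]
          rw [abs_mul, abs_of_nonneg h3]
      _ = (1 - ε) * ∑ s, |x s| := by
          rw [Finset.sum_comm, Finset.mul_sum]
          refine Finset.sum_congr rfl fun i _ => ?_
          rw [← Finset.mul_sum, Finset.sum_sub_distrib, ← Finset.mul_sum, hq1,
            Matrix.sum_row_of_mem_rowStochastic hQ]
          ring
  have hk : ∀ k s, ∑ s', |((P ^ n) ^ k) s s' - q s'| ≤ (1 - ε) ^ k * 2 := by
    intro k s
    induction k with
    | zero =>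
      rw [pow_zero, pow_zero, one_mul]
      calc ∑ s', |(1 : Matrix S S ℝ) s s' - q s'|
          ≤ ∑ s', ((1 : Matrix S S ℝ) s s' + q s') := Finset.sum_le_sum fun s' _ => by
            rw [abs_le]
            have : 0 ≤ (1 : Matrix S S ℝ) s s' := by
              rw [Matrix.one_apply]; split_ifs <;> norm_num
            constructor <;> linarith [hq0 s']
        _ = 2 := by
            rw [Finset.sum_add_distrib, hq1,
              Matrix.sum_row_of_mem_rowStochastic (one_mem _ : (1 : Matrix S S ℝ) ∈ _)]
            norm_num
    | succ k ih =>
      have h2 : ∀ s', ((P ^ n) ^ (k + 1)) s s' - q s' =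
          ((fun s' => ((P ^ n) ^ k) s s' - q s') ᵥ* P ^ n) s' := by
        intro s'
        have h3 : q s' = ∑ i, q i * (P ^ n) i s' := (congrFun (stationary_vecMul_pow hq n) s').symm
        rw [pow_succ, Matrix.mul_apply, h3, ← Finset.sum_sub_distrib]
        exact Finset.sum_congr rfl fun i _ => by ring
      simp_rw [h2]
      refine (hstep _ ?_).trans ?_
      · rw [Finset.sum_sub_distrib, hq1, Matrix.sum_row_of_mem_rowStochastic (pow_mem hQ k),
          sub_self]
      · rw [pow_succ' (1 - ε), mul_assoc]
        exact mul_le_mul_of_nonneg_left ih (by linarith)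
  obtain ⟨k, hkδ⟩ := exists_pow_lt_of_lt_one (half_pos hδ) (show 1 - ε < 1 by linarith)
  -- The exponent is `k + 1` rather than `k` so that the time is at least one.
  refine ⟨n * (k + 1), Nat.mul_pos hn k.succ_pos, fun s => ?_⟩
  rw [pow_mul]
  refine (hk (k + 1) s).trans ?_
  have : (1 - ε) ^ (k + 1) ≤ (1 - ε) ^ k :=
    pow_le_pow_of_le_one (by linarith) (by linarith) (Nat.le_succ k)
  linarith

/-! ### Decay of correlations for centred vector-valued functions. -/

section Decay

variable {V : Type*} [NormedAddCommGroup V] [NormedSpace ℝ V]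

/-- The action `(P F)(s) = ∑ s', P(s, s') F(s')` of a kernel on vector-valued functions. -/
def act (P : Matrix S S ℝ) (F : S → V) (s : S) : V := ∑ s', P s s' • F s'

lemma act_one (F : S → V) : act 1 F = F := by
  ext s
  simp [act, Matrix.one_apply, ite_smul]

lemma act_mul (P Q : Matrix S S ℝ) (F : S → V) : act (P * Q) F = act P (act Q F) := by
  ext s
  simp only [act, Matrix.mul_apply, Finset.smul_sum, Finset.sum_smul, mul_smul]
  exact Finset.sum_comm

lemma norm_act_le (hP : P ∈ Matrix.rowStochastic ℝ S) {F : S → V} {G : ℝ}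
    (hF : ∀ s, ‖F s‖ ≤ G) (s : S) : ‖act P F s‖ ≤ G := by
  calc ‖act P F s‖ ≤ ∑ s', P s s' * G := norm_sum_le_of_le _ fun s' _ => by
        rw [norm_smul, Real.norm_of_nonneg (Matrix.nonneg_of_mem_rowStochastic hP)]
        exact mul_le_mul_of_nonneg_left (hF s') (Matrix.nonneg_of_mem_rowStochastic hP)
    _ = G := by rw [← Finset.sum_mul, Matrix.sum_row_of_mem_rowStochastic hP, one_mul]

lemma sum_smul_act {q : S → ℝ} (hq : q ᵥ* P = q) (F : S → V) :
    ∑ s, q s • act P F s = ∑ s, q s • F s := by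
  simp only [act, Finset.smul_sum]
  rw [Finset.sum_comm]
  refine Finset.sum_congr rfl fun s' _ => ?_
  simp_rw [smul_smul]
  rw [← Finset.sum_smul]
  congr 1
  exact congrFun hq s'

/-- Since `F` has zero `q`-mean, each row of `P ^ t` may be replaced by its difference with `q`.
Total variation `1/4` means `ℓ¹` distance `1/2`. -/
lemma norm_act_pow_le_half {q : S → ℝ} {t : ℕ}
    (ht : ∀ s, (1 / 2 : ℝ) * ∑ s', |(P ^ t) s s' - q s'| ≤ 1 / 4) {F : S → V} {G : ℝ}
    (hF0 : ∑ s, q s • F s = 0) (hF : ∀ s, ‖F s‖ ≤ G) (s : S) :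
    ‖act (P ^ t) F s‖ ≤ G / 2 := by
  have hG : 0 ≤ G := (norm_nonneg _).trans (hF s)
  have h1 : act (P ^ t) F s = ∑ s', ((P ^ t) s s' - q s') • F s' := by
    simp_rw [sub_smul]
    rw [Finset.sum_sub_distrib, hF0, sub_zero]
    rfl
  rw [h1]
  calc ‖∑ s', ((P ^ t) s s' - q s') • F s'‖ ≤ ∑ s', |(P ^ t) s s' - q s'| * G :=
        norm_sum_le_of_le _ fun s' _ => by
          rw [norm_smul, Real.norm_eq_abs]
          exact mul_le_mul_of_nonneg_left (hF s') (abs_nonneg _)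
    _ = (∑ s', |(P ^ t) s s' - q s'|) * G := by rw [Finset.sum_mul]
    _ ≤ 1 / 2 * G := mul_le_mul_of_nonneg_right (by linarith [ht s]) hG
    _ = G / 2 := by ring

/-- The correlations of a centred function decay fast enough to be summed up to the mixing time. -/
theorem sum_norm_act_pow_le (hP : P ∈ Matrix.rowStochastic ℝ S) {q : S → ℝ} (hq : q ᵥ* P = q)
    {t : ℕ} (ht1 : 1 ≤ t) (ht : ∀ s, (1 / 2 : ℝ) * ∑ s', |(P ^ t) s s' - q s'| ≤ 1 / 4) (n : ℕ) :
    ∀ {F : S → V} {G : ℝ}, ∑ s, q s • F s = 0 → (∀ s, ‖F s‖ ≤ G) → ∀ s,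
      ∑ i ∈ Finset.range n, ‖act (P ^ i) F s‖ ≤ 2 * t * G := by
  induction n using Nat.strong_induction_on with
  | _ n ih =>
    intro F G hF0 hF s
    have hG : 0 ≤ G := (norm_nonneg _).trans (hF s)
    have hfirst : ∀ k ≤ t, ∑ i ∈ Finset.range k, ‖act (P ^ i) F s‖ ≤ t * G := by
      intro k hk
      calc ∑ i ∈ Finset.range k, ‖act (P ^ i) F s‖ ≤ ∑ i ∈ Finset.range k, G :=
            Finset.sum_le_sum fun i _ => norm_act_le (pow_mem hP i) hF s
        _ = k * G := by simp
        _ ≤ t * G := by gcongr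
    rcases le_or_gt n t with hn | hn
    · refine (hfirst n hn).trans ?_
      have : 0 ≤ t * G := by positivity
      linarith
    · obtain ⟨k, rfl⟩ := Nat.exists_eq_add_of_lt hn
      -- The first `t` terms cost at most `t G`. The rest is the same sum for `P ^ t F`, which is
      -- again centred and has sup norm at most `G / 2`, so the induction closes with `t G + 2 t (G
      -- / 2) = 2 t G`.
      rw [show t + k + 1 = t + (k + 1) by ring, Finset.sum_range_add]
      have h2 := ih (k + 1) (by omega) (F := act (P ^ t) F) (G := G / 2)
        ((sum_smul_act (stationary_vecMul_pow hq t) F).trans hF0) (norm_act_pow_le_half ht hF0 hF) s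
      have h3 : ∀ i, act (P ^ (t + i)) F s = act (P ^ i) (act (P ^ t) F) s := fun i => by
        rw [← act_mul, ← pow_add, add_comm]
      simp_rw [h3]
      linarith [hfirst t le_rfl]

end Decay

end Chain

/-! ### Moments of trajectory sums -/

namespace CMDP

variable {S A : Type*} (M : CMDP S A) (π : S → PMF A)

lemma nonempty_state {S A : Type*} (M : CMDP S A) : Nonempty S := ⟨M.ρ.support_nonempty.some⟩

lemma length_of_mem_support_trajLaw (n : ℕ) (s : S) {zs : List (Transition S A)}
    (h : zs ∈ (M.trajLaw π n s).support) : zs.length = n := by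
  induction n generalizing s zs with
  | zero =>
    rw [trajLaw, PMF.mem_support_pure_iff] at h
    simp [h]
  | succ n ih =>
    rw [trajLaw, PMF.mem_support_bind_iff] at h
    obtain ⟨a, -, h⟩ := h
    rw [PMF.mem_support_bind_iff] at h
    obtain ⟨s', -, h⟩ := h
    rw [PMF.mem_support_map_iff] at h
    obtain ⟨zs', h', rfl⟩ := h
    simp [ih s' h']

/-- This lets the averages at levels `0`, `q - 1` and `q`, computed from one trajectory, be treated
as averages over trajectories of their own lengths. -/
lemma trajLaw_map_take {k n : ℕ} (hk : k ≤ n) (s : S) :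
    (M.trajLaw π n s).map (List.take k) = M.trajLaw π k s := by
  induction k generalizing n s with
  | zero =>
    have : (List.take 0 : List (Transition S A) → _) = Function.const _ [] := by ext; simp
    rw [this, PMF.map_const, trajLaw]
  | succ k ih =>
    obtain ⟨n, rfl⟩ : ∃ n', n = n' + 1 := ⟨n - 1, by omega⟩
    simp only [trajLaw, PMF.map_bind]
    refine congrArg _ (funext fun a => congrArg _ (funext fun s' => ?_))
    rw [PMF.map_comp, ← ih (n := n) (by omega) s', PMF.map_comp]
    rfl

section Moments

variable [Fintype S] [Fintype A] {V : Type*} [NormedAddCommGroup V]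

lemma bddOn_trajLaw (n : ℕ) (s : S) (F : List (Transition S A) → V) :
    BddOn (M.trajLaw π n s) F := by
  have hfin : {l : List (Transition S A) | l.length = n}.Finite := List.finite_length_eq _ n
  obtain ⟨C, hC⟩ := (hfin.image fun l => ‖F l‖).bddAbove
  exact ⟨C, fun l hl => hC ⟨l, M.length_of_mem_support_trajLaw π n s hl, rfl⟩⟩

/-- The one-step transition weight `π(a | s) P(s' | s, a)`. -/
def weight (s : S) (a : A) (s' : S) : ℝ := (π s a).toReal * (M.P s a s').toReal

lemma weight_nonneg (s : S) (a : A) (s' : S) : 0 ≤ M.weight π s a s' :=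
  mul_nonneg ENNReal.toReal_nonneg ENNReal.toReal_nonneg

lemma sum_toReal {α : Type*} [Fintype α] (p : PMF α) : ∑ a, (p a).toReal = 1 :=
  (tsum_fintype _).symm.trans (hasSum_toReal p).tsum_eq

lemma sum_weight (s : S) : ∑ a, ∑ s', M.weight π s a s' = 1 := by
  simp only [weight, ← Finset.mul_sum, sum_toReal, mul_one]

variable [NormedSpace ℝ V]

/-- The mean of `f(s, a, s')` for `a ∼ π(s)` and `s' ∼ P(s, a)`. -/
def stepMean (f : Transition S A → V) (s : S) : V :=
  ∑ a, ∑ s', M.weight π s a s' • f (s, a, s')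

lemma stationaryMean_eq (f : Transition S A → V) :
    M.stationaryMean π f = ∑ s, M.stationary π s • M.stepMean π f s := by
  simp only [stationaryMean, stepMean, weight, Finset.smul_sum, smul_smul, mul_assoc]

lemma norm_stepMean_le {f : Transition S A → V} {C : ℝ} (h : ∀ z, ‖f z‖ ≤ C) (s : S) :
    ‖M.stepMean π f s‖ ≤ C := by
  calc ‖M.stepMean π f s‖ ≤ ∑ a, ∑ s', M.weight π s a s' * C :=
        norm_sum_le_of_le _ fun a _ => norm_sum_le_of_le _ fun s' _ => by
          rw [norm_smul, Real.norm_of_nonneg (M.weight_nonneg π s a s')]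
          exact mul_le_mul_of_nonneg_left (h _) (M.weight_nonneg π s a s')
    _ = C := by simp_rw [← Finset.sum_mul]; rw [M.sum_weight, one_mul]

variable [CompleteSpace V]

lemma mean_trajLaw_succ (n : ℕ) (s : S) (F : List (Transition S A) → V) :
    mean (M.trajLaw π (n + 1) s) F =
      ∑ a, ∑ s', M.weight π s a s' • mean (M.trajLaw π n s') fun zs => F ((s, a, s') :: zs) := by
  have hb := M.bddOn_trajLaw π (n + 1) s F
  rw [trajLaw] at hb ⊢
  rw [mean_bind hb, mean_fintype]
  refine Finset.sum_congr rfl fun a _ => ?_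
  by_cases ha : π s a = 0
  · simp [ha, weight]
  have hb' := hb.of_bind ((PMF.mem_support_iff _ _).2 ha)
  rw [mean_bind hb', mean_fintype, Finset.smul_sum]
  refine Finset.sum_congr rfl fun s' _ => ?_
  rw [mean_map (M.bddOn_trajLaw π n s' _), weight, mul_smul]

variable [DecidableEq S]

lemma transitionMatrix_apply (s s' : S) :
    M.transitionMatrix π s s' = ∑ a, M.weight π s a s' := rfl

lemma transitionMatrix_mem : M.transitionMatrix π ∈ Matrix.rowStochastic ℝ S := by
  rw [Matrix.mem_rowStochastic_iff_sum]
  refine ⟨fun s s' => ?_, fun s => ?_⟩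
  · rw [transitionMatrix_apply]
    exact Finset.sum_nonneg fun a _ => M.weight_nonneg π s a s'
  · simp_rw [transitionMatrix_apply]
    rw [Finset.sum_comm, M.sum_weight]

lemma act_transitionMatrix (F : S → V) (s : S) :
    act (M.transitionMatrix π) F s = ∑ a, ∑ s', M.weight π s a s' • F s' := by
  rw [act, Finset.sum_comm]
  simp_rw [transitionMatrix_apply, Finset.sum_smul]

/-- By the Markov property the mean of `f` at time `t` is `P ^ t` applied to the one-step mean.
Conditioning on the first transition shifts the time by one. -/
lemma mean_trajLaw_sum (n : ℕ) (s : S) (f : Transition S A → V) :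
    mean (M.trajLaw π n s) (fun zs => (zs.map f).sum) =
      ∑ t ∈ Finset.range n, act (M.transitionMatrix π ^ t) (M.stepMean π f) s := by
  induction n generalizing s with
  | zero => simp [trajLaw, mean_pure]
  | succ n ih =>
    rw [mean_trajLaw_succ, Finset.sum_range_succ']
    have h1 : ∀ a s', mean (M.trajLaw π n s')
        (fun zs => (((s, a, s') :: zs : List (Transition S A)).map f).sum) = f (s, a, s') +
          ∑ t ∈ Finset.range n, act (M.transitionMatrix π ^ t) (M.stepMean π f) s' := by
      intro a s'
      simp only [List.map_cons, List.sum_cons]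
      rw [mean_add (BddOn.const _ _) (M.bddOn_trajLaw π n s' _), mean_const, ih]
    simp_rw [h1, smul_add, Finset.sum_add_distrib]
    rw [pow_zero, act_one, add_comm]
    congr 1
    simp_rw [pow_succ', act_mul, act_transitionMatrix, Finset.smul_sum]
    rw [Finset.sum_comm]
    conv_rhs => rw [Finset.sum_comm]
    rw [Finset.sum_comm]
    refine Finset.sum_congr rfl fun a _ => ?_
    rw [Finset.sum_comm]

end Moments

/-! ### Moment bounds under a mixing time. -/

section Mixing

variable [Fintype S] [Fintype A] [DecidableEq S]

/-- Existence of some stationary distribution suffices for the choice operator; uniqueness plays no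
role here. -/
lemma isStationary_stationary : M.IsStationary π (M.stationary π) := by
  have := M.nonempty_state
  exact Classical.epsilon_spec (exists_stationary (M.transitionMatrix_mem π))

/-- The chain induced by `π` has a mixing time of at most `τ`. -/
def MixedBy (τ : ℕ) : Prop :=
  ∃ t, 1 ≤ t ∧ t ≤ τ ∧
    ∀ s, (1 / 2 : ℝ) * ∑ s', |(M.transitionMatrix π ^ t) s s' - M.stationary π s'| ≤ 1 / 4

lemma mixedBy_mixingTime (hM : M.Ergodic) : M.MixedBy π (M.mixingTime π) := by
  have := M.nonempty_state
  obtain ⟨h0, h1, hq⟩ := M.isStationary_stationary π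
  obtain ⟨t, ht1, ht⟩ := exists_mixing (M.transitionMatrix_mem π)
    (isPrimitive_of_aperiodic (hM π).1 (hM π).2) h0 h1 hq (δ := 1 / 2) (by norm_num)
  have hmem := Nat.sInf_mem (s := {t : ℕ | 1 ≤ t ∧
    ∀ s, (1 / 2 : ℝ) * ∑ s', |(M.transitionMatrix π ^ t) s s' - M.stationary π s'| ≤ 1 / 4})
    ⟨t, ht1, fun s => by linarith [ht s]⟩
  exact ⟨_, hmem.1, le_rfl, hmem.2⟩

/-- In the natural numbers the supremum of an unbounded set is `0`. A nonzero `tauMix` therefore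
certifies that the mixing times over `Θ` are bounded, and the supremum dominates each of them. -/
lemma mixedBy_tauMix (hM : M.Ergodic) {d : ℕ} (π : ParamSpace d → S → PMF A)
    {Θ : Set (ParamSpace d)} (hτ : M.tauMix π Θ ≠ 0) {θ : ParamSpace d} (hθ : θ ∈ Θ) :
    M.MixedBy (π θ) (M.tauMix π Θ) := by
  obtain ⟨t, ht1, htle, ht⟩ := M.mixedBy_mixingTime (π θ) hM
  refine ⟨t, ht1, htle.trans ?_, ht⟩
  have hb : BddAbove (Set.range fun θ : Θ => M.mixingTime (π θ)) := by
    by_contra h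
    exact hτ (Nat.sSup_of_not_bddAbove h)
  exact le_ciSup hb ⟨θ, hθ⟩

variable {V : Type*} [NormedAddCommGroup V] {M π} {τ : ℕ}

lemma norm_mean_trajLaw_sum_le [NormedSpace ℝ V] [CompleteSpace V] (hτ : M.MixedBy π τ)
    {f : Transition S A → V} {G : ℝ} (hf : M.stationaryMean π f = 0) (hG : ∀ z, ‖f z‖ ≤ G)
    (n : ℕ) (s : S) : ‖mean (M.trajLaw π n s) (fun zs => (zs.map f).sum)‖ ≤ 2 * τ * G := by
  obtain ⟨t, ht1, htle, ht⟩ := hτ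
  rw [mean_trajLaw_sum]
  rw [stationaryMean_eq] at hf
  have hG' := M.norm_stepMean_le π hG
  have hG0 : 0 ≤ G := (norm_nonneg _).trans (hG' s)
  refine (norm_sum_le _ _).trans ((sum_norm_act_pow_le (M.transitionMatrix_mem π)
    (M.isStationary_stationary π).2.2 ht1 ht n hf hG' s).trans ?_)
  gcongr

lemma MixedBy.one_le (hτ : M.MixedBy π τ) : 1 ≤ τ := by
  obtain ⟨t, ht1, htle, -⟩ := hτ
  exact ht1.trans htle

/-- Split off the first transition. In the cross term it is paired with the mean of the remaining
sum, which is at most `2 τ G`, so each step adds at most `G² + 4 τ G² ≤ 5 τ G²`. -/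
lemma mean_trajLaw_norm_sq_le [InnerProductSpace ℝ V] [CompleteSpace V] (hτ : M.MixedBy π τ)
    {f : Transition S A → V} {G : ℝ} (hf : M.stationaryMean π f = 0) (hG : ∀ z, ‖f z‖ ≤ G)
    (n : ℕ) (s : S) :
    mean (M.trajLaw π n s) (fun zs => ‖(zs.map f).sum‖ ^ 2) ≤ 5 * n * τ * G ^ 2 := by
  have hτ1 : (1 : ℝ) ≤ τ := by exact_mod_cast hτ.one_le
  induction n generalizing s with
  | zero => simp [trajLaw, mean_pure]
  | succ n ih =>
    have key : ∀ a s', mean (M.trajLaw π n s')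
        (fun zs => ‖(((s, a, s') :: zs : List (Transition S A)).map f).sum‖ ^ 2) ≤
          5 * (n + 1) * τ * G ^ 2 := by
      intro a s'
      have h1 : ∀ zs : List (Transition S A), ‖(((s, a, s') :: zs).map f).sum‖ ^ 2 =
          (‖f (s, a, s')‖ ^ 2 + 2 * inner ℝ (f (s, a, s')) ((zs.map f).sum)) +
            ‖(zs.map f).sum‖ ^ 2 := fun zs => by
        rw [List.map_cons, List.sum_cons, norm_add_sq_real]
      simp_rw [h1]
      rw [mean_add (M.bddOn_trajLaw π n s' _) (M.bddOn_trajLaw π n s' _),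
        mean_add (BddOn.const _ _) (M.bddOn_trajLaw π n s' _), mean_const,
        mean_mul _ (M.bddOn_trajLaw π n s' _), mean_inner_left _ (M.bddOn_trajLaw π n s' _)]
      have h2 := norm_mean_trajLaw_sum_le hτ hf hG n s'
      have h3 := real_inner_le_norm (f (s, a, s'))
        (mean (M.trajLaw π n s') (fun zs => (zs.map f).sum))
      have h4 := hG (s, a, s')
      have h0 := norm_nonneg (f (s, a, s'))
      have h5 : ‖f (s, a, s')‖ * ‖mean (M.trajLaw π n s') (fun zs => (zs.map f).sum)‖ ≤
          G * (2 * τ * G) := mul_le_mul h4 h2 (norm_nonneg _) (h0.trans h4)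
      have h6 : ‖f (s, a, s')‖ ^ 2 ≤ G ^ 2 := pow_le_pow_left₀ h0 h4 2
      nlinarith [ih s', mul_le_mul_of_nonneg_right hτ1 (sq_nonneg G)]
    rw [mean_trajLaw_succ]
    calc _ ≤ ∑ a, ∑ s', M.weight π s a s' * (5 * (n + 1) * τ * G ^ 2) :=
          Finset.sum_le_sum fun a _ => Finset.sum_le_sum fun s' _ =>
            mul_le_mul_of_nonneg_left (key a s') (M.weight_nonneg π s a s')
      _ = 5 * (n + 1 : ℕ) * τ * G ^ 2 := by
          simp_rw [← Finset.sum_mul]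
          rw [M.sum_weight]
          push_cast
          ring

end Mixing

end CMDP

/-! ### Moments of the multi-level Monte Carlo estimate -/

lemma levelLaw_zero : levelLaw 0 = 0 := by
  rw [levelLaw, PMF.apply_eq_zero_iff, PMF.mem_support_map_iff]
  rintro ⟨n, -, hn⟩
  omega

lemma levelLaw_succ_toReal (n : ℕ) : (levelLaw (n + 1)).toReal = (1 / 2) ^ (n + 1) := by
  have hp : (⟨1 / 2, by norm_num, by norm_num⟩ : unitInterval) ≠ 0 := by
    intro h
    have := congrArg Subtype.val h
    norm_num at this
  rw [levelLaw, PMF.map_apply, tsum_eq_single n]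
  · rw [if_pos rfl, Measure.toPMF_apply, geometricMeasure_singleton hp,
      ENNReal.toReal_ofReal (geometricMeasure_nonneg _ n)]
    norm_num [pow_succ]
  · intro b hb
    rw [if_neg]
    omega

lemma one_le_of_mem_support_levelLaw {q : ℕ} (hq : q ∈ levelLaw.support) : 1 ≤ q := by
  rcases Nat.eq_zero_or_pos q with rfl | h
  · exact absurd levelLaw_zero ((PMF.mem_support_iff _ _).1 hq)
  · exact h

section Level

variable {V : Type*} [NormedAddCommGroup V] [NormedSpace ℝ V]

/-- Truncation at `T_max` leaves the levels `1, …, log₂ T_max`, with weights that cancel the factor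
`2 ^ q` of the estimate. -/
lemma mean_levelLaw_ite {Tmax : ℕ} (hT : Tmax ≠ 0) (D : ℕ → V) :
    mean levelLaw (fun q => if 2 ^ q ≤ Tmax then D q else 0) =
      ∑ j ∈ Finset.range (Nat.log 2 Tmax), ((1 / 2 : ℝ) ^ (j + 1)) • D (j + 1) := by
  have hiff : ∀ q, 2 ^ q ≤ Tmax ↔ q ≤ Nat.log 2 Tmax := fun q =>
    (Nat.le_log_iff_pow_le (by norm_num) hT).symm
  rw [mean, tsum_eq_sum (s := Finset.range (Nat.log 2 Tmax + 1))]
  · rw [Finset.sum_range_succ']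
    simp only [levelLaw_zero, ENNReal.toReal_zero, zero_smul, add_zero, levelLaw_succ_toReal]
    refine Finset.sum_congr rfl fun j hj => ?_
    rw [if_pos ((hiff _).2 (Finset.mem_range.1 hj))]
  · intro q hq
    rw [if_neg, smul_zero]
    rw [hiff]
    simpa [Nat.lt_succ_iff] using hq

lemma bddOn_levelLaw_ite (Tmax : ℕ) (D : ℕ → V) :
    BddOn levelLaw (fun q => if 2 ^ q ≤ Tmax then D q else 0) := by
  refine ⟨∑ j ∈ Finset.range Tmax, ‖D j‖, fun q _ => ?_⟩
  beta_reduce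
  split_ifs with h
  · exact Finset.single_le_sum (f := fun j => ‖D j‖) (fun _ _ => norm_nonneg _)
      (Finset.mem_range.2 (q.lt_two_pow_self.trans_le h))
  · rw [norm_zero]
    exact Finset.sum_nonneg fun _ _ => norm_nonneg _

end Level

section LevelMean

variable {Z V : Type*} [NormedAddCommGroup V] [NormedSpace ℝ V]

lemma norm_sum_map_le {f : Z → V} {G : ℝ} (hG : ∀ z, ‖f z‖ ≤ G) (zs : List Z) :
    ‖(zs.map f).sum‖ ≤ zs.length * G := by
  induction zs with
  | nil => simp
  | cons z zs ih =>
    rw [List.map_cons, List.sum_cons, List.length_cons]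
    push_cast
    linarith [norm_add_le (f z) (zs.map f).sum, hG z]

lemma norm_levelMean_le {f : Z → V} {G : ℝ} (hG0 : 0 ≤ G) (hG : ∀ z, ‖f z‖ ≤ G) (zs : List Z)
    (j : ℕ) : ‖levelMean f zs j‖ ≤ G := by
  have h1 := norm_sum_map_le hG (zs.take (2 ^ j))
  have h2 : ((zs.take (2 ^ j)).length : ℝ) ≤ 2 ^ j := by
    exact_mod_cast List.length_take_le _ _
  rw [levelMean, norm_smul, norm_inv, norm_pow, Real.norm_ofNat, inv_mul_le_iff₀ (by positivity)]
  exact h1.trans (mul_le_mul_of_nonneg_right h2 hG0)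

/-- A crude deterministic bound, used only for integrability; its growth with `T_max` never enters
the rates. -/
lemma norm_mlmc_le {f : Z → V} {G : ℝ} (hG0 : 0 ≤ G) (hG : ∀ z, ‖f z‖ ≤ G) (Tmax q : ℕ)
    (zs : List Z) : ‖mlmc Tmax f q zs‖ ≤ (1 + 2 * Tmax) * G := by
  have h := norm_levelMean_le hG0 hG zs
  rw [mlmc]
  refine (norm_add_le _ _).trans ?_
  have h2 : ‖if 2 ^ q ≤ Tmax then (2 : ℝ) ^ q • (levelMean f zs q - levelMean f zs (q - 1))
      else 0‖ ≤ Tmax * (2 * G) := by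
    split_ifs with hq
    · rw [norm_smul, norm_pow, Real.norm_ofNat]
      have hq' : (2 : ℝ) ^ q ≤ Tmax := by exact_mod_cast hq
      have := norm_sub_le (levelMean f zs q) (levelMean f zs (q - 1))
      exact mul_le_mul hq' (by linarith [h q, h (q - 1)]) (norm_nonneg _) (by positivity)
    · rw [norm_zero]; positivity
  linarith [h 0]

lemma levelMean_take (f : Z → V) (zs : List Z) (j : ℕ) :
    levelMean f (zs.take (2 ^ j)) j = levelMean f zs j := by
  simp [levelMean, List.take_take]

lemma sum_map_sub_const (f : Z → V) (c : V) (zs : List Z) :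
    (zs.map fun z => f z - c).sum = (zs.map f).sum - (zs.length : ℝ) • c := by
  induction zs with
  | nil => simp
  | cons z zs ih =>
    simp only [List.map_cons, List.sum_cons, ih, List.length_cons, Nat.cast_add, Nat.cast_one,
      add_smul, one_smul]
    abel

lemma levelMean_sub_const (f : Z → V) (c : V) {zs : List Z} {j : ℕ} (h : 2 ^ j ≤ zs.length) :
    levelMean (fun z => f z - c) zs j = levelMean f zs j - c := by
  rw [levelMean, sum_map_sub_const, List.length_take, min_eq_left h, smul_sub, smul_smul]
  push_cast
  rw [inv_mul_cancel₀ (by positivity), one_smul]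
  rfl

end LevelMean

namespace CMDP

variable {S A : Type*} (M : CMDP S A) (π : S → PMF A) (Tmax : ℕ)

/-- The law of one inner-loop step from the state `s`. -/
def stepLaw (s : S) : PMF (InnerSample S A) :=
  levelLaw.bind fun q => (M.trajLaw π (trajLength Tmax q) s).map fun zs => (q, zs)

section

variable {V : Type*} [NormedAddCommGroup V] [NormedSpace ℝ V]

lemma bddOn_stepLaw_mlmc {f : Transition S A → V} {G : ℝ} (hG : ∀ z, ‖f z‖ ≤ G) (s : S) :
    BddOn (M.stepLaw π Tmax s) (fun x => mlmc Tmax f x.1 x.2) :=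
  BddOn.of_forall ((1 + 2 * Tmax) * max G 0) fun x =>
    norm_mlmc_le (le_max_right _ _) (fun z => (hG z).trans (le_max_left _ _)) Tmax x.1 x.2

variable [CompleteSpace V]

lemma mean_stepLaw [Fintype S] [Fintype A] {s : S} {F : InnerSample S A → V}
    (hF : BddOn (M.stepLaw π Tmax s) F) :
    mean (M.stepLaw π Tmax s) F =
      mean levelLaw fun q => mean (M.trajLaw π (trajLength Tmax q) s) fun zs => F (q, zs) := by
  rw [stepLaw] at hF ⊢
  rw [mean_bind hF]
  exact mean_congr fun q _ => mean_map (M.bddOn_trajLaw π _ s _)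

end

section Moments

variable [Fintype S] [Fintype A] {M π Tmax} {V : Type*} [NormedAddCommGroup V]
  [InnerProductSpace ℝ V] [CompleteSpace V]

lemma mean_trajLaw_levelMean {W : Type*} [NormedAddCommGroup W] [NormedSpace ℝ W]
    [CompleteSpace W] (f : Transition S A → V) (Φ : V → W) {n j : ℕ}
    (h : 2 ^ j ≤ n) (s : S) :
    mean (M.trajLaw π n s) (fun zs => Φ (levelMean f zs j)) =
      mean (M.trajLaw π (2 ^ j) s) (fun zs => Φ (levelMean f zs j)) := by
  rw [← M.trajLaw_map_take π h, mean_map (M.bddOn_trajLaw π n s _)]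
  simp_rw [levelMean_take]

/-- The multi-level estimate has the mean of the longest average. -/
lemma mean_stepLaw_mlmc (hT : Tmax ≠ 0) (f : Transition S A → V) (s : S) :
    mean (M.stepLaw π Tmax s) (fun x => mlmc Tmax f x.1 x.2) =
      mean (M.trajLaw π (2 ^ Nat.log 2 Tmax) s) (fun zs => levelMean f zs (Nat.log 2 Tmax)) := by
  obtain ⟨G, hG⟩ := (Set.finite_range fun z => ‖f z‖).bddAbove
  replace hG : ∀ z, ‖f z‖ ≤ G := fun z => hG ⟨z, rfl⟩
  rw [mean_stepLaw _ _ _ (M.bddOn_stepLaw_mlmc π Tmax hG s)]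
  set ℓ : ℕ → V := fun j => mean (M.trajLaw π (2 ^ j) s) (fun zs => levelMean f zs j) with hℓ
  have hlen : ∀ q, 1 ≤ trajLength Tmax q := fun q => by
    rw [trajLength]; split_ifs
    · exact Nat.one_le_two_pow
    · exact le_rfl
  have hmean : ∀ {n j : ℕ}, 2 ^ j ≤ n →
      mean (M.trajLaw π n s) (fun zs => levelMean f zs j) = ℓ j := fun h =>
    mean_trajLaw_levelMean f id h s
  have h1 : ∀ q ∈ levelLaw.support, mean (M.trajLaw π (trajLength Tmax q) s)
      (fun zs => mlmc Tmax f q zs) =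
        ℓ 0 + if 2 ^ q ≤ Tmax then (2 : ℝ) ^ q • (ℓ q - ℓ (q - 1)) else 0 := by
    intro q _
    simp only [mlmc]
    rw [mean_add (M.bddOn_trajLaw π _ s _) (M.bddOn_trajLaw π _ s _),
      hmean (j := 0) (by simpa using hlen q)]
    congr 1
    by_cases hq : 2 ^ q ≤ Tmax
    · simp only [hq, if_true]
      rw [mean_smul _ (M.bddOn_trajLaw π _ s _),
        mean_sub (M.bddOn_trajLaw π _ s _) (M.bddOn_trajLaw π _ s _), trajLength, if_pos hq,
        hmean le_rfl, hmean (Nat.pow_le_pow_right (by norm_num) (Nat.sub_le q 1))]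
    · simp only [hq, if_false]
      exact mean_const _ _
  rw [mean_congr h1, mean_add (BddOn.const _ _) (bddOn_levelLaw_ite Tmax _), mean_const,
    mean_levelLaw_ite hT]
  -- The probability of the level cancels its factor, so the differences of consecutive level means
  -- telescope.
  have h2 : ∀ j, ((1 / 2 : ℝ) ^ (j + 1)) • (2 : ℝ) ^ (j + 1) • (ℓ (j + 1) - ℓ (j + 1 - 1)) =
      ℓ (j + 1) - ℓ j := fun j => by
    rw [smul_smul, ← mul_pow]
    norm_num
  simp_rw [h2]
  rw [Finset.sum_range_sub]
  abel

variable [DecidableEq S] {τ : ℕ}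

lemma mean_trajLaw_levelMean_norm_sq_le (hτ : M.MixedBy π τ) {f : Transition S A → V} {G : ℝ}
    (hf : M.stationaryMean π f = 0) (hG : ∀ z, ‖f z‖ ≤ G) {n j : ℕ} (h : 2 ^ j ≤ n) (s : S) :
    mean (M.trajLaw π n s) (fun zs => ‖levelMean f zs j‖ ^ 2) ≤ 5 * τ * G ^ 2 / 2 ^ j := by
  rw [mean_trajLaw_levelMean f (fun v => ‖v‖ ^ 2) h]
  have h1 : ∀ zs ∈ (M.trajLaw π (2 ^ j) s).support,
      ‖levelMean f zs j‖ ^ 2 = ((2 : ℝ) ^ j)⁻¹ ^ 2 * ‖(zs.map f).sum‖ ^ 2 := by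
    intro zs hzs
    rw [levelMean, List.take_of_length_le (M.length_of_mem_support_trajLaw π _ s hzs).le,
      norm_smul, norm_inv, norm_pow, Real.norm_ofNat, mul_pow]
  rw [mean_congr h1, mean_mul _ (M.bddOn_trajLaw π _ s _)]
  have h2 := mean_trajLaw_norm_sq_le hτ hf hG (2 ^ j) s
  calc _ ≤ ((2 : ℝ) ^ j)⁻¹ ^ 2 * (5 * (2 ^ j : ℕ) * τ * G ^ 2) := by gcongr
    _ = 5 * τ * G ^ 2 / 2 ^ j := by
      push_cast
      field_simp

/-- The mean is that of an average over `2 ^ J` transitions, where `J = log₂ T_max` rounded down, so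
`2 ^ J ≥ T_max / 2`. The centred sum has mean at most `2 τ G`, whatever its length. -/
lemma norm_mean_stepLaw_mlmc_sub_le (hT : Tmax ≠ 0) (hτ : M.MixedBy π τ)
    {f : Transition S A → V} {c : V} {G : ℝ} (hf : M.stationaryMean π (fun z => f z - c) = 0)
    (hG : ∀ z, ‖f z - c‖ ≤ G) (s : S) :
    ‖mean (M.stepLaw π Tmax s) (fun x => mlmc Tmax f x.1 x.2) - c‖ ≤ 4 * τ / Tmax * G := by
  set J := Nat.log 2 Tmax with hJ
  rw [mean_stepLaw_mlmc hT]
  have h1 : mean (M.trajLaw π (2 ^ J) s) (fun zs => levelMean f zs J) - c =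
      ((2 : ℝ) ^ J)⁻¹ • mean (M.trajLaw π (2 ^ J) s)
        (fun zs => (zs.map fun z => f z - c).sum) := by
    rw [← mean_smul _ (M.bddOn_trajLaw π _ s _), ← mean_const (M.trajLaw π (2 ^ J) s) c,
      ← mean_sub (M.bddOn_trajLaw π _ s _) (BddOn.const _ _), mean_const]
    refine mean_congr fun zs hzs => ?_
    have hl := M.length_of_mem_support_trajLaw π _ s hzs
    rw [← levelMean_sub_const f c hl.ge, levelMean, List.take_of_length_le hl.le]
  rw [h1, norm_smul, norm_inv, norm_pow, Real.norm_ofNat]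
  have h2 := norm_mean_trajLaw_sum_le hτ hf hG (2 ^ J) s
  have hG0 : 0 ≤ G := by
    have hτ1 : (1 : ℝ) ≤ τ := by exact_mod_cast hτ.one_le
    have := (norm_nonneg _).trans h2
    nlinarith
  have h3 : (Tmax : ℝ) ≤ 2 * 2 ^ J := by
    have := (Nat.lt_pow_succ_log_self (b := 2) (by norm_num) Tmax).le
    rw [pow_succ, mul_comm] at this
    exact_mod_cast this
  have hT0 : (0 : ℝ) < Tmax := by exact_mod_cast Nat.pos_of_ne_zero hT
  calc ((2 : ℝ) ^ J)⁻¹ * ‖mean (M.trajLaw π (2 ^ J) s)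
        (fun zs => (zs.map fun z => f z - c).sum)‖ ≤ ((2 : ℝ) ^ J)⁻¹ * (2 * τ * G) := by gcongr
    _ ≤ (2 / Tmax) * (2 * τ * G) := by
        gcongr
        rw [inv_le_comm₀ (by positivity) (by positivity), inv_div]
        linarith
    _ = 4 * τ / Tmax * G := by ring

/-- Level `q` contributes `4 ^ q` times a mean square of order `τ G² / 2 ^ q`, hence `60 τ G² 2 ^
q`. Its probability `2 ^ (-q)` reduces this to `60 τ G²`, and there are `log₂ T_max` levels. -/
lemma mean_stepLaw_mlmc_norm_sq_le (hT : Tmax ≠ 0) (hτ : M.MixedBy π τ)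
    {f : Transition S A → V} {c : V} {B G : ℝ} (hB : ∀ z, ‖f z‖ ≤ B)
    (hf : M.stationaryMean π (fun z => f z - c) = 0) (hG : ∀ z, ‖f z - c‖ ≤ G) (s : S) :
    mean (M.stepLaw π Tmax s) (fun x => ‖mlmc Tmax f x.1 x.2‖ ^ 2) ≤
      2 * B ^ 2 + 60 * τ * G ^ 2 * Nat.log 2 Tmax := by
  rw [mean_stepLaw _ _ _ (M.bddOn_stepLaw_mlmc π Tmax hB s).norm_sq]
  have key : ∀ q ∈ levelLaw.support, mean (M.trajLaw π (trajLength Tmax q) s)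
      (fun zs => ‖mlmc Tmax f q zs‖ ^ 2) ≤
        2 * B ^ 2 + if 2 ^ q ≤ Tmax then 60 * τ * G ^ 2 * 2 ^ q else 0 := by
    intro q hq1
    replace hq1 := one_le_of_mem_support_levelLaw hq1
    have hB0 : ∀ zs : List (Transition S A), ‖levelMean f zs 0‖ ^ 2 ≤ B ^ 2 ∨ zs = [] := by
      intro zs
      rcases zs with - | ⟨z, zs⟩
      · exact Or.inr rfl
      · left
        exact pow_le_pow_left₀ (norm_nonneg _)
          (norm_levelMean_le ((norm_nonneg _).trans (hB z)) hB _ 0) 2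
    by_cases hq : 2 ^ q ≤ Tmax
    · simp only [mlmc, hq, if_true, trajLength]
      have hp : ∀ zs ∈ (M.trajLaw π (2 ^ q) s).support,
          ‖levelMean f zs 0 + (2 : ℝ) ^ q • (levelMean f zs q - levelMean f zs (q - 1))‖ ^ 2 ≤
            2 * B ^ 2 + 4 * (2 ^ q) ^ 2 * (‖levelMean (fun z => f z - c) zs q‖ ^ 2 +
              ‖levelMean (fun z => f z - c) zs (q - 1)‖ ^ 2) := by
        intro zs hzs
        have hl := M.length_of_mem_support_trajLaw π _ s hzs
        have hl' : 2 ^ (q - 1) ≤ zs.length :=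
          hl ▸ Nat.pow_le_pow_right (by norm_num) (Nat.sub_le q 1)
        have h0 : ‖levelMean f zs 0‖ ^ 2 ≤ B ^ 2 := (hB0 zs).resolve_right fun h => by
          rw [h] at hl
          simp at hl
          exact absurd hl.symm (by positivity)
        rw [levelMean_sub_const f c hl.ge, levelMean_sub_const f c hl']
        set u := levelMean f zs q
        set v := levelMean f zs (q - 1)
        have h1 := norm_add_le (levelMean f zs 0) ((2 : ℝ) ^ q • (u - v))
        have h2 : ‖(2 : ℝ) ^ q • (u - v)‖ ≤ 2 ^ q * (‖u - c‖ + ‖v - c‖) := by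
          rw [norm_smul, norm_pow, Real.norm_ofNat]
          gcongr
          calc ‖u - v‖ = ‖(u - c) - (v - c)‖ := by congr 1; abel
            _ ≤ _ := norm_sub_le _ _
        have h3 : ‖levelMean f zs 0 + (2 : ℝ) ^ q • (u - v)‖ ^ 2 ≤
            (‖levelMean f zs 0‖ + 2 ^ q * (‖u - c‖ + ‖v - c‖)) ^ 2 :=
          pow_le_pow_left₀ (norm_nonneg _) (h1.trans (by linarith)) 2
        have h4 := add_sq_le (a := ‖levelMean f zs 0‖) (b := 2 ^ q * (‖u - c‖ + ‖v - c‖))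
        have h5 := add_sq_le (a := ‖u - c‖) (b := ‖v - c‖)
        have h6 : (2 ^ q * (‖u - c‖ + ‖v - c‖)) ^ 2 ≤
            (2 ^ q) ^ 2 * (2 * (‖u - c‖ ^ 2 + ‖v - c‖ ^ 2)) := by
          rw [mul_pow]; gcongr
        linarith
      refine (mean_mono (M.bddOn_trajLaw π _ s _) (M.bddOn_trajLaw π _ s _) hp).trans ?_
      rw [mean_add (BddOn.const _ _) (M.bddOn_trajLaw π _ s _), mean_const,
        mean_mul _ (M.bddOn_trajLaw π _ s _),
        mean_add (M.bddOn_trajLaw π _ s _) (M.bddOn_trajLaw π _ s _)]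
      have h1 := mean_trajLaw_levelMean_norm_sq_le hτ hf hG (le_refl (2 ^ q)) s
      have h2 := mean_trajLaw_levelMean_norm_sq_le hτ hf hG (j := q - 1) (n := 2 ^ q)
        (Nat.pow_le_pow_right (by norm_num) (Nat.sub_le q 1)) s
      -- This is where `q ≥ 1` on the support of the level law matters, because the subtraction is
      -- truncated.
      have h3 : (2 : ℝ) ^ q = 2 * 2 ^ (q - 1) := by
        rw [← pow_succ', Nat.sub_add_cancel hq1]
      calc _ ≤ 2 * B ^ 2 + 4 * (2 ^ q) ^ 2 * (5 * τ * G ^ 2 / 2 ^ q +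
            5 * τ * G ^ 2 / 2 ^ (q - 1)) := by gcongr
        _ = 2 * B ^ 2 + 60 * τ * G ^ 2 * 2 ^ q := by
          rw [h3]
          field_simp
          ring
    · simp only [mlmc, hq, if_false, trajLength, add_zero]
      refine mean_le (M.bddOn_trajLaw π _ s _) fun zs hzs => ?_
      have hl := M.length_of_mem_support_trajLaw π _ s hzs
      have := (hB0 zs).resolve_right fun h => by
        rw [h] at hl
        simp at hl
      linarith [sq_nonneg B]
  refine (mean_mono ?_ ?_ key).trans ?_
  · have hb := (M.bddOn_stepLaw_mlmc π Tmax hB s).norm_sq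
    obtain ⟨C, hC⟩ := BddOn.mean_bind (p := levelLaw) hb
    refine ⟨C, fun q hq => ?_⟩
    have := hC q hq
    beta_reduce at this ⊢
    rwa [mean_map (M.bddOn_trajLaw π _ s _)] at this
  · exact (BddOn.const _ _).add (bddOn_levelLaw_ite Tmax _)
  · rw [mean_add (BddOn.const _ _) (bddOn_levelLaw_ite Tmax _), mean_const, mean_levelLaw_ite hT]
    have h2 : ∀ j : ℕ, ((1 / 2 : ℝ) ^ (j + 1)) • (60 * τ * G ^ 2 * 2 ^ (j + 1)) =
        60 * τ * G ^ 2 := fun j => by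
      rw [smul_eq_mul, mul_left_comm, ← mul_pow]
      norm_num
    simp_rw [h2]
    rw [Finset.sum_const, Finset.card_range, nsmul_eq_mul, mul_comm (Nat.log 2 Tmax : ℝ)]

end Moments

end CMDP

/-! ### The critic equation -/

namespace CMDP

section StationaryMean

variable {S A : Type*} [Fintype S] [Fintype A] (M : CMDP S A) (π : S → PMF A)

lemma map_stationaryMean {V W : Type*} [AddCommGroup V] [Module ℝ V] [AddCommGroup W] [Module ℝ W]
    (L : V →ₗ[ℝ] W) (f : Transition S A → V) :
    L (M.stationaryMean π f) = M.stationaryMean π fun z => L (f z) := by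
  simp [stationaryMean, map_sum]

lemma stationaryMean_add {V : Type*} [AddCommGroup V] [Module ℝ V] (f g : Transition S A → V) :
    M.stationaryMean π (fun z => f z + g z) = M.stationaryMean π f + M.stationaryMean π g := by
  simp [stationaryMean, smul_add, Finset.sum_add_distrib]

lemma stationaryMean_sub {V : Type*} [AddCommGroup V] [Module ℝ V] (f g : Transition S A → V) :
    M.stationaryMean π (fun z => f z - g z) = M.stationaryMean π f - M.stationaryMean π g := by
  simp [stationaryMean, smul_sub, Finset.sum_sub_distrib]

variable [DecidableEq S]

lemma stationaryMean_const {V : Type*} [NormedAddCommGroup V] [NormedSpace ℝ V] (c : V) :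
    M.stationaryMean π (fun _ => c) = c := by
  rw [stationaryMean_eq]
  have h : ∀ s, M.stepMean π (fun _ => c) s = c := fun s => by
    rw [stepMean]
    simp_rw [← Finset.sum_smul]
    rw [M.sum_weight, one_smul]
  simp_rw [h]
  rw [← Finset.sum_smul, (M.isStationary_stationary π).2.1, one_smul]

lemma norm_stationaryMean_le {V : Type*} [NormedAddCommGroup V] [NormedSpace ℝ V]
    {f : Transition S A → V} {C : ℝ} (h : ∀ z, ‖f z‖ ≤ C) : ‖M.stationaryMean π f‖ ≤ C := by
  obtain ⟨h0, h1, -⟩ := M.isStationary_stationary π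
  rw [stationaryMean_eq]
  calc _ ≤ ∑ s, M.stationary π s * C := norm_sum_le_of_le _ fun s _ => by
        rw [norm_smul, Real.norm_of_nonneg (h0 s)]
        exact mul_le_mul_of_nonneg_left (M.norm_stepMean_le π h s) (h0 s)
    _ = C := by rw [← Finset.sum_mul, h1, one_mul]

end StationaryMean

section Critic

variable {S A : Type*} {m : ℕ}

/-- The vector `[η, ζ]`. -/
def block (η : ℝ) (ζ : EuclideanSpace ℝ (Fin m)) : CriticSpace m :=
  WithLp.toLp 2 (Sum.elim (fun _ => η) fun i => ζ i)

/-- The weights `ζ` of `ξ = [η, ζ]`. -/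
def weights (ξ : CriticSpace m) : EuclideanSpace ℝ (Fin m) :=
  WithLp.toLp 2 fun i => ξ (Sum.inr i)

lemma norm_sq_eq_add (ξ : CriticSpace m) : ‖ξ‖ ^ 2 = ξ (Sum.inl ()) ^ 2 + ‖weights ξ‖ ^ 2 := by
  simp [EuclideanSpace.norm_sq_eq, weights]

lemma inner_block (ξ : CriticSpace m) (η : ℝ) (ζ : EuclideanSpace ℝ (Fin m)) :
    inner ℝ ξ (block η ζ) = ξ (Sum.inl ()) * η + inner ℝ (weights ξ) ζ := by
  simp [PiLp.inner_apply, block, weights, mul_comm]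

lemma norm_block_sq (η : ℝ) (ζ : EuclideanSpace ℝ (Fin m)) :
    ‖block η ζ‖ ^ 2 = η ^ 2 + ‖ζ‖ ^ 2 := by
  rw [norm_sq_eq_add]
  rfl

lemma abs_inl_le (ξ : CriticSpace m) : |ξ (Sum.inl ())| ≤ ‖ξ‖ := by
  apply abs_le_of_sq_le_sq _ (norm_nonneg _)
  rw [norm_sq_eq_add]
  nlinarith [sq_nonneg ‖weights ξ‖]

lemma norm_weights_le (ξ : CriticSpace m) : ‖weights ξ‖ ≤ ‖ξ‖ := by
  apply le_of_sq_le_sq _ (norm_nonneg _)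
  rw [norm_sq_eq_add]
  nlinarith [sq_nonneg (ξ (Sum.inl ()))]

lemma norm_block_zero_right (η : ℝ) : ‖block η (0 : EuclideanSpace ℝ (Fin m))‖ = |η| := by
  rw [← abs_of_nonneg (norm_nonneg (block η (0 : EuclideanSpace ℝ (Fin m)))),
    ← sq_eq_sq_iff_abs_eq_abs, norm_block_sq]
  simp

lemma norm_block_zero_left (ζ : EuclideanSpace ℝ (Fin m)) : ‖block 0 ζ‖ = ‖ζ‖ := by
  rw [← abs_of_nonneg (norm_nonneg (block 0 ζ)), ← abs_of_nonneg (norm_nonneg ζ),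
    ← sq_eq_sq_iff_abs_eq_abs, norm_block_sq]
  simp

variable (φ : Signal → S → EuclideanSpace ℝ (Fin m)) (cγ : ℝ)

/-- The part of `A_g(z) ξ` that depends on the transition. -/
def criticNoise (g : Signal) (ξ : CriticSpace m) (z : Transition S A) : CriticSpace m :=
  block 0 ((ξ (Sum.inl ()) + inner ℝ (weights ξ) (φ g z.1 - φ g z.2.2)) • φ g z.1)

/-- The large entry `c_γ` is deterministic. Separating it leaves a random part bounded by `3 ‖ξ‖`,
so the fluctuations do not grow with `c_γ`. -/
lemma toEuclideanCLM_criticMatrixAt (g : Signal) (ξ : CriticSpace m) (z : Transition S A) :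
    Matrix.toEuclideanCLM (𝕜 := ℝ) (criticMatrixAt φ cγ g z) ξ =
      block (cγ * ξ (Sum.inl ())) 0 + criticNoise φ g ξ z := by
  ext i
  rcases i with i | i
  · simp [criticMatrixAt, block, criticNoise, Matrix.fromBlocks, Matrix.mulVec, dotProduct]
  · simp [criticMatrixAt, block, criticNoise, weights, Matrix.fromBlocks, Matrix.mulVec,
      dotProduct, PiLp.inner_apply, Finset.sum_mul, add_mul]
    rw [mul_comm]
    exact congrArg _ (Finset.sum_congr rfl fun j _ => by ring)

lemma criticDirectionAt_eq (M : CMDP S A) (g : Signal) (ξ : CriticSpace m) (z : Transition S A) :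
    M.criticDirectionAt φ cγ g ξ z = Matrix.toEuclideanCLM (𝕜 := ℝ) (criticMatrixAt φ cγ g z) ξ -
      WithLp.toLp 2 (M.criticVectorAt φ cγ g z) := rfl

lemma abs_signal_le (M : CMDP S A) (g : Signal) (s : S) (a : A) : |M.signal g s a| ≤ 1 := by
  rw [abs_le]
  cases g
  · have := M.r_mem s a
    exact ⟨by linarith [this.1, show M.signal Signal.r s a = M.r s a from rfl], this.2⟩
  · exact M.c_mem s a

variable {φ cγ}

lemma norm_criticNoise_le (hφ : ∀ g s, ‖φ g s‖ ≤ 1) (g : Signal) (ξ : CriticSpace m)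
    (z : Transition S A) : ‖criticNoise φ g ξ z‖ ≤ 3 * ‖ξ‖ := by
  rw [criticNoise, norm_block_zero_left, norm_smul, Real.norm_eq_abs]
  have h1 := abs_inl_le ξ
  have h2 := norm_weights_le ξ
  have h3 := abs_real_inner_le_norm (weights ξ) (φ g z.1 - φ g z.2.2)
  have h4 : ‖φ g z.1 - φ g z.2.2‖ ≤ 2 := (norm_sub_le _ _).trans (by linarith [hφ g z.1, hφ g z.2.2])
  have h5 : ‖weights ξ‖ * ‖φ g z.1 - φ g z.2.2‖ ≤ ‖ξ‖ * 2 :=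
    mul_le_mul h2 h4 (norm_nonneg _) (norm_nonneg _)
  have h6 := abs_add_le (ξ (Sum.inl ())) (inner ℝ (weights ξ) (φ g z.1 - φ g z.2.2))
  calc _ ≤ (3 * ‖ξ‖) * 1 := mul_le_mul (by linarith) (hφ g z.1) (norm_nonneg _)
        (by positivity)
    _ = _ := mul_one _

lemma norm_criticMatrixAt_le (hφ : ∀ g s, ‖φ g s‖ ≤ 1) (hc : 0 ≤ cγ) (g : Signal)
    (ξ : CriticSpace m) (z : Transition S A) :
    ‖Matrix.toEuclideanCLM (𝕜 := ℝ) (criticMatrixAt φ cγ g z) ξ‖ ≤ (cγ + 3) * ‖ξ‖ := by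
  rw [toEuclideanCLM_criticMatrixAt]
  refine (norm_add_le _ _).trans ?_
  rw [norm_block_zero_right, abs_mul, abs_of_nonneg hc]
  have := mul_le_mul_of_nonneg_left (abs_inl_le ξ) hc
  linarith [norm_criticNoise_le hφ g ξ z]

lemma norm_criticVectorAt_le (M : CMDP S A) (hφ : ∀ g s, ‖φ g s‖ ≤ 1) (hc : 0 ≤ cγ) (g : Signal)
    (z : Transition S A) :
    ‖(WithLp.toLp 2 (M.criticVectorAt φ cγ g z) : CriticSpace m)‖ ≤ cγ + 1 := by
  have h : (WithLp.toLp 2 (M.criticVectorAt φ cγ g z) : CriticSpace m) =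
      block (cγ * M.signal g z.1 z.2.1) 0 + block 0 (M.signal g z.1 z.2.1 • φ g z.1) := by
    ext i
    rcases i with i | i <;> simp [criticVectorAt, block]
  rw [h]
  refine (norm_add_le _ _).trans (add_le_add ?_ ?_)
  · rw [norm_block_zero_right, abs_mul, abs_of_nonneg hc]
    exact mul_le_of_le_one_right hc (M.abs_signal_le g _ _)
  · rw [norm_block_zero_left, norm_smul]
    exact mul_le_one₀ (M.abs_signal_le g _ _) (norm_nonneg _) (hφ g _)

variable [Fintype S] [Fintype A] (M : CMDP S A) (π : S → PMF A)

variable (φ cγ) in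
/-- The mean critic operator `ξ ↦ A_g ξ`. -/
def criticOp (g : Signal) : CriticSpace m →L[ℝ] CriticSpace m :=
  Matrix.toEuclideanCLM (𝕜 := ℝ) (M.criticMatrix φ cγ π g)

lemma criticOp_apply (g : Signal) (ξ : CriticSpace m) :
    M.criticOp φ cγ π g ξ = M.stationaryMean π fun z =>
      Matrix.toEuclideanCLM (𝕜 := ℝ) (criticMatrixAt φ cγ g z) ξ :=
  M.map_stationaryMean π ((LinearMap.applyₗ ξ) ∘ₗ ContinuousLinearMap.coeLM ℝ ∘ₗ
    (Matrix.toEuclideanCLM (𝕜 := ℝ) (n := Unit ⊕ Fin m)).toAlgEquiv.toLinearMap)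
    (criticMatrixAt φ cγ g)

lemma toLp_criticVector (g : Signal) :
    (WithLp.toLp 2 (M.criticVector φ cγ π g) : CriticSpace m) = M.stationaryMean π fun z =>
      WithLp.toLp 2 (M.criticVectorAt φ cγ g z) :=
  M.map_stationaryMean π (WithLp.linearEquiv 2 ℝ (Unit ⊕ Fin m → ℝ)).symm.toLinearMap
    (M.criticVectorAt φ cγ g)

variable [DecidableEq S]

lemma criticOp_eq (g : Signal) (ξ : CriticSpace m) :
    M.criticOp φ cγ π g ξ =
      block (cγ * ξ (Sum.inl ())) 0 + M.stationaryMean π (criticNoise φ g ξ) := by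
  rw [criticOp_apply]
  simp_rw [toEuclideanCLM_criticMatrixAt]
  rw [stationaryMean_add, stationaryMean_const]

lemma norm_criticOp_le (hφ : ∀ g s, ‖φ g s‖ ≤ 1) (hc : 0 ≤ cγ) (g : Signal) (ξ : CriticSpace m) :
    ‖M.criticOp φ cγ π g ξ‖ ≤ (cγ + 3) * ‖ξ‖ := by
  rw [criticOp_apply]
  exact M.norm_stationaryMean_le π (norm_criticMatrixAt_le hφ hc g ξ)

/-- The mean critic operator is coercive when `c_γ` is large. -/
lemma le_inner_criticOp (hφ : ∀ g s, ‖φ g s‖ ≤ 1) {lam : ℝ} (hlam : 0 < lam)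
    (hc : lam + 2 / lam ≤ cγ) {d : ℕ} {π : ParamSpace d → S → PMF A} {Θ : Set (ParamSpace d)}
    (hpos : M.CriticPositive φ π Θ lam) {θ : ParamSpace d} (hθ : θ ∈ Θ) (g : Signal)
    (ξ : CriticSpace m) :
    7 / 8 * lam * ‖ξ‖ ^ 2 ≤ inner ℝ ξ (M.criticOp φ cγ (π θ) g ξ) := by
  set η := ξ (Sum.inl ()) with hη
  set ζ := weights ξ with hζ
  have h1 : inner ℝ ξ (M.stationaryMean (π θ) (criticNoise φ g ξ)) =
      M.stationaryMean (π θ) (fun z : Transition S A => η * inner ℝ ζ (φ g z.1)) +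
      M.stationaryMean (π θ) (fun z : Transition S A =>
        inner ℝ ζ (φ g z.1) * inner ℝ ζ (φ g z.1 - φ g z.2.2)) := by
    rw [← stationaryMean_add]
    refine (M.map_stationaryMean (π θ) (innerₛₗ ℝ ξ) _).trans ?_
    congr 1
    ext z
    rw [innerₛₗ_apply_apply, criticNoise, inner_block, inner_smul_right]
    ring
  have h2 : ‖M.stationaryMean (π θ) (fun z : Transition S A => η * inner ℝ ζ (φ g z.1))‖ ≤
      |η| * ‖ζ‖ := by
    refine M.norm_stationaryMean_le (π θ) fun z => ?_
    rw [Real.norm_eq_abs, abs_mul]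
    refine mul_le_mul_of_nonneg_left ((abs_real_inner_le_norm _ _).trans ?_) (abs_nonneg _)
    exact mul_le_of_le_one_right (norm_nonneg _) (hφ g _)
  have h3 : lam * ‖ζ‖ ^ 2 ≤ M.stationaryMean (π θ) (fun z : Transition S A =>
        inner ℝ ζ (φ g z.1) * inner ℝ ζ (φ g z.1 - φ g z.2.2)) := by
    have h := hpos θ hθ g (fun i => ζ i)
    rw [Matrix.sub_mulVec, dotProduct_sub, Matrix.smul_mulVec, Matrix.one_mulVec,
      dotProduct_smul] at h
    have hL := M.map_stationaryMean (π θ)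
      ((dotProductBilin ℝ ℝ (fun i => ζ i)) ∘ₗ (Matrix.mulVecBilin ℝ ℝ).flip (fun i => ζ i))
      (fun z : Transition S A =>
        Matrix.vecMulVec (fun i => φ g z.1 i) (fun j => φ g z.1 j - φ g z.2.2 j))
    have hn : (fun i => ζ i) ⬝ᵥ (fun i => ζ i) = ‖ζ‖ ^ 2 := by
      rw [EuclideanSpace.norm_sq_eq]
      simp [dotProduct, pow_two]
    rw [hn] at h
    have hR : ∀ z : Transition S A, (fun i => ζ i) ⬝ᵥ
        (Matrix.vecMulVec (fun i => φ g z.1 i) (fun j => φ g z.1 j - φ g z.2.2 j) *ᵥ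
          (fun i => ζ i)) = inner ℝ ζ (φ g z.1) * inner ℝ ζ (φ g z.1 - φ g z.2.2) := by
      intro z
      rw [Matrix.vecMulVec_mulVec]
      simp [PiLp.inner_apply, dotProduct, Finset.sum_mul, mul_comm, mul_assoc]
      exact Finset.sum_congr rfl fun i _ => mul_left_comm _ _ _
    simp only [LinearMap.comp_apply, LinearMap.flip_apply, dotProductBilin_apply_apply,
      Matrix.mulVecBilin_apply] at hL
    simp_rw [hR] at hL
    rw [hL, smul_eq_mul] at h
    linarith
  rw [criticOp_eq, inner_add_right, inner_block, inner_zero_right, h1, norm_sq_eq_add, ← hη, ← hζ]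
  rw [Real.norm_eq_abs] at h2
  have h4 := (abs_le.1 h2).1
  -- Weighted AM-GM for the coupling of `η` and `ζ`: the `ζ` part loses `lam / 8`, whence the
  -- constant `7/8`, and the `η` part loses `2 / lam`, which `c_γ ≥ lam + 2 / lam` can afford.
  have h5 : 2 / lam * η ^ 2 + lam / 8 * ‖ζ‖ ^ 2 ≥ |η| * ‖ζ‖ := by
    have h6 : 0 ≤ (4 * |η| - lam * ‖ζ‖) ^ 2 / (8 * lam) := by positivity
    have h7 : (4 * |η| - lam * ‖ζ‖) ^ 2 / (8 * lam) =
        2 / lam * η ^ 2 + lam / 8 * ‖ζ‖ ^ 2 - |η| * ‖ζ‖ := by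
      rw [← sq_abs η]
      field_simp
      ring
    linarith
  have h8 := mul_le_mul_of_nonneg_right hc (sq_nonneg η)
  have h9 : 0 ≤ lam * η ^ 2 := by positivity
  nlinarith

/-- Coercivity forces the kernel to be trivial. -/
lemma isUnit_det_criticMatrix (hφ : ∀ g s, ‖φ g s‖ ≤ 1) {lam : ℝ} (hlam : 0 < lam)
    (hc : lam + 2 / lam ≤ cγ) {d : ℕ} {π : ParamSpace d → S → PMF A} {Θ : Set (ParamSpace d)}
    (hpos : M.CriticPositive φ π Θ lam) {θ : ParamSpace d} (hθ : θ ∈ Θ) (g : Signal) :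
    IsUnit (M.criticMatrix φ cγ (π θ) g).det := by
  rw [isUnit_iff_ne_zero]
  intro h
  obtain ⟨x, hx0, hx⟩ := Matrix.exists_mulVec_eq_zero_iff.2 h
  have h1 := M.le_inner_criticOp hφ hlam hc hpos hθ g (WithLp.toLp 2 x)
  have h2 : M.criticOp φ cγ (π θ) g (WithLp.toLp 2 x) = 0 := by
    change WithLp.toLp 2 (M.criticMatrix φ cγ (π θ) g *ᵥ x) = 0
    rw [hx]
    rfl
  rw [h2, inner_zero_right] at h1
  have h3 : ‖(WithLp.toLp 2 x : CriticSpace m)‖ ^ 2 ≤ 0 := by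
    by_contra hn
    have : 0 < 7 / 8 * lam * ‖(WithLp.toLp 2 x : CriticSpace m)‖ ^ 2 := by
      push Not at hn
      positivity
    linarith
  have h4 : (WithLp.toLp 2 x : CriticSpace m) = 0 := by
    rw [← norm_eq_zero]
    exact pow_eq_zero_iff two_ne_zero |>.1 (le_antisymm h3 (sq_nonneg _))
  exact hx0 (congrArg WithLp.ofLp h4)

lemma criticOp_criticTarget (g : Signal) (h : IsUnit (M.criticMatrix φ cγ π g).det) :
    M.criticOp φ cγ π g (M.criticTarget φ cγ π g) = WithLp.toLp 2 (M.criticVector φ cγ π g) := by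
  change WithLp.toLp 2 (M.criticMatrix φ cγ π g *ᵥ
    ((M.criticMatrix φ cγ π g)⁻¹ *ᵥ M.criticVector φ cγ π g)) = _
  rw [Matrix.mulVec_mulVec, Matrix.mul_nonsing_inv _ h, Matrix.one_mulVec]

/-- Pairing `A ξ^* = b` with `ξ^*` gives `7/8 * lam * ‖ξ^*‖² ≤ (c_γ + 1) ‖ξ^*‖`; the factor `8/7` is
rounded up to `2`. -/
lemma norm_criticTarget_le (hφ : ∀ g s, ‖φ g s‖ ≤ 1) {lam : ℝ} (hlam : 0 < lam)
    (hc : lam + 2 / lam ≤ cγ) {d : ℕ} {π : ParamSpace d → S → PMF A} {Θ : Set (ParamSpace d)}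
    (hpos : M.CriticPositive φ π Θ lam) {θ : ParamSpace d} (hθ : θ ∈ Θ) (g : Signal) :
    ‖M.criticTarget φ cγ (π θ) g‖ ≤ 2 * (cγ + 1) / lam := by
  have hc0 : 0 ≤ cγ := le_trans (by positivity) hc
  have h1 := M.le_inner_criticOp hφ hlam hc hpos hθ g (M.criticTarget φ cγ (π θ) g)
  rw [M.criticOp_criticTarget _ g (M.isUnit_det_criticMatrix hφ hlam hc hpos hθ g)] at h1
  have h2 := real_inner_le_norm (M.criticTarget φ cγ (π θ) g)
    (WithLp.toLp 2 (M.criticVector φ cγ (π θ) g))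
  have h3 : ‖(WithLp.toLp 2 (M.criticVector φ cγ (π θ) g) : CriticSpace m)‖ ≤ cγ + 1 := by
    rw [toLp_criticVector]
    exact M.norm_stationaryMean_le (π θ) (M.norm_criticVectorAt_le hφ hc0 g)
  set x := ‖M.criticTarget φ cγ (π θ) g‖
  rw [le_div_iff₀ hlam]
  rcases (norm_nonneg (M.criticTarget φ cγ (π θ) g)).eq_or_lt' with h0 | h0
  · rw [show x = 0 from h0]; linarith
  · have h4 := mul_le_mul_of_nonneg_left h3 h0.le
    have h5 : x * (7 / 8 * lam * x) ≤ x * (cγ + 1) := by nlinarith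
    have h6 := le_of_mul_le_mul_left h5 h0
    nlinarith

variable (φ cγ) in
-- The `c_γ` blocks of the sample and of the mean coincide and cancel. The deviation is thus at most
-- `6 ‖ξ - ξ'‖` plus the residual at `ξ'`, with no factor `c_γ` in front of the error.
lemma criticDirectionAt_sub (g : Signal) (ξ ξ' : CriticSpace m) (z : Transition S A) :
    M.criticDirectionAt φ cγ g ξ z - M.criticOp φ cγ π g (ξ - ξ') =
      criticNoise φ g (ξ - ξ') z - M.stationaryMean π (criticNoise φ g (ξ - ξ')) +
        M.criticDirectionAt φ cγ g ξ' z := by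
  rw [criticOp_eq, criticDirectionAt_eq, criticDirectionAt_eq]
  have h := toEuclideanCLM_criticMatrixAt φ cγ g (ξ - ξ') z
  rw [map_sub, sub_eq_iff_eq_add] at h
  rw [h]
  abel

/-- Because `A ξ^* = b`, the stationary mean of the direction at `ξ` is `A (ξ - ξ^*)`; this is the
centring constant used in the mixing bounds. -/
lemma stationaryMean_criticDirectionAt (g : Signal)
    (h : IsUnit (M.criticMatrix φ cγ π g).det) (ξ : CriticSpace m) :
    M.stationaryMean π (fun z => M.criticDirectionAt φ cγ g ξ z -
      M.criticOp φ cγ π g (ξ - M.criticTarget φ cγ π g)) = 0 := by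
  simp_rw [criticDirectionAt_eq]
  rw [stationaryMean_sub, stationaryMean_sub, stationaryMean_const, ← criticOp_apply,
    ← toLp_criticVector, map_sub, criticOp_criticTarget _ _ _ h]
  abel

/-- A bound for `‖A_g(z) ξ_g^* - b_g(z)‖`. -/
def residualBound (lam cγ : ℝ) : ℝ := (cγ + 3) * (2 * (cγ + 1) / lam) + (cγ + 1)

lemma norm_criticDirectionAt_target_le (hφ : ∀ g s, ‖φ g s‖ ≤ 1) {lam : ℝ} (hlam : 0 < lam)
    (hc : lam + 2 / lam ≤ cγ) {d : ℕ} {π : ParamSpace d → S → PMF A} {Θ : Set (ParamSpace d)}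
    (hpos : M.CriticPositive φ π Θ lam) {θ : ParamSpace d} (hθ : θ ∈ Θ) (g : Signal)
    (z : Transition S A) :
    ‖M.criticDirectionAt φ cγ g (M.criticTarget φ cγ (π θ) g) z‖ ≤ residualBound lam cγ := by
  have hc0 : 0 ≤ cγ := le_trans (by positivity) hc
  rw [criticDirectionAt_eq]
  refine (norm_sub_le _ _).trans (add_le_add ((norm_criticMatrixAt_le hφ hc0 g _ z).trans ?_)
    (M.norm_criticVectorAt_le hφ hc0 g z))
  exact mul_le_mul_of_nonneg_left (M.norm_criticTarget_le hφ hlam hc hpos hθ g) (by linarith)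

lemma norm_criticDirectionAt_le (hφ : ∀ g s, ‖φ g s‖ ≤ 1) (hc : 0 ≤ cγ) {g : Signal}
    {ξ' : CriticSpace m} {R : ℝ} (hR : ∀ z, ‖M.criticDirectionAt φ cγ g ξ' z‖ ≤ R)
    (ξ : CriticSpace m) (z : Transition S A) :
    ‖M.criticDirectionAt φ cγ g ξ z‖ ≤ (cγ + 3) * ‖ξ - ξ'‖ + R := by
  have h : M.criticDirectionAt φ cγ g ξ z =
      Matrix.toEuclideanCLM (𝕜 := ℝ) (criticMatrixAt φ cγ g z) (ξ - ξ') +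
        M.criticDirectionAt φ cγ g ξ' z := by
    rw [criticDirectionAt_eq, criticDirectionAt_eq, map_sub]
    abel
  rw [h]
  exact (norm_add_le _ _).trans (add_le_add (norm_criticMatrixAt_le hφ hc g _ z) (hR z))

lemma norm_criticDirectionAt_sub_le (hφ : ∀ g s, ‖φ g s‖ ≤ 1) {g : Signal}
    {ξ' : CriticSpace m} {R : ℝ} (hR : ∀ z, ‖M.criticDirectionAt φ cγ g ξ' z‖ ≤ R)
    (ξ : CriticSpace m) (z : Transition S A) :
    ‖M.criticDirectionAt φ cγ g ξ z - M.criticOp φ cγ π g (ξ - ξ')‖ ≤ 6 * ‖ξ - ξ'‖ + R := by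
  rw [criticDirectionAt_sub]
  refine (norm_add_le _ _).trans (add_le_add ((norm_sub_le _ _).trans ?_) (hR z))
  have h := norm_criticNoise_le (S := S) (A := A) hφ g (ξ - ξ')
  linarith [h z, M.norm_stationaryMean_le π h]

end Critic

end CMDP

/-! ### The inner loop of the critic -/

namespace CMDP

variable {S A : Type*} (M : CMDP S A) (π : S → PMF A) (Tmax : ℕ)

lemma innerLaw_succ (n : ℕ) (s : S) :
    M.innerLaw π Tmax (n + 1) s = (M.stepLaw π Tmax s).bind fun x =>
      (M.innerLaw π Tmax n (trajEnd s x.2)).map fun xs => x :: xs := by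
  rw [innerLaw, stepLaw, PMF.bind_bind]
  simp_rw [PMF.bind_map]
  rfl

/-- The last inner-loop step starts where the previous ones ended. -/
lemma innerLaw_succ_last (n : ℕ) (s : S) :
    M.innerLaw π Tmax (n + 1) s = (M.innerLaw π Tmax n s).bind fun xs =>
      (M.stepLaw π Tmax (innerEnd s xs)).map fun x => xs ++ [x] := by
  induction n generalizing s with
  | zero =>
    rw [innerLaw_succ]
    simp only [innerLaw, PMF.pure_bind, PMF.pure_map]
    rfl
  | succ n ih =>
    rw [innerLaw_succ, M.innerLaw_succ π Tmax n s, PMF.bind_bind]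
    simp_rw [ih, PMF.map_bind, PMF.bind_map, PMF.map_comp]
    rfl

lemma bddOn_mean_stepLaw {V : Type*} [NormedAddCommGroup V] [NormedSpace ℝ V] [CompleteSpace V]
    {n : ℕ} {s : S} {F : List (InnerSample S A) → V}
    (hF : BddOn (M.innerLaw π Tmax (n + 1) s) F) :
    BddOn (M.innerLaw π Tmax n s) fun xs =>
      mean (M.stepLaw π Tmax (innerEnd s xs)) fun x => F (xs ++ [x]) := by
  rw [innerLaw_succ_last] at hF
  obtain ⟨C, hC⟩ := hF.mean_bind
  refine ⟨C, fun xs hxs => ?_⟩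
  have h := hC xs hxs
  beta_reduce at h
  rwa [mean_map (hF.of_bind hxs).of_map] at h

lemma mean_innerLaw_succ {V : Type*} [NormedAddCommGroup V] [NormedSpace ℝ V] [CompleteSpace V]
    {n : ℕ} {s : S} {F : List (InnerSample S A) → V}
    (hF : BddOn (M.innerLaw π Tmax (n + 1) s) F) :
    mean (M.innerLaw π Tmax (n + 1) s) F = mean (M.innerLaw π Tmax n s) fun xs =>
      mean (M.stepLaw π Tmax (innerEnd s xs)) fun x => F (xs ++ [x]) := by
  rw [innerLaw_succ_last] at hF ⊢
  rw [mean_bind hF]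
  exact mean_congr fun xs hxs => mean_map (hF.of_bind hxs).of_map

lemma length_of_mem_support_innerLaw (n : ℕ) (s : S) {xs : List (InnerSample S A)}
    (h : xs ∈ (M.innerLaw π Tmax n s).support) : xs.length = n := by
  induction n generalizing s xs with
  | zero =>
    rw [innerLaw, PMF.mem_support_pure_iff] at h
    simp [h]
  | succ n ih =>
    rw [innerLaw_succ, PMF.mem_support_bind_iff] at h
    obtain ⟨x, -, h⟩ := h
    rw [PMF.mem_support_map_iff] at h
    obtain ⟨xs', h', rfl⟩ := h
    simp [ih _ h']

end CMDP

/-! ### Deterministic recursions and the step-size budget. -/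

section Numeric

variable {V : Type*} [NormedAddCommGroup V] [InnerProductSpace ℝ V]

/-- One step of a perturbed coercive linear recursion. -/
lemma norm_sub_smul_add_sq_le {γ lam c : ℝ} (hγ : 0 ≤ γ) (hlam : 0 < lam) (hγl : γ * lam ≤ 1)
    (hγc : γ * c ^ 2 ≤ lam / 12) {a a' b : V} (h1 : 7 / 8 * lam * ‖a‖ ^ 2 ≤ inner ℝ a a')
    (h2 : ‖a'‖ ≤ c * ‖a‖) :
    ‖a - γ • (a' + b)‖ ^ 2 ≤ (1 - γ * lam) * ‖a‖ ^ 2 + γ * lam * (4 / lam ^ 2 * ‖b‖ ^ 2) := by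
  rw [norm_sub_sq_real, norm_smul, real_inner_smul_right, inner_add_right, Real.norm_of_nonneg hγ]
  have h3 := (abs_le.1 (abs_real_inner_le_norm a b)).1
  have h4 : ‖a' + b‖ ^ 2 ≤ 2 * (c ^ 2 * ‖a‖ ^ 2) + 2 * ‖b‖ ^ 2 := by
    have h5 : ‖a' + b‖ ≤ c * ‖a‖ + ‖b‖ := (norm_add_le _ _).trans (by linarith)
    calc ‖a' + b‖ ^ 2 ≤ (c * ‖a‖ + ‖b‖) ^ 2 := pow_le_pow_left₀ (norm_nonneg _) h5 2
      _ ≤ 2 * ((c * ‖a‖) ^ 2 + ‖b‖ ^ 2) := add_sq_le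
      _ = _ := by ring
  have h6 : 2 * (‖a‖ * ‖b‖) ≤ lam / 2 * ‖a‖ ^ 2 + 2 / lam * ‖b‖ ^ 2 := by
    have h7 : 0 ≤ (lam * ‖a‖ - 2 * ‖b‖) ^ 2 / (2 * lam) := by positivity
    have h8 : (lam * ‖a‖ - 2 * ‖b‖) ^ 2 / (2 * lam) =
        lam / 2 * ‖a‖ ^ 2 + 2 / lam * ‖b‖ ^ 2 - 2 * (‖a‖ * ‖b‖) := by
      field_simp
      ring
    linarith
  have h9 : γ * ‖a' + b‖ ^ 2 ≤ lam / 6 * ‖a‖ ^ 2 + 2 / lam * ‖b‖ ^ 2 := by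
    have h10 : γ ≤ 1 / lam := by rw [le_div_iff₀ hlam]; exact hγl
    have h11 := mul_le_mul_of_nonneg_right h10 (sq_nonneg ‖b‖)
    have h12 := mul_le_mul_of_nonneg_right hγc (sq_nonneg ‖a‖)
    have h13 := mul_le_mul_of_nonneg_left h4 hγ
    have h14 : 2 / lam * ‖b‖ ^ 2 = 2 * (1 / lam * ‖b‖ ^ 2) := by ring
    rw [h14]
    nlinarith
  have h15 : γ * lam * (4 / lam ^ 2 * ‖b‖ ^ 2) = γ * (4 / lam * ‖b‖ ^ 2) := by
    field_simp
  have h16 : 4 / lam * ‖b‖ ^ 2 = 2 * (2 / lam * ‖b‖ ^ 2) := by ring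
  rw [h15, h16, mul_pow]
  have h17 : 0 ≤ lam * ‖a‖ ^ 2 := by positivity
  -- Coercivity supplies `7/4 * lam`, the cross term with `b` takes `lam / 2` and the quadratic term
  -- `lam / 6`. At least `lam` remains.
  have key : -(2 * (inner ℝ a a' + inner ℝ a b)) + γ * ‖a' + b‖ ^ 2 ≤
      -(lam * ‖a‖ ^ 2) + 2 * (2 / lam * ‖b‖ ^ 2) := by
    nlinarith
  have := mul_le_mul_of_nonneg_left key hγ
  linarith

/-- A contraction with a constant perturbation. -/
lemma le_pow_mul_add {u : ℕ → ℝ} {ρ D : ℝ} (hρ : 0 ≤ ρ) (hD : 0 ≤ D)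
    (h : ∀ n, u (n + 1) ≤ ρ * u n + (1 - ρ) * D) (n : ℕ) : u n ≤ ρ ^ n * u 0 + D := by
  induction n with
  | zero => simpa using hD
  | succ n ih =>
    have := mul_le_mul_of_nonneg_left ih hρ
    rw [pow_succ]
    nlinarith [h n]

end Numeric

/-- The conditions on the step size and the maximal trajectory length, with `κ = 100`. -/
structure StepSize (lam cγ γ : ℝ) (τ Tmax : ℕ) : Prop where
  lam_pos : 0 < lam
  large : 100 * (lam + 1 / lam) ≤ cγ
  nonneg : 0 ≤ γ
  one_le_tau : 1 ≤ τ
  le : γ * (24 * cγ ^ 2 * τ * Real.log Tmax) ≤ lam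
  le_Tmax : 8 * cγ ^ 2 * τ ≤ lam * Tmax

lemma large_bounds {lam cγ : ℝ} (hlam : 0 < lam) (h : 100 * (lam + 1 / lam) ≤ cγ) :
    200 ≤ cγ ∧ 100 * lam ≤ cγ ∧ 100 ≤ cγ * lam ∧ lam + 2 / lam ≤ cγ := by
  have h1 : 0 < 1 / lam := by positivity
  have h2 : lam * (1 / lam) = 1 := mul_one_div_cancel hlam.ne'
  have h3 : 2 ≤ lam + 1 / lam := by nlinarith [sq_nonneg (lam - 1)]
  have h4 : 2 / lam = 2 * (1 / lam) := by ring
  refine ⟨by linarith, by linarith, ?_, by linarith⟩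
  nlinarith

namespace StepSize

variable {lam cγ γ : ℝ} {τ Tmax : ℕ}

lemma tau_ge (h : StepSize lam cγ γ τ Tmax) : (1 : ℝ) ≤ τ := by exact_mod_cast h.one_le_tau

/-- The bound `3 > e` is what makes `log T_max ≥ 1`. It follows because `8 c_γ² ≤ lam T_max` while
`c_γ ≥ 200` and `c_γ ≥ 100 lam`. -/
lemma three_le (h : StepSize lam cγ γ τ Tmax) : 3 ≤ Tmax := by
  obtain ⟨h1, h2, -, -⟩ := large_bounds h.lam_pos h.large
  have h3 := h.le_Tmax
  have h4 := h.tau_ge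
  have h5 : (3 : ℝ) ≤ Tmax := by
    by_contra hn
    push Not at hn
    have := h.lam_pos
    have h6 : cγ ^ 2 ≤ cγ ^ 2 * τ := le_mul_of_one_le_right (sq_nonneg _) h4
    nlinarith
  exact_mod_cast h5

lemma Tmax_pos (h : StepSize lam cγ γ τ Tmax) : (0 : ℝ) < Tmax := by
  have := h.three_le
  exact_mod_cast (by omega : 0 < Tmax)

lemma one_le_log (h : StepSize lam cγ γ τ Tmax) : 1 ≤ Real.log Tmax := by
  rw [Real.le_log_iff_exp_le h.Tmax_pos]
  have : (3 : ℝ) ≤ Tmax := by exact_mod_cast h.three_le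
  linarith [Real.exp_one_lt_d9]

/-- The constant comes from `1 / log 2 < 3/2`. -/
lemma natLog_le (h : StepSize lam cγ γ τ Tmax) : (Nat.log 2 Tmax : ℝ) ≤ 3 / 2 * Real.log Tmax := by
  have h1 : (2 : ℝ) ^ Nat.log 2 Tmax ≤ Tmax := by
    exact_mod_cast Nat.pow_log_le_self 2 (by have := h.three_le; omega)
  have h2 := Real.log_le_log (by positivity) h1
  rw [Real.log_pow] at h2
  have := Real.log_two_gt_d9
  have h3 : (0 : ℝ) ≤ Nat.log 2 Tmax := Nat.cast_nonneg _
  nlinarith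

lemma mul_le (h : StepSize lam cγ γ τ Tmax) : γ * (τ * Real.log Tmax) * cγ ^ 2 ≤ lam / 24 := by
  have := h.le
  linarith

lemma mul_lam_le (h : StepSize lam cγ γ τ Tmax) : γ * lam ≤ 1 := by
  obtain ⟨h1, h2, -, -⟩ := large_bounds h.lam_pos h.large
  have h3 := h.mul_le
  have h4 : 1 ≤ τ * Real.log Tmax := one_le_mul_of_one_le_of_one_le h.tau_ge h.one_le_log
  have h5 : γ * cγ ^ 2 ≤ γ * (τ * Real.log Tmax) * cγ ^ 2 := by
    have := mul_le_mul_of_nonneg_left h4 h.nonneg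
    exact mul_le_mul_of_nonneg_right (by linarith) (sq_nonneg _)
  have h6 : γ * lam * lam ≤ 1 * lam := by
    have h7 : lam ^ 2 ≤ cγ ^ 2 := pow_le_pow_left₀ h.lam_pos.le (by linarith [h.lam_pos]) 2
    have := mul_le_mul_of_nonneg_left h7 h.nonneg
    nlinarith [h.lam_pos]
  exact le_of_mul_le_mul_right h6 h.lam_pos

lemma ratio_le (h : StepSize lam cγ γ τ Tmax) : τ / (Tmax : ℝ) * cγ ^ 2 ≤ lam / 8 := by
  have h1 := h.Tmax_pos
  rw [div_mul_eq_mul_div, div_le_iff₀ h1]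
  linarith [h.le_Tmax]

/-- One step of the second moment recursion, from the bounds on the bias and on the second moment
of the update direction. -/
lemma second_moment_step (h : StepSize lam cγ γ τ Tmax) {V : Type*} [NormedAddCommGroup V]
    [InnerProductSpace ℝ V] {e a' v : V} {R w : ℝ} (h1 : 7 / 8 * lam * ‖e‖ ^ 2 ≤ inner ℝ e a')
    (h2 : ‖v - a'‖ ≤ 4 * τ / Tmax * (6 * ‖e‖ + R))
    (h3 : w ≤ 2 * ((cγ + 3) * ‖e‖ + R) ^ 2 + 60 * τ * (6 * ‖e‖ + R) ^ 2 * Nat.log 2 Tmax) :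
    ‖e‖ ^ 2 - 2 * γ * inner ℝ e v + γ ^ 2 * w ≤ (1 - γ * lam) * ‖e‖ ^ 2 +
      (1 - (1 - γ * lam)) * (128 / lam ^ 2 * (τ / Tmax) ^ 2 * R ^ 2 +
        184 / lam * (γ * (τ * Real.log Tmax)) * R ^ 2) := by
  obtain ⟨hc1, hc2, -, -⟩ := large_bounds h.lam_pos h.large
  have hlam := h.lam_pos
  have hγ := h.nonneg
  have hm := h.mul_le
  have hr := h.ratio_le
  have hτ := h.tau_ge
  have hl1 := h.one_le_log
  have hJ := h.natLog_le
  have hr0 : 0 ≤ τ / (Tmax : ℝ) := by positivity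
  set r := τ / (Tmax : ℝ) with hrdef
  set ℓ := Real.log Tmax with hℓ
  set x := ‖e‖ with hx
  have hx0 : 0 ≤ x := norm_nonneg e
  have hq1 : 1 ≤ τ * ℓ := one_le_mul_of_one_le_of_one_le hτ hl1
  set q := τ * ℓ with hq
  -- the inner product
  have hin : 7 / 8 * lam * x ^ 2 - x * (4 * r * (6 * x + R)) ≤ inner ℝ e v := by
    have h4 := (abs_le.1 (abs_real_inner_le_norm e (v - a'))).1
    rw [inner_sub_right] at h4
    have h5 : ‖e‖ * ‖v - a'‖ ≤ x * (4 * r * (6 * x + R)) := by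
      rw [mul_div_assoc] at h2
      exact mul_le_mul_of_nonneg_left h2 hx0
    linarith
  -- Twice the bias cost is `48 r x² + 8 r R x`. Each of the two terms takes `lam / 8 * x²` from the
  -- `7/4 * lam * x²` of coercivity, which leaves `3/2`.
  have hr' : 384 * r ≤ lam := by
    have h4 : r * 40000 ≤ r * cγ ^ 2 := mul_le_mul_of_nonneg_left (by nlinarith) hr0
    linarith
  have hamgm : 8 * r * R * x ≤ lam / 8 * x ^ 2 + 128 / lam * (r ^ 2 * R ^ 2) := by
    have h7 : 0 ≤ (lam * x - 32 * (r * R)) ^ 2 / (8 * lam) := by positivity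
    have h8 : (lam * x - 32 * (r * R)) ^ 2 / (8 * lam) =
        lam / 8 * x ^ 2 + 128 / lam * (r ^ 2 * R ^ 2) - 8 * r * R * x := by
      field_simp
      ring
    linarith
  have hin' : -(2 * inner ℝ e v) ≤ -(3 / 2 * lam * x ^ 2) + 128 / lam * (r ^ 2 * R ^ 2) := by
    have h9 : 384 * r * x ^ 2 ≤ lam * x ^ 2 := mul_le_mul_of_nonneg_right hr' (sq_nonneg x)
    linarith
  -- the second moment
  have hw : w ≤ q * (6 * cγ ^ 2 * x ^ 2 + 184 * R ^ 2) := by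
    have h10 : ((cγ + 3) * x + R) ^ 2 ≤ 2 * (((cγ + 3) * x) ^ 2 + R ^ 2) := add_sq_le
    have h11 : (6 * x + R) ^ 2 ≤ 2 * ((6 * x) ^ 2 + R ^ 2) := add_sq_le
    have h12 : 60 * τ * (6 * x + R) ^ 2 * Nat.log 2 Tmax ≤
        90 * q * (2 * ((6 * x) ^ 2 + R ^ 2)) := by
      calc 60 * τ * (6 * x + R) ^ 2 * Nat.log 2 Tmax ≤
            60 * τ * (2 * ((6 * x) ^ 2 + R ^ 2)) * (3 / 2 * ℓ) := by gcongr
        _ = 90 * q * (2 * ((6 * x) ^ 2 + R ^ 2)) := by rw [hq]; ring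
    have h13 : 2 * ((cγ + 3) * x + R) ^ 2 ≤ q * (4 * (((cγ + 3) * x) ^ 2 + R ^ 2)) := by
      have := mul_le_mul_of_nonneg_right hq1
        (show 0 ≤ 4 * (((cγ + 3) * x) ^ 2 + R ^ 2) by positivity)
      linarith
    have h14 : q * (4 * (((cγ + 3) * x) ^ 2 + R ^ 2)) + 90 * q * (2 * ((6 * x) ^ 2 + R ^ 2)) ≤
        q * (6 * cγ ^ 2 * x ^ 2 + 184 * R ^ 2) := by
      have h15 : (4 * (cγ + 3) ^ 2 + 6480) * x ^ 2 ≤ 6 * cγ ^ 2 * x ^ 2 :=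
        mul_le_mul_of_nonneg_right (by nlinarith) (sq_nonneg x)
      have h16 := mul_le_mul_of_nonneg_left h15 (show 0 ≤ q by linarith)
      linarith
    linarith
  -- The step size condition turns `6 c_γ² x²` into `lam / 4 * x²`, so `5/4 * lam` remains where
  -- `lam` is needed.
  have hw' : γ * w ≤ lam / 4 * x ^ 2 + 184 * (γ * q) * R ^ 2 := by
    have h17 := mul_le_mul_of_nonneg_left hw hγ
    have h18 := mul_le_mul_of_nonneg_right hm (show 0 ≤ 6 * x ^ 2 by positivity)
    linarith
  have hfin : -(2 * inner ℝ e v) + γ * w ≤ -(lam * x ^ 2) +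
      (128 / lam * (r ^ 2 * R ^ 2) + 184 * (γ * q) * R ^ 2) := by
    have : 0 ≤ lam * x ^ 2 := by positivity
    linarith
  have h19 := mul_le_mul_of_nonneg_left hfin hγ
  have h20 : (1 - (1 - γ * lam)) * (128 / lam ^ 2 * r ^ 2 * R ^ 2 + 184 / lam * (γ * q) * R ^ 2) =
      γ * (128 / lam * (r ^ 2 * R ^ 2) + 184 * (γ * q) * R ^ 2) := by
    field_simp
    ring
  rw [h20]
  linarith

end StepSize

namespace Algorithm

variable {S A : Type*} {m d : ℕ} (alg : Algorithm S A m d) (M : CMDP S A)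

lemma criticIterate_append (g : Signal) (xs : List (InnerSample S A)) (x : InnerSample S A) :
    alg.criticIterate M g (xs ++ [x]) = alg.criticIterate M g xs - alg.γξ •
      mlmc alg.Tmax (M.criticDirectionAt alg.φ alg.cγ g (alg.criticIterate M g xs)) x.1 x.2 := by
  simp [criticIterate, List.foldl_append]

lemma criticIterate_eq_zero (h : alg.γξ = 0) (g : Signal) (xs : List (InnerSample S A)) :
    alg.criticIterate M g xs = 0 := by
  induction xs using List.reverseRecOn with
  | nil => rfl
  | append_singleton xs x ih => rw [criticIterate_append, h, zero_smul, sub_zero, ih]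

section Bounded

variable [Fintype S] [Fintype A] [DecidableEq S]

/-- The iterates are bounded surely, by a constant that may grow with the number of steps. This
provides integrability and nothing else. -/
lemma exists_norm_criticIterate_le (hφ : ∀ g s, ‖alg.φ g s‖ ≤ 1) (hc : 0 ≤ alg.cγ) (g : Signal)
    (n : ℕ) : ∃ B, 0 ≤ B ∧ ∀ xs : List (InnerSample S A), xs.length = n →
      ‖alg.criticIterate M g xs‖ ≤ B := by
  have h0 : ∀ z, ‖M.criticDirectionAt alg.φ alg.cγ g 0 z‖ ≤ alg.cγ + 1 := by
    intro z
    rw [CMDP.criticDirectionAt_eq, map_zero, zero_sub, norm_neg]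
    exact M.norm_criticVectorAt_le hφ hc g z
  induction n with
  | zero =>
    refine ⟨0, le_rfl, fun xs hxs => ?_⟩
    rw [List.length_eq_zero_iff.1 hxs]
    simp [criticIterate]
  | succ n ih =>
    obtain ⟨B, hB0, hB⟩ := ih
    refine ⟨B + |alg.γξ| * ((1 + 2 * alg.Tmax) * ((alg.cγ + 3) * B + (alg.cγ + 1))),
      by positivity, fun xs hxs => ?_⟩
    obtain ⟨xs, x, rfl⟩ : ∃ ys y, xs = ys ++ [y] := by
      rcases List.eq_nil_or_concat xs with h | ⟨ys, y, h⟩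
      · simp [h] at hxs
      · exact ⟨ys, y, by simpa using h⟩
    have hB' := hB xs (by simpa using hxs)
    rw [criticIterate_append]
    refine (norm_sub_le _ _).trans (add_le_add hB' ?_)
    rw [norm_smul, Real.norm_eq_abs]
    refine mul_le_mul_of_nonneg_left ?_ (abs_nonneg _)
    refine norm_mlmc_le (by positivity) (fun z => ?_) _ _ _
    refine (M.norm_criticDirectionAt_le hφ hc h0 _ z).trans ?_
    rw [sub_zero]
    gcongr

lemma bddOn_criticIterate (hφ : ∀ g s, ‖alg.φ g s‖ ≤ 1) (hc : 0 ≤ alg.cγ) (g : Signal)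
    (π : S → PMF A) (n : ℕ) (s : S) :
    BddOn (M.innerLaw π alg.Tmax n s) (alg.criticIterate M g) := by
  obtain ⟨B, -, hB⟩ := alg.exists_norm_criticIterate_le M hφ hc g n
  exact ⟨B, fun xs hxs => hB xs (M.length_of_mem_support_innerLaw π _ n s hxs)⟩

end Bounded

/-! ### Recursions for the critic error. -/

section Recursion

variable [Fintype S] [Fintype A] [DecidableEq S] {alg M} {lam : ℝ} {Θ : Set (ParamSpace d)}

/-- The critic error. -/
def criticError (alg : Algorithm S A m d) (M : CMDP S A) (g : Signal) (θ : ParamSpace d)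
    (xs : List (InnerSample S A)) : CriticSpace m :=
  alg.criticIterate M g xs - M.criticTarget alg.φ alg.cγ (alg.π θ) g

lemma criticError_append (g : Signal) (θ : ParamSpace d) (xs : List (InnerSample S A))
    (x : InnerSample S A) :
    alg.criticError M g θ (xs ++ [x]) = alg.criticError M g θ xs - alg.γξ •
      mlmc alg.Tmax (M.criticDirectionAt alg.φ alg.cγ g (alg.criticIterate M g xs)) x.1 x.2 := by
  rw [criticError, criticIterate_append, criticError]
  abel

lemma bddOn_criticError (hφ : ∀ g s, ‖alg.φ g s‖ ≤ 1) (hc : 0 ≤ alg.cγ) (g : Signal)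
    (θ : ParamSpace d) (n : ℕ) (s : S) :
    BddOn (M.innerLaw (alg.π θ) alg.Tmax n s) (alg.criticError M g θ) :=
  (alg.bddOn_criticIterate M hφ hc g _ n s).sub (BddOn.const _ _)

lemma bddOn_mlmc_criticDirection (g : Signal) (ξ : CriticSpace m) (π : S → PMF A) (s : S) :
    BddOn (M.stepLaw π alg.Tmax s)
      (fun x => mlmc alg.Tmax (M.criticDirectionAt alg.φ alg.cγ g ξ) x.1 x.2) := by
  obtain ⟨G, hG⟩ := (Set.finite_range fun z => ‖M.criticDirectionAt alg.φ alg.cγ g ξ z‖).bddAbove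
  exact M.bddOn_stepLaw_mlmc π alg.Tmax (fun z => hG ⟨z, rfl⟩) s

/-- The mean update direction of an inner-loop step from the iterate `ξ` and the state `s`. -/
def meanDirection (alg : Algorithm S A m d) (M : CMDP S A) (g : Signal) (θ : ParamSpace d)
    (ξ : CriticSpace m) (s : S) : CriticSpace m :=
  mean (M.stepLaw (alg.π θ) alg.Tmax s)
    (fun x => mlmc alg.Tmax (M.criticDirectionAt alg.φ alg.cγ g ξ) x.1 x.2)

lemma mean_stepLaw_criticError (g : Signal) (θ : ParamSpace d) (xs : List (InnerSample S A))
    (s : S) :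
    mean (M.stepLaw (alg.π θ) alg.Tmax s) (fun x => alg.criticError M g θ (xs ++ [x])) =
      alg.criticError M g θ xs -
        alg.γξ • alg.meanDirection M g θ (alg.criticIterate M g xs) s := by
  simp_rw [criticError_append]
  rw [mean_sub (BddOn.const _ _) ((bddOn_mlmc_criticDirection g _ _ _).const_smul _), mean_const,
    mean_smul _ (bddOn_mlmc_criticDirection g _ _ _)]
  rfl

lemma mean_stepLaw_criticError_sq (g : Signal) (θ : ParamSpace d) (xs : List (InnerSample S A))
    (s : S) :
    mean (M.stepLaw (alg.π θ) alg.Tmax s) (fun x => ‖alg.criticError M g θ (xs ++ [x])‖ ^ 2) =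
      ‖alg.criticError M g θ xs‖ ^ 2 - 2 * alg.γξ * inner ℝ (alg.criticError M g θ xs)
        (alg.meanDirection M g θ (alg.criticIterate M g xs) s) +
      alg.γξ ^ 2 * mean (M.stepLaw (alg.π θ) alg.Tmax s) fun x =>
        ‖mlmc alg.Tmax (M.criticDirectionAt alg.φ alg.cγ g (alg.criticIterate M g xs))
          x.1 x.2‖ ^ 2 := by
  have h1 : ∀ x : InnerSample S A, ‖alg.criticError M g θ (xs ++ [x])‖ ^ 2 =
      ‖alg.criticError M g θ xs‖ ^ 2 - 2 * alg.γξ * inner ℝ (alg.criticError M g θ xs)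
        (mlmc alg.Tmax (M.criticDirectionAt alg.φ alg.cγ g (alg.criticIterate M g xs)) x.1 x.2) +
      alg.γξ ^ 2 * ‖mlmc alg.Tmax (M.criticDirectionAt alg.φ alg.cγ g
        (alg.criticIterate M g xs)) x.1 x.2‖ ^ 2 := by
    intro x
    rw [criticError_append, norm_sub_sq_real, real_inner_smul_right, norm_smul, mul_pow,
      Real.norm_eq_abs, sq_abs]
    ring
  simp_rw [h1]
  have hv := bddOn_mlmc_criticDirection (alg := alg) (M := M) g (alg.criticIterate M g xs)
    (alg.π θ) s
  have hi := hv.inner_left (alg.criticError M g θ xs)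
  rw [mean_add ((BddOn.const _ _).sub (hi.const_mul _)) (hv.norm_sq.const_mul _),
    mean_sub (BddOn.const _ _) (hi.const_mul _), mean_const, mean_mul _ hi, mean_mul _ hv.norm_sq,
    mean_inner_left _ hv]
  rfl

/-- The standing assumptions of the analysis of the inner loop. -/
structure CriticSetting (alg : Algorithm S A m d) (M : CMDP S A) (lam : ℝ)
    (Θ : Set (ParamSpace d)) : Prop where
  lam_pos : 0 < lam
  large : 100 * (lam + 1 / lam) ≤ alg.cγ
  features : ∀ g s, ‖alg.φ g s‖ ≤ 1
  positive : M.CriticPositive alg.φ alg.π Θ lam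

lemma CriticSetting.cγ_ge (h : CriticSetting alg M lam Θ) : lam + 2 / lam ≤ alg.cγ :=
  (large_bounds h.lam_pos h.large).2.2.2

lemma CriticSetting.cγ_nonneg (h : CriticSetting alg M lam Θ) : 0 ≤ alg.cγ := by
  linarith [(large_bounds h.lam_pos h.large).1]

variable {τ : ℕ} {θ : ParamSpace d}

lemma norm_meanDirection_sub_le (h : CriticSetting alg M lam Θ) (hθ : θ ∈ Θ)
    (hτ : M.MixedBy (alg.π θ) τ) (hT : alg.Tmax ≠ 0) (g : Signal) (xs : List (InnerSample S A))
    (s : S) :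
    ‖alg.meanDirection M g θ (alg.criticIterate M g xs) s -
        M.criticOp alg.φ alg.cγ (alg.π θ) g (alg.criticError M g θ xs)‖ ≤
      4 * τ / alg.Tmax * (6 * ‖alg.criticError M g θ xs‖ + CMDP.residualBound lam alg.cγ) :=
  CMDP.norm_mean_stepLaw_mlmc_sub_le hT hτ
    (M.stationaryMean_criticDirectionAt (alg.π θ) g
      (M.isUnit_det_criticMatrix h.features h.lam_pos h.cγ_ge h.positive hθ g) _)
    (M.norm_criticDirectionAt_sub_le (alg.π θ) h.features
      (M.norm_criticDirectionAt_target_le h.features h.lam_pos h.cγ_ge h.positive hθ g) _) s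

lemma mean_mlmc_norm_sq_le (h : CriticSetting alg M lam Θ) (hθ : θ ∈ Θ)
    (hτ : M.MixedBy (alg.π θ) τ) (hT : alg.Tmax ≠ 0) (g : Signal) (xs : List (InnerSample S A))
    (s : S) :
    mean (M.stepLaw (alg.π θ) alg.Tmax s) (fun x =>
        ‖mlmc alg.Tmax (M.criticDirectionAt alg.φ alg.cγ g (alg.criticIterate M g xs))
          x.1 x.2‖ ^ 2) ≤
      2 * ((alg.cγ + 3) * ‖alg.criticError M g θ xs‖ + CMDP.residualBound lam alg.cγ) ^ 2 +
        60 * τ * (6 * ‖alg.criticError M g θ xs‖ + CMDP.residualBound lam alg.cγ) ^ 2 *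
          Nat.log 2 alg.Tmax :=
  have hR := M.norm_criticDirectionAt_target_le h.features h.lam_pos h.cγ_ge h.positive hθ g
  CMDP.mean_stepLaw_mlmc_norm_sq_le hT hτ
    (M.norm_criticDirectionAt_le h.features h.cγ_nonneg hR _)
    (M.stationaryMean_criticDirectionAt (alg.π θ) g
      (M.isUnit_det_criticMatrix h.features h.lam_pos h.cγ_ge h.positive hθ g) _)
    (M.norm_criticDirectionAt_sub_le (alg.π θ) h.features hR _) s

/-- The stationary level of the mean squared critic error. -/
def errorLevel (lam R r γq : ℝ) : ℝ :=
  128 / lam ^ 2 * r ^ 2 * R ^ 2 + 184 / lam * γq * R ^ 2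

/-- The mean squared error of the critic iterates. -/
theorem mean_criticError_sq_le (h : CriticSetting alg M lam Θ) (hθ : θ ∈ Θ)
    (hτ : M.MixedBy (alg.π θ) τ) (hs : StepSize lam alg.cγ alg.γξ τ alg.Tmax) (g : Signal) (n : ℕ)
    (s : S) :
    mean (M.innerLaw (alg.π θ) alg.Tmax n s) (fun xs => ‖alg.criticError M g θ xs‖ ^ 2) ≤
      (1 - alg.γξ * lam) ^ n * (2 * (alg.cγ + 1) / lam) ^ 2 +
        errorLevel lam (CMDP.residualBound lam alg.cγ) (τ / alg.Tmax)
          (alg.γξ * (τ * Real.log alg.Tmax)) := by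
  have hT : alg.Tmax ≠ 0 := by have := hs.three_le; omega
  have hlam := h.lam_pos
  have hγ := hs.nonneg
  have hℓ := hs.one_le_log
  have hρ : 0 ≤ 1 - alg.γξ * lam := by linarith [hs.mul_lam_le]
  have hD : 0 ≤ errorLevel lam (CMDP.residualBound lam alg.cγ) (τ / alg.Tmax)
      (alg.γξ * (τ * Real.log alg.Tmax)) := by
    have : 0 ≤ Real.log alg.Tmax := by linarith
    rw [errorLevel]
    positivity
  refine (le_pow_mul_add (u := fun n => mean (M.innerLaw (alg.π θ) alg.Tmax n s)
    (fun xs => ‖alg.criticError M g θ xs‖ ^ 2)) hρ hD (fun n => ?_) n).trans ?_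
  · have hb := (bddOn_criticError (M := M) h.features h.cγ_nonneg g θ n s).norm_sq
    have hb' := (bddOn_criticError (M := M) h.features h.cγ_nonneg g θ (n + 1) s).norm_sq
    -- The step bounds hold for every starting state, hence for the state where the earlier
    -- trajectories happened to end. No independence between steps is required.
    have hstep := fun xs : List (InnerSample S A) => hs.second_moment_step
      (M.le_inner_criticOp h.features hlam h.cγ_ge h.positive hθ g (alg.criticError M g θ xs))
      (norm_meanDirection_sub_le h hθ hτ hT g xs (innerEnd s xs))
      (mean_mlmc_norm_sq_le h hθ hτ hT g xs (innerEnd s xs))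
    rw [M.mean_innerLaw_succ _ _ hb']
    refine (mean_mono (M.bddOn_mean_stepLaw _ _ hb') ((hb.const_mul _).add (BddOn.const _ _))
      fun xs _ => (mean_stepLaw_criticError_sq g θ xs _).trans_le (hstep xs)).trans_eq ?_
    rw [mean_add (hb.const_mul _) (BddOn.const _ _), mean_const, mean_mul _ hb]
    rfl
  · gcongr
    simp only [CMDP.innerLaw, mean_pure]
    have h1 := M.norm_criticTarget_le h.features hlam h.cγ_ge h.positive hθ g
    have h2 : ‖alg.criticError M g θ []‖ = ‖M.criticTarget alg.φ alg.cγ (alg.π θ) g‖ := by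
      simp [criticError, criticIterate]
    rw [h2]
    exact pow_le_pow_left₀ (norm_nonneg _) h1 2

/-- A bound for the mean squared critic error that depends only on `λ` and `c_γ`. -/
def errorBound (lam cγ : ℝ) : ℝ :=
  (2 * (cγ + 1) / lam) ^ 2 + 10 * CMDP.residualBound lam cγ ^ 2

/-- With `c_γ ≥ 1` the conditions give `τ / T_max ≤ lam / 8` and `γ τ log T_max ≤ lam / 24`, so the
coefficient of the squared residual is at most `2 + 23/3 < 10`. -/
lemma errorLevel_le (h : StepSize lam alg.cγ alg.γξ τ alg.Tmax) :
    errorLevel lam (CMDP.residualBound lam alg.cγ) (τ / alg.Tmax)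
      (alg.γξ * (τ * Real.log alg.Tmax)) ≤
        10 * CMDP.residualBound lam alg.cγ ^ 2 := by
  obtain ⟨hc, -, -, -⟩ := large_bounds h.lam_pos h.large
  have hlam := h.lam_pos
  have hℓ : 0 ≤ Real.log alg.Tmax := by linarith [h.one_le_log]
  have hγ := h.nonneg
  have hr0 : 0 ≤ τ / (alg.Tmax : ℝ) := by positivity
  have hq0 : 0 ≤ alg.γξ * (τ * Real.log alg.Tmax) := by positivity
  have hc2 : 1 ≤ alg.cγ ^ 2 := by nlinarith
  have h1 : τ / (alg.Tmax : ℝ) ≤ lam / 8 := (le_mul_of_one_le_right hr0 hc2).trans h.ratio_le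
  have h2 : alg.γξ * (τ * Real.log alg.Tmax) ≤ lam / 24 :=
    (le_mul_of_one_le_right hq0 hc2).trans h.mul_le
  rw [errorLevel, ← add_mul]
  refine mul_le_mul_of_nonneg_right ?_ (sq_nonneg _)
  have h3 : 128 / lam ^ 2 * (τ / (alg.Tmax : ℝ)) ^ 2 ≤ 128 / lam ^ 2 * (lam / 8) ^ 2 := by gcongr
  have h4 : 184 / lam * (alg.γξ * (τ * Real.log alg.Tmax)) ≤ 184 / lam * (lam / 24) := by gcongr
  have h5 : 128 / lam ^ 2 * (lam / 8) ^ 2 = 2 := by field_simp; norm_num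
  have h6 : 184 / lam * (lam / 24) = 23 / 3 := by field_simp; norm_num
  linarith

lemma mean_criticError_sq_le_errorBound (h : CriticSetting alg M lam Θ) (hθ : θ ∈ Θ)
    (hτ : M.MixedBy (alg.π θ) τ) (hs : StepSize lam alg.cγ alg.γξ τ alg.Tmax) (g : Signal) (n : ℕ)
    (s : S) :
    mean (M.innerLaw (alg.π θ) alg.Tmax n s) (fun xs => ‖alg.criticError M g θ xs‖ ^ 2) ≤
      errorBound lam alg.cγ := by
  refine (mean_criticError_sq_le h hθ hτ hs g n s).trans (add_le_add ?_ (errorLevel_le hs))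
  have h1 : 0 ≤ alg.γξ * lam := mul_nonneg hs.nonneg hs.lam_pos.le
  exact mul_le_of_le_one_left (sq_nonneg _)
    (pow_le_one₀ (by linarith [hs.mul_lam_le]) (by linarith))

/-- A bound for the bias of the update directions, relative to `τ / T_max`. -/
def biasBound (lam cγ : ℝ) : ℝ := 4 * (3 + 3 * errorBound lam cγ + CMDP.residualBound lam cγ)

lemma biasBound_nonneg (hlam : 0 < lam) {cγ : ℝ} (hc : 0 ≤ cγ) : 0 ≤ biasBound lam cγ := by
  rw [biasBound, errorBound, CMDP.residualBound]
  positivity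

/-- The bias of the critic iterates. -/
theorem norm_mean_criticError_sq_le (h : CriticSetting alg M lam Θ) (hθ : θ ∈ Θ)
    (hτ : M.MixedBy (alg.π θ) τ) (hs : StepSize lam alg.cγ alg.γξ τ alg.Tmax) (g : Signal) (n : ℕ)
    (s : S) :
    ‖mean (M.innerLaw (alg.π θ) alg.Tmax n s) (alg.criticError M g θ)‖ ^ 2 ≤
      (1 - alg.γξ * lam) ^ n * (2 * (alg.cγ + 1) / lam) ^ 2 +
        4 / lam ^ 2 * (τ / alg.Tmax * biasBound lam alg.cγ) ^ 2 := by
  have hT : alg.Tmax ≠ 0 := by have := hs.three_le; omega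
  have hlam := h.lam_pos
  have hγ := hs.nonneg
  have hρ : 0 ≤ 1 - alg.γξ * lam := by linarith [hs.mul_lam_le]
  have hr0 : 0 ≤ τ / (alg.Tmax : ℝ) := by positivity
  refine (le_pow_mul_add (u := fun n => ‖mean (M.innerLaw (alg.π θ) alg.Tmax n s)
    (alg.criticError M g θ)‖ ^ 2) (D := 4 / lam ^ 2 * (τ / alg.Tmax * biasBound lam alg.cγ) ^ 2)
    hρ (by positivity) (fun n => ?_) n).trans ?_
  · set p := M.innerLaw (alg.π θ) alg.Tmax n s
    set L := M.criticOp alg.φ alg.cγ (alg.π θ) g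
    have hb : BddOn p (alg.criticError M g θ) := bddOn_criticError h.features h.cγ_nonneg g θ n s
    have hb' := bddOn_criticError (M := M) h.features h.cγ_nonneg g θ (n + 1) s
    -- `b` is the conditional bias of the direction. Since `L` is linear, averaging turns the step
    -- into the same recursion for the mean error with `mean p b` as its only perturbation.
    set b : List (InnerSample S A) → CriticSpace m := fun xs =>
      alg.meanDirection M g θ (alg.criticIterate M g xs) (innerEnd s xs) -
        L (alg.criticError M g θ xs) with hbdef
    -- The inequality `6 x ≤ 3 + 3 x²` replaces the norm of the error by its square, whose mean is
    -- already bounded uniformly in `n`.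
    have hble : ∀ xs, ‖b xs‖ ≤ τ / alg.Tmax * (4 * (3 + CMDP.residualBound lam alg.cγ) +
        12 * ‖alg.criticError M g θ xs‖ ^ 2) := fun xs => by
      refine (norm_meanDirection_sub_le h hθ hτ hT g xs (innerEnd s xs)).trans ?_
      rw [mul_div_assoc, mul_comm 4, mul_assoc]
      refine mul_le_mul_of_nonneg_left ?_ hr0
      nlinarith [sq_nonneg (‖alg.criticError M g θ xs‖ - 1)]
    have hrhs : BddOn p fun xs => τ / alg.Tmax * (4 * (3 + CMDP.residualBound lam alg.cγ) +
        12 * ‖alg.criticError M g θ xs‖ ^ 2) :=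
      ((BddOn.const _ _).add (hb.norm_sq.const_mul _)).const_mul _
    have hbb : BddOn p b := by
      obtain ⟨B, hB⟩ := hrhs
      exact ⟨B, fun xs hxs => (hble xs).trans ((le_abs_self _).trans (hB xs hxs))⟩
    have hmean : mean (M.innerLaw (alg.π θ) alg.Tmax (n + 1) s) (alg.criticError M g θ) =
        mean p (alg.criticError M g θ) - alg.γξ • (L (mean p (alg.criticError M g θ)) +
          mean p b) := by
      rw [M.mean_innerLaw_succ _ _ hb']
      have h1 : ∀ xs ∈ p.support, mean (M.stepLaw (alg.π θ) alg.Tmax (innerEnd s xs))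
          (fun x => alg.criticError M g θ (xs ++ [x])) = alg.criticError M g θ xs -
            alg.γξ • (L (alg.criticError M g θ xs) + b xs) := fun xs _ => by
        rw [mean_stepLaw_criticError, hbdef, add_sub_cancel]
      rw [mean_congr h1, mean_sub hb (((hb.clm L).add hbb).const_smul _),
        mean_smul _ ((hb.clm L).add hbb), mean_add (hb.clm L) hbb, mean_clm L hb]
    have hbn : ‖mean p b‖ ≤ τ / alg.Tmax * biasBound lam alg.cγ := by
      refine (norm_mean_le_mean_norm hbb).trans ((mean_mono hbb.norm hrhs fun xs _ =>
        hble xs).trans ?_)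
      rw [mean_mul _ ((BddOn.const _ _).add (hb.norm_sq.const_mul _)),
        mean_add (BddOn.const _ _) (hb.norm_sq.const_mul _), mean_const, mean_mul _ hb.norm_sq]
      refine mul_le_mul_of_nonneg_left ?_ hr0
      have := mean_criticError_sq_le_errorBound h hθ hτ hs g n s
      rw [biasBound]
      linarith
    have hγc : alg.γξ * (alg.cγ + 3) ^ 2 ≤ lam / 12 := by
      obtain ⟨hc, -, -, -⟩ := large_bounds h.lam_pos h.large
      have h2 : (alg.cγ + 3) ^ 2 ≤ 2 * alg.cγ ^ 2 := by nlinarith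
      have h3 : 1 ≤ τ * Real.log alg.Tmax :=
        one_le_mul_of_one_le_of_one_le hs.tau_ge hs.one_le_log
      have h4 : alg.γξ * 1 * alg.cγ ^ 2 ≤ alg.γξ * (τ * Real.log alg.Tmax) * alg.cγ ^ 2 := by
        gcongr
      have h5 := mul_le_mul_of_nonneg_left h2 hγ
      linarith [hs.mul_le]
    rw [hmean]
    refine (norm_sub_smul_add_sq_le hγ hlam hs.mul_lam_le hγc
      (M.le_inner_criticOp h.features hlam h.cγ_ge h.positive hθ g _)
      (M.norm_criticOp_le _ h.features h.cγ_nonneg g _)).trans ?_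
    rw [sub_sub_cancel]
    have h6 : ‖mean p b‖ ^ 2 ≤ (τ / alg.Tmax * biasBound lam alg.cγ) ^ 2 :=
      pow_le_pow_left₀ (norm_nonneg _) hbn 2
    exact add_le_add le_rfl (mul_le_mul_of_nonneg_left
      (mul_le_mul_of_nonneg_left h6 (by positivity)) (mul_nonneg hγ hlam.le))
  · gcongr
    simp only [CMDP.innerLaw, mean_pure]
    have h1 := M.norm_criticTarget_le h.features hlam h.cγ_ge h.positive hθ g
    have h2 : ‖alg.criticError M g θ []‖ = ‖M.criticTarget alg.φ alg.cγ (alg.π θ) g‖ := by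
      simp [criticError, criticIterate]
    rw [h2]
    exact h1

/-! ### From the recursions to the stated rates. -/

/-- The constant of the error bounds. -/
def criticConstant (lam cγ : ℝ) : ℝ :=
  (2 * (cγ + 1) / lam) ^ 2 + (16 / lam + 368 / lam ^ 2) * CMDP.residualBound lam cγ ^ 2 +
    4 / lam ^ 2 * biasBound lam cγ ^ 2 + 1

lemma criticConstant_pos (hlam : 0 < lam) (cγ : ℝ) : 0 < criticConstant lam cγ := by
  rw [criticConstant]
  positivity

/-- The conditions on the inputs of the algorithm. -/
structure InputConditions (alg : Algorithm S A m d) (M : CMDP S A) (lam : ℝ)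
    (Θ : Set (ParamSpace d)) (T : ℕ) : Prop where
  ergodic : M.Ergodic
  one_le_T : 1 ≤ T
  one_le_H : 1 ≤ alg.H
  step_eq : alg.γξ = 2 * Real.log T / (lam * alg.H)
  step_le : alg.γξ ≤ lam / (24 * alg.cγ ^ 2 * M.tauMix alg.π Θ * Real.log alg.Tmax)
  le_Tmax : 8 * alg.cγ ^ 2 * M.tauMix alg.π Θ / lam ≤ alg.Tmax

variable {T : ℕ}

/-- If `T = 1`, the step size vanishes and the critic never moves. Otherwise it is positive, so its
upper bound cannot be a division by zero; this excludes `tauMix = 0`, in particular the default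
value of an unbounded supremum. -/
lemma InputConditions.dichotomy (h : CriticSetting alg M lam Θ)
    (hi : InputConditions alg M lam Θ T) :
    (alg.γξ = 0 ∧ T = 1) ∨
      (M.tauMix alg.π Θ ≠ 0 ∧ StepSize lam alg.cγ alg.γξ (M.tauMix alg.π Θ) alg.Tmax) := by
  have hlam := h.lam_pos
  have hT : (1 : ℝ) ≤ T := by exact_mod_cast hi.one_le_T
  have hH : (1 : ℝ) ≤ alg.H := by exact_mod_cast hi.one_le_H
  have hlog := Real.log_nonneg hT
  rcases hi.one_le_T.eq_or_lt with h1 | h1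
  · left
    refine ⟨?_, h1.symm⟩
    rw [hi.step_eq, ← h1]
    simp
  · right
    have hlogpos : 0 < Real.log T := Real.log_pos (by exact_mod_cast h1)
    have hγ : 0 < alg.γξ := by
      rw [hi.step_eq]
      positivity
    have hden : 0 < 24 * alg.cγ ^ 2 * M.tauMix alg.π Θ * Real.log alg.Tmax := by
      have h2 := hγ.trans_le hi.step_le
      exact (div_pos_iff_of_pos_left hlam).1 h2
    have hτ : M.tauMix alg.π Θ ≠ 0 := by
      intro h0
      rw [h0] at hden
      simp at hden
    refine ⟨hτ, hlam, h.large, hγ.le, Nat.one_le_iff_ne_zero.2 hτ, ?_, ?_⟩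
    · exact (le_div_iff₀ hden).1 hi.step_le
    · have := (div_le_iff₀ hlam).1 hi.le_Tmax
      linarith

lemma log_factor_ge (T Tmax : ℕ) :
    1 ≤ (1 + Real.log T) * (1 + Real.log Tmax) ∧
      Real.log T * Real.log Tmax ≤ (1 + Real.log T) * (1 + Real.log Tmax) := by
  have h1 : 0 ≤ Real.log T := Real.log_natCast_nonneg T
  have h2 : 0 ≤ Real.log Tmax := Real.log_natCast_nonneg Tmax
  constructor <;> nlinarith [mul_nonneg h1 h2]

/-- By the choice of the step size, `H γ lam = 2 log T`, and `1 - x ≤ exp (-x)`. -/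
lemma contraction_pow_le (h : CriticSetting alg M lam Θ) (hi : InputConditions alg M lam Θ T)
    (hs : StepSize lam alg.cγ alg.γξ (M.tauMix alg.π Θ) alg.Tmax) :
    (1 - alg.γξ * lam) ^ alg.H ≤ 1 / (T : ℝ) ^ 2 := by
  have hlam := h.lam_pos
  have hT : (0 : ℝ) < T := by exact_mod_cast hi.one_le_T
  have hH : (0 : ℝ) < alg.H := by exact_mod_cast hi.one_le_H
  have h1 : 0 ≤ 1 - alg.γξ * lam := by linarith [hs.mul_lam_le]
  have h2 : 1 - alg.γξ * lam ≤ Real.exp (-(alg.γξ * lam)) := by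
    linarith [Real.add_one_le_exp (-(alg.γξ * lam))]
  have h3 : (alg.H : ℝ) * -(alg.γξ * lam) = -(((2 : ℕ) : ℝ) * Real.log T) := by
    rw [hi.step_eq]
    push_cast
    field_simp
  calc (1 - alg.γξ * lam) ^ alg.H ≤ Real.exp (-(alg.γξ * lam)) ^ alg.H :=
        pow_le_pow_left₀ h1 h2 _
    _ = 1 / (T : ℝ) ^ 2 := by
        rw [← Real.exp_nat_mul, h3, Real.exp_neg, ← Real.log_pow, Real.exp_log (by positivity),
          one_div]

/-- The mean squared error of the critic output. -/
theorem critic_second_moment (h : CriticSetting alg M lam Θ) (hi : InputConditions alg M lam Θ T)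
    (hθ : θ ∈ Θ) (g : Signal) (s : S) :
    mean (M.innerLaw (alg.π θ) alg.Tmax alg.H s) (fun xs => ‖alg.criticError M g θ xs‖ ^ 2) ≤
      criticConstant lam alg.cγ * ((1 + Real.log T) * (1 + Real.log alg.Tmax)) ^ 1 *
        (1 / (T : ℝ) ^ 2 + (M.tauMix alg.π Θ : ℝ) / alg.H +
          (M.tauMix alg.π Θ : ℝ) / alg.Tmax) := by
  have hlam := h.lam_pos
  obtain ⟨hL1, hL2⟩ := log_factor_ge T alg.Tmax
  rw [pow_one]
  set L := (1 + Real.log T) * (1 + Real.log alg.Tmax) with hL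
  set τ := M.tauMix alg.π Θ with hτ
  set X := (2 * (alg.cγ + 1) / lam) ^ 2 with hX
  set R := CMDP.residualBound lam alg.cγ with hR
  have hX0 : 0 ≤ X := sq_nonneg _
  have hb0 : 0 ≤ 4 / lam ^ 2 * biasBound lam alg.cγ ^ 2 := by positivity
  have hCX : X ≤ criticConstant lam alg.cγ := by
    have : 0 ≤ (16 / lam + 368 / lam ^ 2) * R ^ 2 := by positivity
    rw [criticConstant]
    linarith
  have hC0 := criticConstant_pos hlam alg.cγ
  have hH : (1 : ℝ) ≤ alg.H := by exact_mod_cast hi.one_le_H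
  -- When `T = 1` the error is `‖ξ^*‖²`, and the term `1 / T² = 1` alone covers it.
  rcases hi.dichotomy h with ⟨h0, rfl⟩ | ⟨hτ0, hs⟩
  · have h1 : mean (M.innerLaw (alg.π θ) alg.Tmax alg.H s)
        (fun xs => ‖alg.criticError M g θ xs‖ ^ 2) ≤ X := by
      simp_rw [criticError, criticIterate_eq_zero _ _ h0, zero_sub, norm_neg]
      rw [mean_const]
      exact pow_le_pow_left₀ (norm_nonneg _)
        (M.norm_criticTarget_le h.features hlam h.cγ_ge h.positive hθ g) 2
    have h2 : 1 ≤ 1 / ((1 : ℕ) : ℝ) ^ 2 + (τ : ℝ) / alg.H + (τ : ℝ) / alg.Tmax := by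
      have h3 : 0 ≤ (τ : ℝ) / alg.H := by positivity
      have h4 : 0 ≤ (τ : ℝ) / alg.Tmax := by positivity
      norm_num
      linarith
    calc _ ≤ X := h1
      _ ≤ criticConstant lam alg.cγ := hCX
      _ = criticConstant lam alg.cγ * 1 * 1 := by ring
      _ ≤ _ := by gcongr
  · refine (mean_criticError_sq_le h hθ (M.mixedBy_tauMix hi.ergodic alg.π hτ0 hθ) hs g alg.H
      s).trans ?_
    have hpow := contraction_pow_le h hi hs
    obtain ⟨hc, -, -, -⟩ := large_bounds hlam h.large
    have hr0 : 0 ≤ (τ : ℝ) / alg.Tmax := by positivity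
    have hr1 : (τ : ℝ) / alg.Tmax ≤ lam / 8 :=
      (le_mul_of_one_le_right hr0 (by nlinarith)).trans hs.ratio_le
    have h1 : (1 - alg.γξ * lam) ^ alg.H * X ≤ X * L * (1 / (T : ℝ) ^ 2) := by
      calc _ ≤ 1 / (T : ℝ) ^ 2 * X := mul_le_mul_of_nonneg_right hpow hX0
        _ = X * 1 * (1 / (T : ℝ) ^ 2) := by ring
        _ ≤ _ := by gcongr
    -- One of the two factors `τ / T_max` is traded for `lam / 8`; this yields the linear rate.
    have h2 : 128 / lam ^ 2 * ((τ : ℝ) / alg.Tmax) ^ 2 * R ^ 2 ≤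
        16 / lam * R ^ 2 * L * ((τ : ℝ) / alg.Tmax) := by
      calc 128 / lam ^ 2 * ((τ : ℝ) / alg.Tmax) ^ 2 * R ^ 2 =
            128 / lam ^ 2 * R ^ 2 * ((τ : ℝ) / alg.Tmax) * ((τ : ℝ) / alg.Tmax) := by ring
        _ ≤ 128 / lam ^ 2 * R ^ 2 * (lam / 8) * ((τ : ℝ) / alg.Tmax) := by gcongr
        _ = 16 / lam * R ^ 2 * 1 * ((τ : ℝ) / alg.Tmax) := by field_simp; ring
        _ ≤ _ := by gcongr
    -- Inserting the value of the step size produces `τ / H` times `log T * log T_max`, which is the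
    -- source of the logarithmic factor.
    have h3 : 184 / lam * (alg.γξ * (τ * Real.log alg.Tmax)) * R ^ 2 ≤
        368 / lam ^ 2 * R ^ 2 * L * ((τ : ℝ) / alg.H) := by
      calc 184 / lam * (alg.γξ * (τ * Real.log alg.Tmax)) * R ^ 2 =
            368 / lam ^ 2 * R ^ 2 * (Real.log T * Real.log alg.Tmax) * ((τ : ℝ) / alg.H) := by
              rw [hi.step_eq]
              have : (alg.H : ℝ) ≠ 0 := by positivity
              field_simp
              ring
        _ ≤ _ := by gcongr
    rw [errorLevel]
    set a := 1 / (T : ℝ) ^ 2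
    set b := (τ : ℝ) / alg.H
    set c := (τ : ℝ) / alg.Tmax
    have ha : 0 ≤ a := by positivity
    have hb : 0 ≤ b := by positivity
    have hX' : X * L * a ≤ criticConstant lam alg.cγ * L * a := by gcongr
    have hc' : 16 / lam * R ^ 2 * L * c ≤ criticConstant lam alg.cγ * L * c := by
      gcongr
      rw [criticConstant]
      have : 0 ≤ 368 / lam ^ 2 * R ^ 2 := by positivity
      linarith
    have hb' : 368 / lam ^ 2 * R ^ 2 * L * b ≤ criticConstant lam alg.cγ * L * b := by
      gcongr
      rw [criticConstant]
      have : 0 ≤ 16 / lam * R ^ 2 := by positivity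
      linarith
    linarith

/-- The bias of the critic output. -/
theorem critic_bias (h : CriticSetting alg M lam Θ) (hi : InputConditions alg M lam Θ T)
    (hθ : θ ∈ Θ) (g : Signal) (s : S) :
    ‖mean (M.innerLaw (alg.π θ) alg.Tmax alg.H s) (alg.criticError M g θ)‖ ^ 2 ≤
      criticConstant lam alg.cγ * ((1 + Real.log T) * (1 + Real.log alg.Tmax)) ^ 1 *
        (1 / (T : ℝ) ^ 2 + (M.tauMix alg.π Θ : ℝ) ^ 2 / alg.Tmax) := by
  have hlam := h.lam_pos
  obtain ⟨hL1, -⟩ := log_factor_ge T alg.Tmax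
  rw [pow_one]
  set L := (1 + Real.log T) * (1 + Real.log alg.Tmax) with hL
  set τ := M.tauMix alg.π Θ with hτ
  set X := (2 * (alg.cγ + 1) / lam) ^ 2 with hX
  have hX0 : 0 ≤ X := sq_nonneg _
  have hW0 := biasBound_nonneg hlam h.cγ_nonneg
  set W := biasBound lam alg.cγ with hW
  have hCX : X + 4 / lam ^ 2 * W ^ 2 ≤ criticConstant lam alg.cγ := by
    have : 0 ≤ (16 / lam + 368 / lam ^ 2) * CMDP.residualBound lam alg.cγ ^ 2 := by positivity
    rw [criticConstant]
    linarith
  have hb0 : 0 ≤ 4 / lam ^ 2 * W ^ 2 := by positivity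
  have hC0 := criticConstant_pos hlam alg.cγ
  rcases hi.dichotomy h with ⟨h0, rfl⟩ | ⟨hτ0, hs⟩
  · have h1 : ‖mean (M.innerLaw (alg.π θ) alg.Tmax alg.H s) (alg.criticError M g θ)‖ ^ 2 ≤ X := by
      have h2 : alg.criticError M g θ = fun _ => -M.criticTarget alg.φ alg.cγ (alg.π θ) g := by
        ext1 xs
        rw [criticError, criticIterate_eq_zero _ _ h0, zero_sub]
      rw [h2, mean_const, norm_neg]
      exact pow_le_pow_left₀ (norm_nonneg _)
        (M.norm_criticTarget_le h.features hlam h.cγ_ge h.positive hθ g) 2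
    have h2 : 1 ≤ 1 / ((1 : ℕ) : ℝ) ^ 2 + (τ : ℝ) ^ 2 / alg.Tmax := by
      have h4 : 0 ≤ (τ : ℝ) ^ 2 / alg.Tmax := by positivity
      norm_num
      linarith
    calc _ ≤ X := h1
      _ ≤ criticConstant lam alg.cγ := by linarith
      _ = criticConstant lam alg.cγ * 1 * 1 := by ring
      _ ≤ _ := by gcongr
  · refine (norm_mean_criticError_sq_le h hθ (M.mixedBy_tauMix hi.ergodic alg.π hτ0 hθ) hs g alg.H
      s).trans ?_
    have hpow := contraction_pow_le h hi hs
    have hT1 : (1 : ℝ) ≤ alg.Tmax := by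
      have := hs.three_le
      exact_mod_cast (by omega : 1 ≤ alg.Tmax)
    have hsq : ((τ : ℝ) / alg.Tmax) ^ 2 ≤ (τ : ℝ) ^ 2 / alg.Tmax := by
      rw [div_pow]
      gcongr
      nlinarith
    have h1 : (1 - alg.γξ * lam) ^ alg.H * X ≤ criticConstant lam alg.cγ * L * (1 / (T : ℝ) ^ 2) := by
      calc _ ≤ 1 / (T : ℝ) ^ 2 * X := mul_le_mul_of_nonneg_right hpow hX0
        _ = X * 1 * (1 / (T : ℝ) ^ 2) := by ring
        _ ≤ _ := by
          gcongr
          linarith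
    have h2 : 4 / lam ^ 2 * ((τ : ℝ) / alg.Tmax * W) ^ 2 ≤
        criticConstant lam alg.cγ * L * ((τ : ℝ) ^ 2 / alg.Tmax) := by
      calc 4 / lam ^ 2 * ((τ : ℝ) / alg.Tmax * W) ^ 2 =
            4 / lam ^ 2 * W ^ 2 * 1 * ((τ : ℝ) / alg.Tmax) ^ 2 := by ring
        _ ≤ _ := by
          gcongr
          linarith
    linarith

end Recursion

end Algorithm

/-! ### Conditioning on the history -/

section Run

lemma bind_congr_support {α β : Type*} {p : PMF α} {f g : α → PMF β}
    (h : ∀ a ∈ p.support, f a = g a) : p.bind f = p.bind g := by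
  ext b
  rw [PMF.bind_apply, PMF.bind_apply]
  refine tsum_congr fun a => ?_
  by_cases ha : p a = 0
  · simp [ha]
  · rw [h a ((p.mem_support_iff a).2 ha)]

lemma ae_toMeasure_iff {α : Type*} [MeasurableSpace α] [DiscreteMeasurableSpace α] (p : PMF α)
    {P : α → Prop} : (∀ᵐ a ∂p.toMeasure, P a) ↔ ∀ a ∈ p.support, P a := by
  rw [ae_iff, PMF.toMeasure_apply_eq_zero_iff _ MeasurableSet.of_discrete, Set.disjoint_left]
  simp

variable {S A : Type*}

instance : DiscreteMeasurableSpace (Run S A) := ⟨fun _ => trivial⟩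

/-- The part of a run before epoch `k`. -/
def runPrefix (k : ℕ) (ω : Run S A) : Run S A := (ω.1, ω.2.take k)

/-- The data of epoch `k`. -/
def epochData (k : ℕ) (ω : Run S A) : EpochSample S A := ω.2.getD k ([], [])

/-- The run followed by one more epoch. -/
def runSnoc (ω : Run S A) (e : EpochSample S A) : Run S A := (ω.1, ω.2 ++ [e])

/-- The run without epochs that starts at `s`. -/
def runStart (s : S) : Run S A := (s, [])

lemma runPrefix_runPrefix {k n : ℕ} (h : k ≤ n) (ω : Run S A) :
    runPrefix k (runPrefix n ω) = runPrefix k ω :=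
  Prod.ext rfl (by simp [runPrefix, List.take_take, h])

lemma epochData_runPrefix {k n : ℕ} (h : k < n) (ω : Run S A) :
    epochData k (runPrefix n ω) = epochData k ω := by
  simp [runPrefix, epochData, List.getD_eq_getElem?_getD, h]

namespace Algorithm

variable {m d : ℕ} (alg : Algorithm S A m d) (M : CMDP S A)

/-- The law of the epoch that follows the run `ω`. -/
def epochKernel (ω : Run S A) : PMF (EpochSample S A) :=
  alg.epochLaw M (alg.stateAfter M ω.1 ω.2)

lemma runLaw_zero : alg.runLaw M 0 = M.ρ.map runStart := rfl

lemma runLaw_succ (k : ℕ) : alg.runLaw M (k + 1) =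
    (alg.runLaw M k).bind fun ω => (alg.epochKernel M ω).map (runSnoc ω) := rfl

lemma length_of_mem_support_runLaw (k : ℕ) {ω : Run S A} (h : ω ∈ (alg.runLaw M k).support) :
    ω.2.length = k := by
  induction k generalizing ω with
  | zero =>
    rw [runLaw_zero, PMF.mem_support_map_iff] at h
    obtain ⟨s, -, rfl⟩ := h
    rfl
  | succ k ih =>
    rw [runLaw_succ, PMF.mem_support_bind_iff] at h
    obtain ⟨ω', h', h⟩ := h
    rw [PMF.mem_support_map_iff] at h
    obtain ⟨e, -, rfl⟩ := h
    simp [runSnoc, ih h']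

/-- Later epochs are appended without altering earlier ones, so the laws of runs of different
lengths are consistent. -/
lemma runLaw_map_runPrefix {n K : ℕ} (h : n ≤ K) :
    (alg.runLaw M K).map (runPrefix n) = alg.runLaw M n := by
  induction K, h using Nat.le_induction with
  | base =>
    conv_rhs => rw [← PMF.bind_pure (alg.runLaw M n)]
    refine bind_congr_support fun ω hω => ?_
    have hl := alg.length_of_mem_support_runLaw M n hω
    rw [Function.comp, runPrefix, List.take_of_length_le hl.le]
    rfl
  | succ K hK ih =>
    rw [runLaw_succ, PMF.map_bind]
    conv_rhs => rw [← ih, PMF.map]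
    refine bind_congr_support fun ω hω => ?_
    have hl := alg.length_of_mem_support_runLaw M K hω
    rw [PMF.map_comp]
    have h1 : (runPrefix n ∘ runSnoc ω) =
        Function.const _ (runPrefix n ω) := by
      ext1 e
      have h2 : (ω.2 ++ [e]).take n = ω.2.take n := List.take_append_of_le_length (by omega)
      exact Prod.ext rfl h2
    rw [h1, PMF.map_const]
    rfl

section Mean

variable {V : Type*} [NormedAddCommGroup V] [NormedSpace ℝ V]

lemma bddOn_runLaw_succ {k K : ℕ} (hk : k < K) {Ψ : Run S A → EpochSample S A → V}
    (hb : BddOn (alg.runLaw M K) fun ω => Ψ (runPrefix k ω) (epochData k ω)) :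
    BddOn (alg.runLaw M (k + 1)) fun ω => Ψ (runPrefix k ω) (epochData k ω) := by
  rw [← alg.runLaw_map_runPrefix M (Nat.succ_le_of_lt hk)]
  apply BddOn.map
  simp_rw [runPrefix_runPrefix (Nat.le_succ k), epochData_runPrefix (Nat.lt_succ_self k)]
  exact hb

lemma runPrefix_epochData_append {k : ℕ} {ω : Run S A} (hω : ω ∈ (alg.runLaw M k).support)
    (e : EpochSample S A) : runPrefix k (runSnoc ω e) = ω ∧ epochData k (runSnoc ω e) = e := by
  have hl := alg.length_of_mem_support_runLaw M k hω
  constructor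
  · have h2 : (ω.2 ++ [e]).take k = ω.2 := by rw [← hl]; exact List.take_left
    exact Prod.ext rfl h2
  · change (ω.2 ++ [e]).getD k _ = e
    rw [List.getD_append_right _ _ _ _ hl.le, hl]
    simp

variable [CompleteSpace V]

lemma bddOn_mean_epochKernel {k K : ℕ} (hk : k < K) {Ψ : Run S A → EpochSample S A → V}
    (hb : BddOn (alg.runLaw M K) fun ω => Ψ (runPrefix k ω) (epochData k ω)) :
    BddOn (alg.runLaw M K) fun ω =>
      mean (alg.epochKernel M (runPrefix k ω)) (Ψ (runPrefix k ω)) := by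
  have h1 := alg.bddOn_runLaw_succ M hk hb
  rw [runLaw_succ] at h1
  obtain ⟨C, hC⟩ := h1
  refine ⟨C, fun ω hω => norm_mean_le fun e he => ?_⟩
  have hω' : runPrefix k ω ∈ (alg.runLaw M k).support := by
    rw [← alg.runLaw_map_runPrefix M hk.le]
    exact (PMF.mem_support_map_iff _ _ _).2 ⟨ω, hω, rfl⟩
  have h2 := hC (runSnoc (runPrefix k ω) e)
    ((PMF.mem_support_bind_iff _ _ _).2 ⟨_, hω', (PMF.mem_support_map_iff _ _ _).2 ⟨e, he, rfl⟩⟩)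
  obtain ⟨h3, h4⟩ := alg.runPrefix_epochData_append M hω' e
  beta_reduce at h2
  rwa [h3, h4] at h2

/-- By consistency both sides reduce to shorter runs: the left to `k + 1` epochs, the last of which
is drawn from the kernel at the prefix, and the right to `k` epochs. -/
lemma mean_runLaw_eq {k K : ℕ} (hk : k < K) {Ψ : Run S A → EpochSample S A → V}
    (hb : BddOn (alg.runLaw M K) fun ω => Ψ (runPrefix k ω) (epochData k ω)) :
    mean (alg.runLaw M K) (fun ω => Ψ (runPrefix k ω) (epochData k ω)) =
      mean (alg.runLaw M K) fun ω =>
        mean (alg.epochKernel M (runPrefix k ω)) (Ψ (runPrefix k ω)) := by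
  have h1 := alg.bddOn_runLaw_succ M hk hb
  have hm := alg.bddOn_mean_epochKernel M hk hb
  have hL : mean (alg.runLaw M K) (fun ω => Ψ (runPrefix k ω) (epochData k ω)) =
      mean (alg.runLaw M (k + 1)) (fun ω => Ψ (runPrefix k ω) (epochData k ω)) := by
    rw [← alg.runLaw_map_runPrefix M (Nat.succ_le_of_lt hk), mean_map]
    · simp_rw [runPrefix_runPrefix (Nat.le_succ k), epochData_runPrefix (Nat.lt_succ_self k)]
    · simp_rw [runPrefix_runPrefix (Nat.le_succ k), epochData_runPrefix (Nat.lt_succ_self k)]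
      exact hb
  have hR : mean (alg.runLaw M k) (fun ω => mean (alg.epochKernel M ω) (Ψ ω)) =
      mean (alg.runLaw M K) fun ω =>
        mean (alg.epochKernel M (runPrefix k ω)) (Ψ (runPrefix k ω)) := by
    rw [← alg.runLaw_map_runPrefix M hk.le, mean_map hm]
  rw [hL, ← hR]
  rw [runLaw_succ] at h1 ⊢
  rw [mean_bind h1]
  refine mean_congr fun ω hω => ?_
  rw [mean_map (h1.of_bind hω).of_map]
  refine mean_congr fun e _ => ?_
  obtain ⟨h3, h4⟩ := alg.runPrefix_epochData_append M hω e
  rw [h3, h4]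

/-- The conditional expectation given the history is the mean over the epoch law. -/
theorem condExp_history [SecondCountableTopology V] {k K : ℕ} (hk : k < K)
    {Ψ : Run S A → EpochSample S A → V}
    (hb : BddOn (alg.runLaw M K) fun ω => Ψ (runPrefix k ω) (epochData k ω)) :
    (alg.runMeasure M K)[fun ω => Ψ (runPrefix k ω) (epochData k ω) | history S A k]
      =ᵐ[alg.runMeasure M K] fun ω =>
        mean (alg.epochKernel M (runPrefix k ω)) (Ψ (runPrefix k ω)) := by
  have hm : history S A k ≤ (inferInstance : MeasurableSpace (Run S A)) := fun _ _ => trivial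
  have hprob : IsProbabilityMeasure (alg.runMeasure M K) := PMF.toMeasure.isProbabilityMeasure _
  have hg := alg.bddOn_mean_epochKernel M hk hb
  symm
  refine ae_eq_condExp_of_forall_setIntegral_eq hm (integrable_toMeasure hb)
    (fun s _ _ => (integrable_toMeasure hg).integrableOn) (fun s hs _ => ?_) ?_
  · obtain ⟨B, -, rfl⟩ := hs
    classical
    have hind : ∀ f : Run S A → V, BddOn (alg.runLaw M K) f → BddOn (alg.runLaw M K)
        (((fun ω : Run S A => (ω.1, ω.2.take k)) ⁻¹' B).indicator f) := by
      rintro f ⟨C, hC⟩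
      exact ⟨C, fun ω hω => (norm_indicator_le_norm_self _ _).trans (hC ω hω)⟩
    rw [← integral_indicator MeasurableSet.of_discrete,
      ← integral_indicator MeasurableSet.of_discrete, runMeasure,
      integral_toMeasure (hind _ hg), integral_toMeasure (hind _ hb)]
    -- An event of the history depends only on the prefix, so its indicator can be absorbed into `Ψ`
    -- and taken out of the inner mean.
    have hΨ := alg.mean_runLaw_eq M hk
      (Ψ := fun ω e => if (ω : S × List (EpochSample S A)) ∈ B then Ψ ω e else 0) (hind _ hb)
    refine Eq.trans ?_ hΨ.symm
    refine mean_congr fun ω _ => ?_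
    by_cases hω : (runPrefix k ω : S × List (EpochSample S A)) ∈ B
    · rw [Set.indicator_of_mem (by exact hω)]
      simp only [if_pos hω]
    · rw [Set.indicator_of_notMem (by exact hω)]
      simp only [if_neg hω, mean_const]
  · borelize V
    -- The history is pulled back from the full σ-algebra, so every function of the prefix is
    -- measurable for it.
    let G : S × List (EpochSample S A) → V := fun x => mean (alg.epochKernel M x) (Ψ x)
    have h1 : @Measurable _ _ (history S A k) _
        (G ∘ fun ω : Run S A => (ω.1, ω.2.take k)) :=
      (measurable_from_top (f := G)).comp (comap_measurable _)
    exact (h1.stronglyMeasurable).aestronglyMeasurable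

end Mean

section Critic

variable [Fintype S] [Fintype A] [DecidableEq S] {alg M}

/-- The actor steps are drawn after the critic steps and integrate out. -/
lemma mean_epochKernel_fst {V : Type*} [NormedAddCommGroup V] [NormedSpace ℝ V] [CompleteSpace V]
    (ω : Run S A) {F : List (InnerSample S A) → V}
    (hF : BddOn (M.innerLaw (alg.π (alg.stateAfter M ω.1 ω.2).θ) alg.Tmax alg.H
      (alg.stateAfter M ω.1 ω.2).state) F) :
    mean (alg.epochKernel M ω) (fun e => F e.1) =
      mean (M.innerLaw (alg.π (alg.stateAfter M ω.1 ω.2).θ) alg.Tmax alg.H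
        (alg.stateAfter M ω.1 ω.2).state) F := by
  rw [epochKernel, epochLaw, mean_bind]
  · refine mean_congr fun cs hcs => ?_
    exact (mean_map (f := fun e : EpochSample S A => F e.1) (BddOn.const _ (F cs))).trans
      (mean_const _ (F cs))
  · obtain ⟨C, hC⟩ := hF
    refine ⟨C, fun e he => ?_⟩
    rw [PMF.mem_support_bind_iff] at he
    obtain ⟨cs, hcs, he⟩ := he
    rw [PMF.mem_support_map_iff] at he
    obtain ⟨as, -, rfl⟩ := he
    exact hC cs hcs

lemma length_epochData {k K : ℕ} (hk : k < K) {ω : Run S A}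
    (hω : ω ∈ (alg.runLaw M K).support) : (epochData k ω).1.length = alg.H := by
  have h1 : runPrefix (k + 1) ω ∈ (alg.runLaw M (k + 1)).support := by
    rw [← alg.runLaw_map_runPrefix M (Nat.succ_le_of_lt hk)]
    exact (PMF.mem_support_map_iff _ _ _).2 ⟨ω, hω, rfl⟩
  rw [← epochData_runPrefix (Nat.lt_succ_self k)]
  rw [runLaw_succ, PMF.mem_support_bind_iff] at h1
  obtain ⟨ω', hω', h1⟩ := h1
  rw [PMF.mem_support_map_iff] at h1
  obtain ⟨e, he, h1⟩ := h1
  rw [← h1, (alg.runPrefix_epochData_append M hω' e).2]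
  rw [epochKernel, epochLaw, PMF.mem_support_bind_iff] at he
  obtain ⟨cs, hcs, he⟩ := he
  rw [PMF.mem_support_map_iff] at he
  obtain ⟨as, -, rfl⟩ := he
  exact M.length_of_mem_support_innerLaw _ _ _ _ hcs

end Critic

end Algorithm

end Run

end PDNAC

end

/-! ### Assembly of the theorem. -/

theorem mainTheorem4 :
    ∃ (p : ℕ) (κ : ℝ), ∀ lam cγ : ℝ, 0 < lam → κ * (lam + 1 / lam) ≤ cγ → ∃ C : ℝ, 0 < C ∧
      ∀ (S : Type*) (A : Type*) [Fintype S] [DecidableEq S] [Fintype A]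
        (M : PDNAC.CMDP S A) (m d : ℕ) (alg : PDNAC.Algorithm S A m d)
        (Θ : Set (PDNAC.ParamSpace d)) (K T : ℕ),
        M.Ergodic →
        (∀ g s, ‖alg.φ g s‖ ≤ 1) →
        M.CriticPositive alg.φ alg.π Θ lam →
        (∀ k < K, ∀ᵐ ω ∂alg.runMeasure M K, alg.theta M k ω ∈ Θ) →
        alg.cγ = cγ →
        alg.δ ∈ Set.Ioo (0 : ℝ) 1 →
        1 ≤ T →
        1 ≤ alg.H →
        alg.γξ = 2 * Real.log T / (lam * alg.H) →
        alg.γξ ≤ lam / (24 * cγ ^ 2 * M.tauMix alg.π Θ * Real.log alg.Tmax) →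
        8 * cγ ^ 2 * M.tauMix alg.π Θ / lam ≤ alg.Tmax →
        ∀ (g : PDNAC.Signal) (k : ℕ), k < K →
          (∀ θ ∈ Θ, IsUnit (M.criticMatrix alg.φ alg.cγ (alg.π θ) g).det) ∧
          Integrable (alg.xi M g k) (alg.runMeasure M K) ∧
          Integrable (fun ω => ‖alg.xi M g k ω -
            M.criticTarget alg.φ alg.cγ (alg.π (alg.theta M k ω)) g‖ ^ 2)
            (alg.runMeasure M K) ∧
          (∀ᵐ ω ∂alg.runMeasure M K,
            ‖((alg.runMeasure M K)[alg.xi M g k | PDNAC.history S A k]) ω -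
                M.criticTarget alg.φ alg.cγ (alg.π (alg.theta M k ω)) g‖ ^ 2 ≤
              C * ((1 + Real.log T) * (1 + Real.log alg.Tmax)) ^ p *
                (1 / (T : ℝ) ^ 2 + (M.tauMix alg.π Θ : ℝ) ^ 2 / alg.Tmax)) ∧
          (∀ᵐ ω ∂alg.runMeasure M K,
            ((alg.runMeasure M K)[fun ω => ‖alg.xi M g k ω -
                M.criticTarget alg.φ alg.cγ (alg.π (alg.theta M k ω)) g‖ ^ 2 |
                PDNAC.history S A k]) ω ≤
              C * ((1 + Real.log T) * (1 + Real.log alg.Tmax)) ^ p *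
                (1 / (T : ℝ) ^ 2 + (M.tauMix alg.π Θ : ℝ) / alg.H +
                  (M.tauMix alg.π Θ : ℝ) / alg.Tmax)) := by
  open PDNAC in
  refine ⟨1, 100, fun lam cγ hlam hlarge => ⟨Algorithm.criticConstant lam cγ,
    Algorithm.criticConstant_pos hlam cγ, ?_⟩⟩
  intro S A _ _ _ M m d alg Θ K T hM hφ hpos hΘ hcγ _ hT hH hγ hγle hTmax g k hk
  subst hcγ
  have h : alg.CriticSetting M lam Θ := ⟨hlam, hlarge, hφ, hpos⟩
  have hi : alg.InputConditions M lam Θ T := ⟨hM, hT, hH, hγ, hγle, hTmax⟩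
  have hmem := (ae_toMeasure_iff _).1 (hΘ k hk)
  have hξ : BddOn (alg.runLaw M K) (alg.xi M g k) := by
    obtain ⟨B, -, hB⟩ := alg.exists_norm_criticIterate_le M hφ h.cγ_nonneg g alg.H
    exact ⟨B, fun ω hω => hB _ (Algorithm.length_epochData hk hω)⟩
  -- The targets are bounded only over `Θ`, so the almost sure membership of `θ_k` is first turned
  -- into membership on the support of the run law.
  have hξs : BddOn (alg.runLaw M K)
      (fun ω => M.criticTarget alg.φ alg.cγ (alg.π (alg.theta M k ω)) g) :=
    ⟨_, fun ω hω => M.norm_criticTarget_le hφ hlam h.cγ_ge hpos (hmem ω hω) g⟩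
  have hsq := (hξ.sub hξs).norm_sq
  refine ⟨fun θ hθ => M.isUnit_det_criticMatrix hφ hlam h.cγ_ge hpos hθ g,
    integrable_toMeasure hξ, integrable_toMeasure hsq, ?_, ?_⟩
  · have hc := alg.condExp_history M hk (Ψ := fun _ e => alg.criticIterate M g e.1) hξ
    filter_upwards [hc, hΘ k hk] with ω hω hθ
    have hb := alg.bddOn_criticIterate M hφ h.cγ_nonneg g (alg.π (alg.theta M k ω)) alg.H
      (alg.stateAfter M ω.1 (ω.2.take k)).state
    have h1 : ((alg.runMeasure M K)[alg.xi M g k | PDNAC.history S A k]) ω =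
        mean (M.innerLaw (alg.π (alg.theta M k ω)) alg.Tmax alg.H
          (alg.stateAfter M ω.1 (ω.2.take k)).state) (alg.criticIterate M g) :=
      hω.trans (Algorithm.mean_epochKernel_fst (runPrefix k ω) hb)
    rw [h1]
    have h2 := Algorithm.critic_bias h hi hθ g (alg.stateAfter M ω.1 (ω.2.take k)).state
    have h3 := mean_sub hb
      (BddOn.const _ (M.criticTarget alg.φ alg.cγ (alg.π (alg.theta M k ω)) g))
    rw [mean_const] at h3
    rw [← h3]
    exact h2
  · have hc := alg.condExp_history M hk (Ψ := fun ω' e => ‖alg.criticIterate M g e.1 -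
      M.criticTarget alg.φ alg.cγ (alg.π (alg.stateAfter M ω'.1 ω'.2).θ) g‖ ^ 2) hsq
    filter_upwards [hc, hΘ k hk] with ω hω hθ
    have hb := (Algorithm.bddOn_criticError (alg := alg) (M := M) hφ h.cγ_nonneg g
      (alg.theta M k ω) alg.H (alg.stateAfter M ω.1 (ω.2.take k)).state).norm_sq
    refine (hω.trans (Algorithm.mean_epochKernel_fst (runPrefix k ω) hb)).trans_le ?_
    exact Algorithm.critic_second_moment h hi hθ g (alg.stateAfter M ω.1 (ω.2.take k)).state
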